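/- Fix an integer $n\ge 2$ and equip $\mathbb R^{n+2}$ with the form $\langle\cdot,\cdot\rangle$ with quadratic form $q(u,v,x_1,\dots,x_n)=-u^2-v^2+x_1^2+\dots+x_n^2$. Let $O(2,n)$ be its isometry group, $O_0(2,n)$ the identity component, $\mathsf{Ein}_{1,n-1}\subset\mathbb P(\mathbb R^{n+2})$ the set of isotropic lines, $\mathsf{AdS}_{1,n}\subset\mathbb P(\mathbb R^{n+2})$ the set of negative lines, and $\overline{\mathsf{AdS}}_{1,n}=\mathsf{AdS}_{1,n}\cup\mathsf{Ein}_{1,n-1}$. The lightlike cone of $p\in\mathsf{Ein}_{1,n-1}$ is $p^\perp\cap\mathsf{Ein}_{1,n-1}$. *Causal geodesics.* A causal geodesic is given by a $2$-plane $P\subset\mathbb R^{n+2}$ as the set $\varphi=\mathbb P(P)\cap\overline{\mathsf{AdS}}_{1,n}$; it is a timelike geodesic of $\mathsf{AdS}_{1,n}$ if $q|_P$ is negative definite, a lightlike geodesic of $\mathsf{AdS}_{1,n}$ (with its endpoint in $\mathsf{Ein}_{1,n-1}$) if $q|_P$ is negative semidefinite, degenerate and nonzero, and a lightlike geodesic of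 $\mathsf{Ein}_{1,n-1}$ if $q|_P=0$. The space $\mathcal C$ of causal geodesics carries the topology of the Grassmannian $\mathrm{Gr}_2(\mathbb R^{n+2})$. Let $\mathcal T\subset\mathcal C$ be the space of timelike geodesics (the usual model of the Riemannian symmetric space of $O_0(2,n)$ in the Grassmannian). *Anosov representations.* Every $g\in O(2,n)$ can be written $g=k\,a\,l$ with $k,l\in O(2,n)\cap O(n+2)$ and $a$ conjugate, by a fixed change of basis to isotropic vectors, to $\mathrm{diag}(e^{\lambda},e^{\mu},1,\dots,1,e^{-\mu},e^{-\lambda})$ for unique $\lambda\ge\mu\ge0$ (so that $e^\lambda,e^\mu$ are the two largest singular values of $g$). A sequence $(g_i)$ in $O_0(2,n)$ is $P_1$-divergent if $\lambda_i-\mu_i\to+\infty$. Let $\Gamma$ be a finitely generated Gromov hyperbolic group with Gromov boundary $\partial\Gamma$. A homomorphism $\rho:\Gamma\to O_0(2,n)$ is $P_1$-Anosov with boundary map $\xi:\partial\Gamma\to\mathsf{Ein}_{1,n-1}$ if every sequence of pairwise distinct elements of $\rho(\Gamma)$ is $P_1$-divergent, and $\xi$ is continuous, $\rho$-equivariant,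 transverse (for $\eta\ne\eta'$, $\xi(\eta)$ is not in the lightlike cone of $\xi(\eta')$), and dynamics-preserving (if $\eta$ is the attracting fixed point of $\gamma\in\Gamma$ in $\partial\Gamma$, i.e. $\gamma^k\to\eta$ in $\Gamma\cup\partial\Gamma$ as $k\to+\infty$, then $\xi(\eta)$ is an attracting fixed point of $\rho(\gamma)$ in $\mathsf{Ein}_{1,n-1}$, i.e. it is fixed and the positive powers of $\rho(\gamma)$ converge to it uniformly on some neighbourhood of it). **Theorem.** Let $\Gamma$ be a hyperbolic group, let $\rho:\Gamma\to O_0(2,n)$ be $P_1$-Anosov with boundary map $\xi:\partial\Gamma\to\mathsf{Ein}_{1,n-1}$, and let $$U=\{\varphi\in\mathcal C:\ \varphi\cap\xi(\partial\Gamma)=\emptyset\}$$ be the space of causal geodesics that avoid the limit set $\xi(\partial\Gamma)$. Then the action of $\rho(\Gamma)$ on $U$ is properly discontinuous (for all compact $K,L\subset U$ only finitely many $g\in\rho(\Gamma)$ satisfy $gK\cap L\neq\emptyset$) and cocompact ($\rho(\Gamma)\backslash U$ is compact). Moreover $U$ contains $\mathcal T$, and $\rho(\Gamma)\backslash U$ is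 a compactification of the locally symmetric quotient $\rho(\Gamma)\backslash\mathcal T$: it is a compact Hausdorff space, and the map $\rho(\Gamma)\backslash\mathcal T\to\rho(\Gamma)\backslash U$ induced by the inclusion is an open topological embedding with dense image. -/

import Mathlib

open Filter Topology
open scoped LinearAlgebra.Projectivization

noncomputable section

namespace CausalGeod

/-! ### Hyperbolic groups and their Gromov boundary -/

section Hyperbolic

variable {Γ : Type*} [Group Γ]

/-- The word metric on `Γ` for the set `S`: the graph distance in the Cayley graph. -/
def wordDist (S : Finset Γ) (g h : Γ) : ℕ :=
  (SimpleGraph.mulCayley (S : Set Γ)).dist g h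

/-- The Gromov product `(g | h)_w` for the word metric. -/
def gromovProduct (S : Finset Γ) (w g h : Γ) : ℝ :=
  ((wordDist S g w : ℝ) + wordDist S h w - wordDist S g h) / 2

/-- The finite set `S` generates `Γ`, and the word metric of `S` is Gromov hyperbolic
(four-point condition). -/
structure IsHyperbolicGroup (S : Finset Γ) : Prop where
  generates : Subgroup.closure (S : Set Γ) = ⊤
  hyperbolic : ∃ δ : ℝ, ∀ w x y z : Γ,
    min (gromovProduct S w x y) (gromovProduct S w y z) - δ ≤ gromovProduct S w x z

/-- Geodesic rays of the Cayley graph (as sequences of vertices, from any starting vertex). -/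
@[ext]
structure GeodesicRay (S : Finset Γ) where
  vertex : ℕ → Γ
  isGeodesic : ∀ i k : ℕ, wordDist S (vertex i) (vertex (i + k)) = k

/-- Pointwise convergence of rays, the group being discrete. -/
instance (S : Finset Γ) : TopologicalSpace (GeodesicRay S) :=
  TopologicalSpace.induced GeodesicRay.vertex (@Pi.topologicalSpace ℕ (fun _ => Γ) (fun _ => ⊥))

/-- Two rays are asymptotic when they stay at bounded distance from each other. The distance is
taken in `ℕ∞`; in a connected Cayley graph it is the word metric. -/
def asymptoticSetoid (S : Finset Γ) : Setoid (GeodesicRay S) where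
  r f g := ∃ C : ℕ, ∀ i, (SimpleGraph.mulCayley (S : Set Γ)).edist (f.vertex i) (g.vertex i) ≤ C
  iseqv :=
    { refl := fun f => ⟨0, fun i => by simp⟩
      symm := fun ⟨C, h⟩ => ⟨C, fun i => by rw [SimpleGraph.edist_comm]; exact h i⟩
      trans := fun {_ g _} ⟨C, h⟩ ⟨D, k⟩ => ⟨C + D, fun i => by
        refine (SimpleGraph.edist_triangle (v := g.vertex i)).trans ?_
        push_cast
        exact add_le_add (h i) (k i)⟩ }

/-- The Gromov boundary `∂Γ`: asymptotic classes of geodesic rays, with the quotient topology. -/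
def GromovBoundary (S : Finset Γ) : Type _ := Quotient (asymptoticSetoid S)

instance (S : Finset Γ) : TopologicalSpace (GromovBoundary S) :=
  inferInstanceAs (TopologicalSpace (Quotient (asymptoticSetoid S)))

lemma edist_mul_left_le (S : Finset Γ) (a g h : Γ) :
    (SimpleGraph.mulCayley (S : Set Γ)).edist (a * g) (a * h) ≤
      (SimpleGraph.mulCayley (S : Set Γ)).edist g h := by
  by_cases hr : (SimpleGraph.mulCayley (S : Set Γ)).Reachable g h
  · obtain ⟨p, hp⟩ := hr.exists_walk_length_eq_edist
    let φ : SimpleGraph.mulCayley (S : Set Γ) →g SimpleGraph.mulCayley (S : Set Γ) :=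
      ⟨fun x => a * x, fun hxy => SimpleGraph.mulCayley_adj_mul_iff_right.2 hxy⟩
    rw [← hp, ← SimpleGraph.Walk.length_map φ p]
    exact SimpleGraph.edist_le _
  · rw [SimpleGraph.edist_eq_top_of_not_reachable hr]
    exact le_top

lemma edist_mul_left (S : Finset Γ) (a g h : Γ) :
    (SimpleGraph.mulCayley (S : Set Γ)).edist (a * g) (a * h) =
      (SimpleGraph.mulCayley (S : Set Γ)).edist g h := by
  refine le_antisymm (edist_mul_left_le S a g h) ?_
  simpa using edist_mul_left_le S a⁻¹ (a * g) (a * h)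

lemma wordDist_mul_left (S : Finset Γ) (a g h : Γ) :
    wordDist S (a * g) (a * h) = wordDist S g h := by
  simp only [wordDist, SimpleGraph.dist, edist_mul_left]

/-- `Γ` acts on geodesic rays by left translation. -/
instance (S : Finset Γ) : MulAction Γ (GeodesicRay S) where
  smul a f := ⟨fun i => a * f.vertex i, fun i k => by rw [wordDist_mul_left]; exact f.isGeodesic i k⟩
  one_smul f := GeodesicRay.ext (funext fun i => one_mul (f.vertex i))
  mul_smul a b f := GeodesicRay.ext (funext fun i => mul_assoc a b (f.vertex i))

/-- The action of `Γ` on its Gromov boundary, `a • [f] = [a • f]`. -/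
instance (S : Finset Γ) : MulAction Γ (GromovBoundary S) where
  smul a := Quotient.map (fun f => a • f)
    (fun _ _ ⟨C, h⟩ => ⟨C, fun i => (edist_mul_left S a _ _).le.trans (h i)⟩)
  one_smul η := Quotient.inductionOn η fun f => congrArg (Quotient.mk _) (one_smul Γ f)
  mul_smul a b η := Quotient.inductionOn η fun f => congrArg (Quotient.mk _) (mul_smul a b f)

/-- `η` is the attracting fixed point of `γ` in `∂Γ`: the powers `γ ^ k` converge to `η` in
`Γ ∪ ∂Γ`, i.e. `(γ ^ k | f m)_1 → ∞` as `k, m → ∞` for a ray `f` representing `η`. This forces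
`γ` to have infinite order and to fix `η`. -/
def IsBoundaryAttractingPoint (S : Finset Γ) (γ : Γ) (η : GromovBoundary S) : Prop :=
  ∃ f : GeodesicRay S, (Quotient.mk (asymptoticSetoid S) f : GromovBoundary S) = η ∧
    Tendsto (fun p : ℕ × ℕ => gromovProduct S 1 (γ ^ p.1) (f.vertex p.2)) atTop atTop

end Hyperbolic

/-! ### The space `ℝ^{2,n}`, its isometry group and the Einstein universe -/

/-- The vector space `ℝ^{n+2}`, with coordinates `(u, v, x₁, …, xₙ)`. -/
abbrev R2n (n : ℕ) : Type := EuclideanSpace ℝ (Fin 2 ⊕ Fin n)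

variable {n : ℕ}

/-- The bilinear form of signature `(2, n)` (two minus signs). -/
def bil (x y : R2n n) : ℝ :=
  -(∑ i : Fin 2, x (Sum.inl i) * y (Sum.inl i)) + ∑ j : Fin n, x (Sum.inr j) * y (Sum.inr j)

/-- The quadratic form `q(u, v, x) = -u² - v² + x₁² + ⋯ + xₙ²`. -/
def quad (x : R2n n) : ℝ := bil x x

/-- The topological group of invertible (continuous) linear maps of `ℝ^{n+2}`. -/
abbrev GL2n (n : ℕ) : Type := (R2n n →L[ℝ] R2n n)ˣ

variable (n) in
/-- The group `O(2,n)` of linear isometries. -/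
def O2n : Subgroup (GL2n n) where
  carrier := {g | ∀ x y : R2n n, bil (g.1 x) (g.1 y) = bil x y}
  one_mem' _ _ := rfl
  mul_mem' {g h} hg hh x y := (hg _ _).trans (hh x y)
  inv_mem' {g} hg x y := by
    have key : ∀ z, g.1 (g⁻¹.1 z) = z := fun z => DFunLike.congr_fun g.mul_inv z
    rw [← hg, key, key]

/-- `O_0(2,n)`, the identity component of `O(2,n)`. -/
def O0 (n : ℕ) : Type := Subgroup.connectedComponentOfOne (O2n n)

instance : Group (O0 n) := inferInstanceAs (Group (Subgroup.connectedComponentOfOne (O2n n)))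

/-- The inclusion of `O_0(2,n)` in the group of invertible linear maps. -/
def O0.toGL (g : O0 n) : GL2n n := g.1.1

/-- The linear action of `O_0(2,n)` on `ℝ^{n+2}`. -/
instance : DistribMulAction (O0 n) (R2n n) where
  smul g x := g.toGL.1 x
  one_smul _ := rfl
  mul_smul _ _ _ := rfl
  smul_zero g := map_zero g.toGL.1
  smul_add g := map_add g.toGL.1

instance : SMulCommClass (O0 n) ℝ (R2n n) := ⟨fun g a x => map_smul g.toGL.1 a x⟩

lemma bil_smul (g : O0 n) (x y : R2n n) : bil (g • x) (g • y) = bil x y := g.1.2 x y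

lemma quad_smul (g : O0 n) (x : R2n n) : quad (g • x) = quad x := bil_smul g x x

/-- The usual quotient topology on the projective space `P(ℝ^{n+2})`. -/
instance : TopologicalSpace (ℙ ℝ (R2n n)) :=
  TopologicalSpace.coinduced (fun v : {v : R2n n // v ≠ 0} => Projectivization.mk' ℝ v)
    inferInstance

lemma mem_smul_submodule (g : O0 n) (p : ℙ ℝ (R2n n)) (v : R2n n) :
    v ∈ (g • p).submodule ↔ g⁻¹ • v ∈ p.submodule := by
  induction p using Projectivization.ind with
  | h w hw =>
    rw [Projectivization.smul_mk, Projectivization.submodule_mk, Projectivization.submodule_mk,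
      Submodule.mem_span_singleton, Submodule.mem_span_singleton]
    refine exists_congr fun a => ?_
    rw [eq_inv_smul_iff, smul_comm g a w]

variable (n) in
/-- The Einstein universe `Ein_{1,n-1}`: the isotropic lines of `ℝ^{2,n}`, in projective space. -/
def Ein : SubMulAction (O0 n) (ℙ ℝ (R2n n)) where
  carrier := {p | ∀ v ∈ p.submodule, quad v = 0}
  smul_mem' g p hp v hv := by
    rw [← quad_smul g⁻¹]; exact hp _ ((mem_smul_submodule g p v).1 hv)

variable (n) in
/-- `AdS ∪ ∂AdS` in projective space, `AdS` being the set of negative lines. -/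
def AdSBar : Set (ℙ ℝ (R2n n)) := {p | ∀ v ∈ p.submodule, quad v ≤ 0}

/-- The lightlike cone of a point `p` of the Einstein universe, `p^⊥ ∩ Ein`. -/
def lightCone (p : Ein n) : Set (Ein n) :=
  {x | ∀ v ∈ p.1.submodule, ∀ w ∈ x.1.submodule, bil v w = 0}

/-! ### `P_1`-divergence and `P_1`-Anosov representations -/

/-- The coordinate vector for `u` (`i = 0`) or `v` (`i = 1`). -/
def eNeg (i : Fin 2) : R2n n := EuclideanSpace.single (Sum.inl i) 1

/-- The coordinate vector for `x_{j+1}`. -/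
def ePos (j : Fin n) : R2n n := EuclideanSpace.single (Sum.inr j) 1

/-- The maximal compact subgroup `O(2,n) ∩ O(n+2)`. -/
def maxCompact (n : ℕ) : Set (GL2n n) := {k | k ∈ O2n n ∧ ∀ x : R2n n, ‖k.1 x‖ = ‖x‖}

/-- `a` is the element of the Weyl chamber with parameters `t 0 = λ ≥ t 1 = μ ≥ 0`: it is
diagonal, with entries `e^λ, e^μ, 1, …, 1, e^{-μ}, e^{-λ}`, in the basis of the isotropic vectors
`x₁ + u`, `x₂ + v`, the vectors `x₃, …, xₙ`, and the isotropic vectors `x₂ - v`, `x₁ - u`. -/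
structure IsWeylElement (a : GL2n n) (t : Fin 2 → ℝ) : Prop where
  chamber : 0 ≤ t 1 ∧ t 1 ≤ t 0
  expand : ∀ (i : Fin 2) (j : Fin n), j.val = i.val →
    a.1 (ePos j + eNeg i) = Real.exp (t i) • (ePos j + eNeg i)
  contract : ∀ (i : Fin 2) (j : Fin n), j.val = i.val →
    a.1 (ePos j - eNeg i) = Real.exp (-t i) • (ePos j - eNeg i)
  fixed : ∀ j : Fin n, 2 ≤ j.val → a.1 (ePos j) = ePos j

/-- `t` is the Cartan projection of `g`: `g = k a l` with `k, l` in the maximal compact subgroup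
and `a` the element of the Weyl chamber with parameters `t`. For `n ≥ 2` every `g` has exactly one
Cartan projection: `t 0` and `t 1` are the logarithms of its two largest singular values. -/
def IsCartanProjection (g : GL2n n) (t : Fin 2 → ℝ) : Prop :=
  ∃ k ∈ maxCompact n, ∃ l ∈ maxCompact n, ∃ a : GL2n n, IsWeylElement a t ∧ g = k * a * l

/-- `P_1`-divergence: `λ_i - μ_i → ∞` for the Cartan projections `(λ_i, μ_i)`. -/
def IsP1Divergent (g : ℕ → O0 n) : Prop :=
  ∃ t : ℕ → Fin 2 → ℝ, (∀ i, IsCartanProjection (g i).toGL (t i)) ∧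
    Tendsto (fun i => t i 0 - t i 1) atTop atTop

/-- `x` is an attracting fixed point of `g` in the Einstein universe: it is fixed, and the powers
of `g` converge to `x` uniformly on a neighbourhood of `x`. -/
def IsAttractingFixedPoint (g : O0 n) (x : Ein n) : Prop :=
  g • x = x ∧ ∃ V ∈ 𝓝 x, Tendsto (fun p : ℕ × Ein n => g ^ p.1 • p.2) (atTop ×ˢ 𝓟 V) (𝓝 x)

/-- `ρ` is `P_1`-Anosov with boundary map `ξ`. -/
structure IsP1Anosov {Γ : Type*} [Group Γ] (S : Finset Γ) (ρ : Γ →* O0 n)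
    (ξ : GromovBoundary S → Ein n) : Prop where
  divergent : ∀ h : ℕ → O0 n, (∀ i, h i ∈ ρ.range) → Function.Injective h → IsP1Divergent h
  continuous : Continuous ξ
  equivariant : ∀ (γ : Γ) (η : GromovBoundary S), ξ (γ • η) = ρ γ • ξ η
  transverse : ∀ η η' : GromovBoundary S, η ≠ η' → ξ η ∉ lightCone (ξ η')
  dynamicsPreserving : ∀ (γ : Γ) (η : GromovBoundary S),
    IsBoundaryAttractingPoint S γ η → IsAttractingFixedPoint (ρ γ) (ξ η)

/-! ### Causal geodesics -/

/-- The Grassmannian of 2-planes of `ℝ^{n+2}`. -/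
@[ext]
structure Gr2 (n : ℕ) where
  plane : Submodule ℝ (R2n n)
  finrank_eq : Module.finrank ℝ plane = 2

/-- The 2-plane spanned by a 2-frame. -/
def frameSpan (v : {v : Fin 2 → R2n n // LinearIndependent ℝ v}) : Gr2 n :=
  ⟨Submodule.span ℝ (Set.range v.1), by simpa using finrank_span_eq_card v.2⟩

/-- The usual topology of the Grassmannian, as a quotient of the space of 2-frames. -/
instance : TopologicalSpace (Gr2 n) := TopologicalSpace.coinduced frameSpan inferInstance

/-- The action of `O_0(2,n)` on 2-planes, `g • P = g(P)`. -/
instance : MulAction (O0 n) (Gr2 n) where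
  smul g P := ⟨P.plane.map (DistribMulAction.toLinearEquiv ℝ (R2n n) g).toLinearMap, by
    rw [LinearEquiv.finrank_map_eq]; exact P.finrank_eq⟩
  one_smul P := Gr2.ext <| by
    ext v
    change v ∈ P.plane.map _ ↔ _
    simp
  mul_smul g h P := Gr2.ext <| by
    ext v
    change v ∈ P.plane.map _ ↔ v ∈ (P.plane.map _).map _
    simp [mul_smul]

lemma mem_smul_plane (g : O0 n) (P : Gr2 n) (v : R2n n) :
    v ∈ (g • P).plane ↔ g⁻¹ • v ∈ P.plane := by
  change v ∈ P.plane.map _ ↔ _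
  rw [Submodule.mem_map]
  constructor
  · rintro ⟨w, hw, rfl⟩
    simpa using hw
  · intro h
    exact ⟨_, h, by simp⟩

/-- The geodesic determined by the 2-plane `P`: the part of the projective line `P(P)` lying in
`AdS ∪ ∂AdS`. -/
def geodesicPoints (P : Gr2 n) : Set (ℙ ℝ (R2n n)) := {p | p ∈ AdSBar n ∧ p.submodule ≤ P.plane}

/-- `P` gives a timelike geodesic of `AdS`: the form is negative definite on `P`. -/
def IsTimelike (P : Gr2 n) : Prop := ∀ v ∈ P.plane, v ≠ 0 → quad v < 0

/-- `P` gives a lightlike geodesic of `AdS`: the form is negative semidefinite on `P`, degenerate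
and nonzero. -/
def IsLightlikeAdS (P : Gr2 n) : Prop :=
  (∀ v ∈ P.plane, quad v ≤ 0) ∧ (∃ v ∈ P.plane, v ≠ 0 ∧ quad v = 0) ∧ ∃ v ∈ P.plane, quad v < 0

/-- `P` gives a lightlike geodesic of `Ein`: `P` is totally isotropic. -/
def IsLightlikeEin (P : Gr2 n) : Prop := ∀ v ∈ P.plane, quad v = 0

lemma IsTimelike.smul {P : Gr2 n} (h : IsTimelike P) (g : O0 n) : IsTimelike (g • P) := by
  intro v hv hv0
  rw [← quad_smul g⁻¹]
  exact h _ ((mem_smul_plane g P v).1 hv) ((smul_ne_zero_iff_ne g⁻¹).2 hv0)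

lemma IsLightlikeEin.smul {P : Gr2 n} (h : IsLightlikeEin P) (g : O0 n) :
    IsLightlikeEin (g • P) := by
  intro v hv
  rw [← quad_smul g⁻¹]
  exact h _ ((mem_smul_plane g P v).1 hv)

lemma IsLightlikeAdS.smul {P : Gr2 n} (h : IsLightlikeAdS P) (g : O0 n) :
    IsLightlikeAdS (g • P) := by
  obtain ⟨h1, ⟨v, hv, hv0, hvq⟩, w, hw, hwq⟩ := h
  refine ⟨fun x hx => ?_, ⟨g • v, ?_, (smul_ne_zero_iff_ne g).2 hv0, by rwa [quad_smul]⟩,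
    g • w, ?_, by rwa [quad_smul]⟩
  · rw [← quad_smul g⁻¹]
    exact h1 _ ((mem_smul_plane g P x).1 hx)
  · rw [mem_smul_plane, inv_smul_smul]; exact hv
  · rw [mem_smul_plane, inv_smul_smul]; exact hw

variable (n) in
/-- The space of timelike geodesics of `AdS_{1,n}`, the model of the Riemannian symmetric space of
`O_0(2,n)` as an open subset of the Grassmannian. -/
def timelikeGeodesics : SubMulAction (O0 n) (Gr2 n) where
  carrier := {P | IsTimelike P}
  smul_mem' g _ hP := IsTimelike.smul hP g

variable (n) in
/-- The space `𝒞` of causal geodesics: timelike and lightlike geodesics of `AdS_{1,n}` and lightlike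
geodesics of `Ein_{1,n-1}`. -/
def causalGeodesics : SubMulAction (O0 n) (Gr2 n) where
  carrier := {P | IsTimelike P ∨ IsLightlikeAdS P ∨ IsLightlikeEin P}
  smul_mem' g _ hP := hP.imp (fun h => h.smul g)
    (fun h => h.imp (fun h => h.smul g) (fun h => h.smul g))

lemma mem_geodesicPoints_smul {g : O0 n} {P : Gr2 n} {p : ℙ ℝ (R2n n)}
    (hp : p ∈ geodesicPoints (g • P)) : g⁻¹ • p ∈ geodesicPoints P := by
  refine ⟨fun v hv => ?_, fun v hv => ?_⟩ <;> rw [mem_smul_submodule, inv_inv] at hv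
  · rw [← quad_smul g]
    exact hp.1 _ hv
  · have := (mem_smul_plane g P _).1 (hp.2 hv)
    rwa [inv_smul_smul] at this

/-- The limit set `ξ(∂Γ)`, as a subset of projective space. -/
def limitSet {Γ : Type*} [Group Γ] {S : Finset Γ} (ξ : GromovBoundary S → Ein n) :
    Set (ℙ ℝ (R2n n)) := Set.range fun η => (ξ η : ℙ ℝ (R2n n))

/-- The space `U` of causal geodesics that avoid `ξ(∂Γ)`, with its action of `ρ(Γ)`. -/
def avoidingGeodesics {Γ : Type*} [Group Γ] {S : Finset Γ} {ρ : Γ →* O0 n}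
    {ξ : GromovBoundary S → Ein n} (h : IsP1Anosov S ρ ξ) :
    SubMulAction ρ.range (Gr2 n) where
  carrier := {P | P ∈ causalGeodesics n ∧ geodesicPoints P ∩ limitSet ξ = ∅}
  smul_mem' g P hP := by
    refine ⟨(causalGeodesics n).smul_mem g.1 hP.1, ?_⟩
    rw [Set.eq_empty_iff_forall_notMem]
    rintro p ⟨hp, η, rfl⟩
    obtain ⟨g, γ, rfl⟩ := g
    refine Set.eq_empty_iff_forall_notMem.1 hP.2 _
      ⟨mem_geodesicPoints_smul (g := ρ γ) hp, γ⁻¹ • η, ?_⟩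
    change (ξ (γ⁻¹ • η) : ℙ ℝ (R2n n)) = _
    rw [h.equivariant, map_inv]
    rfl

end CausalGeod

end

open CausalGeod

open Filter Topology
open scoped LinearAlgebra.Projectivization

noncomputable section

namespace CausalGeod

/-! ### Word metrics, finite balls and limits of geodesic segments -/

section Hyperbolic

variable {Γ : Type*} [Group Γ] {S : Finset Γ}

/-! A causal plane is the graph of a linear map `A` from the negative coordinates `ℝ²` to the
positive coordinates `ℝⁿ` with `‖A‖ ≤ 1`, and it is timelike exactly when `‖A‖ < 1`. So `𝒞` is a
closed ball, `𝒯` is the open ball, and `U` is the closed ball minus a closed set. This gives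
openness and density of `𝒯`, and local compactness of `U`.

Dynamics. By the Cartan decomposition and `P_1`-divergence, elements leaving all finite subsets of
`ρ(Γ)` look, after extraction along an ultrafilter, like rank one maps `s b(F, ·) E` with `E`, `F`
isotropic and an error of size `r`, where `s / r → ∞` (`exists_proximalLimit`). The key fact is that
`E` and `F` lie over the limit set (`IsP1Anosov.limit_mem`), although the hypothesis on `ξ` only
speaks of attracting fixed points of single elements. If `F` were not over the limit set, it would
be orthogonal to all of it. The elements contracting two fixed vectors over the limit set form a set
that is almost invariant under translations on both sides and contains only finitely many powers of
a loxodromic element. Such a set is finite (`finite_of_almost_invariant`), a contradiction.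

Proper discontinuity. If planes `P_i` converge in `U` to a plane that avoids `F`, then `g_i P_i`
accumulates only on planes containing `E`, which are not in `U`.

Cocompactness. The number `|jac g A|` measures how `g` distorts area on the graph of `A`, read in
the negative coordinates, and it satisfies a cocycle rule. A Dirichlet type domain is the set of `A`
with `|jac g A| ≥ 1` for all `g`, which is closed in a ball, hence compact. On a plane avoiding `F`
one direction is stretched at rate `s` and no other is shrunk by more than `r`, so the distortion
tends to infinity (`tendsto_abs_jac`). On a plane of `U` the minimal distortion is therefore
attained, and the minimising element moves the plane into the domain. A plane meeting the limit set
is contracted by some element, because every boundary point of a hyperbolic group is conical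
(`exists_conical_limit`, `exists_abs_jac_lt_one`). So the domain lies in `U` and surjects onto the
quotient. -/

lemma mulCayley_connected (hS : Subgroup.closure (S : Set Γ) = ⊤) :
    (SimpleGraph.mulCayley (S : Set Γ)).Connected := by
  have h1 : ∀ g : Γ, (SimpleGraph.mulCayley (S : Set Γ)).Reachable 1 g := by
    intro g
    have hg : g ∈ Subgroup.closure (S : Set Γ) := by rw [hS]; trivial
    have step : ∀ x s : Γ, s ∈ S → (SimpleGraph.mulCayley (S : Set Γ)).Reachable x (x * s) := by
      intro x s hs
      by_cases h : x = x * s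
      · rw [← h]
      · refine SimpleGraph.Adj.reachable ?_
        rw [SimpleGraph.mulCayley_adj]
        exact ⟨h, Or.inl (by simpa using hs)⟩
    induction hg using Subgroup.closure_induction_right with
    | one => exact SimpleGraph.Reachable.refl _
    | mul_right x hx y hy ih => exact ih.trans (step x y hy)
    | mul_inv_cancel x hx y hy ih =>
      refine ih.trans ?_
      have := step (x * y⁻¹) y hy
      rw [inv_mul_cancel_right] at this
      exact this.symm
  have : Nonempty Γ := ⟨1⟩
  exact ⟨fun x y => (h1 x).symm.trans (h1 y)⟩

lemma wordDist_self (x : Γ) : wordDist S x x = 0 := by simp [wordDist]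

lemma wordDist_comm (x y : Γ) : wordDist S x y = wordDist S y x := SimpleGraph.dist_comm

lemma wordDist_triangle (hS : Subgroup.closure (S : Set Γ) = ⊤) (x y z : Γ) :
    wordDist S x z ≤ wordDist S x y + wordDist S y z :=
  (mulCayley_connected hS).dist_triangle

lemma edist_eq_wordDist (hS : Subgroup.closure (S : Set Γ) = ⊤) (x y : Γ) :
    (SimpleGraph.mulCayley (S : Set Γ)).edist x y = (wordDist S x y : ℕ∞) :=
  (((mulCayley_connected hS).preconnected x y).coe_dist_eq_edist).symm

lemma gromovProduct_comm (w x y : Γ) : gromovProduct S w x y = gromovProduct S w y x := by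
  simp only [gromovProduct, wordDist_comm x y]; ring

lemma gromovProduct_mul_left (a w x y : Γ) :
    gromovProduct S (a * w) (a * x) (a * y) = gromovProduct S w x y := by
  simp only [gromovProduct, wordDist_mul_left]

/-- A vertex at positive distance from `y` has a neighbour closer to `y`. -/
lemma exists_neighbour_closer (hS : Subgroup.closure (S : Set Γ) = ⊤) (x y : Γ) (k : ℕ)
    (h : wordDist S x y = k + 1) : ∃ s : Γ, (s ∈ S ∨ s⁻¹ ∈ S) ∧
      wordDist S x (x * s) = 1 ∧ wordDist S (x * s) y = k := by
  obtain ⟨p, hp⟩ := (mulCayley_connected hS).exists_walk_length_eq_dist x y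
  change p.length = wordDist S x y at hp
  cases p with
  | nil => simp only [SimpleGraph.Walk.length_nil] at hp; omega
  | cons hadj q =>
    rename_i v
    have h1 : wordDist S x v = 1 := SimpleGraph.dist_eq_one_iff_adj.2 hadj
    have h2 : wordDist S v y ≤ q.length := SimpleGraph.dist_le q
    have h3 := wordDist_triangle hS x v y
    rw [SimpleGraph.Walk.length_cons] at hp
    rw [SimpleGraph.mulCayley_adj] at hadj
    refine ⟨x⁻¹ * v, ?_, by simpa using h1, by rw [mul_inv_cancel_left]; omega⟩
    rcases hadj.2 with h | h
    · exact Or.inl h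
    · right
      simpa using h

lemma finite_wordDist_le (hS : Subgroup.closure (S : Set Γ) = ⊤) (x : Γ) (R : ℕ) :
    {g : Γ | wordDist S x g ≤ R}.Finite := by
  induction R generalizing x with
  | zero =>
    refine (Set.finite_singleton x).subset fun g hg => ?_
    have : wordDist S x g = 0 := by simpa using hg
    exact (((mulCayley_connected hS).dist_eq_zero_iff).1 this).symm
  | succ R ih =>
    have hfin : {s : Γ | s ∈ S ∨ s⁻¹ ∈ S}.Finite :=
      (S.finite_toSet.union (S.finite_toSet.preimage inv_injective.injOn)).subset
        (fun s hs => hs)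
    refine ((ih x).union (hfin.biUnion fun s _ => ih (x * s))).subset fun g hg => ?_
    rcases Nat.lt_or_ge (wordDist S x g) (R + 1) with h | h
    · left; change _ ≤ R; omega
    · right
      have hg' : wordDist S x g = R + 1 := le_antisymm hg h
      obtain ⟨s, hs, -, h2⟩ := exists_neighbour_closer hS x g R hg'
      exact Set.mem_biUnion hs h2.le

lemma countable_of_generates (hS : Subgroup.closure (S : Set Γ) = ⊤) : Countable Γ := by
  rw [← Set.countable_univ_iff]
  refine (Set.countable_iUnion fun R : ℕ => (finite_wordDist_le hS (1 : Γ) R).countable).mono ?_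
  intro g _
  exact Set.mem_iUnion.2 ⟨wordDist S 1 g, le_refl (wordDist S 1 g)⟩

/-! ### Geodesic rays and compactness of the Gromov boundary -/

/-- Limits of geodesic segments from `1` to points going to infinity, by König's lemma. -/
lemma exists_limit_ray (hS : Subgroup.closure (S : Set Γ) = ⊤) (y : ℕ → Γ)
    (hy : Tendsto (fun k => wordDist S 1 (y k)) atTop atTop) :
    ∃ f : GeodesicRay S, f.vertex 0 = 1 ∧
      ∀ m, ∃ᶠ k in atTop, wordDist S (f.vertex m) (y k) + m = wordDist S 1 (y k) := by
  -- Vertex `x` sits at depth `m` on geodesics from `1` to infinitely many `y k`. The bound `≤ m` is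
  -- enough, since the second clause and the triangle inequality force equality. Finiteness of `S`
  -- lets one neighbour serve infinitely many `k`.
  let Good : ℕ → Γ → Prop := fun m x =>
    wordDist S 1 x ≤ m ∧ ∃ᶠ k in atTop, wordDist S x (y k) + m = wordDist S 1 (y k)
  have hstep : ∀ m x, Good m x → ∃ x', Good (m + 1) x' ∧ wordDist S x x' = 1 := by
    rintro m x ⟨hx, hfreq⟩
    have hfin : {s : Γ | (s ∈ S ∨ s⁻¹ ∈ S) ∧ wordDist S x (x * s) = 1}.Finite :=
      (S.finite_toSet.union (S.finite_toSet.preimage inv_injective.injOn)).subset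
        (fun s hs => hs.1)
    have h1 : ∃ᶠ k in atTop, ∃ s ∈ {s : Γ | (s ∈ S ∨ s⁻¹ ∈ S) ∧ wordDist S x (x * s) = 1},
        wordDist S (x * s) (y k) + (m + 1) = wordDist S 1 (y k) := by
      refine (hfreq.and_eventually (hy.eventually_ge_atTop (m + 1))).mono ?_
      rintro k ⟨hk, hk'⟩
      obtain ⟨s, hs, h1, h2⟩ := exists_neighbour_closer hS x (y k) (wordDist S 1 (y k) - (m + 1))
        (by omega)
      exact ⟨s, ⟨hs, h1⟩, by omega⟩
    have h2 : ∃ s ∈ {s : Γ | (s ∈ S ∨ s⁻¹ ∈ S) ∧ wordDist S x (x * s) = 1},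
        ∃ᶠ k in atTop, wordDist S (x * s) (y k) + (m + 1) = wordDist S 1 (y k) := by
      by_contra hcon
      push Not at hcon
      refine h1 ?_
      have := (Filter.eventually_all_finite hfin).2 fun s hs => hcon s hs
      refine this.mono fun k hk => ?_
      rintro ⟨s, hs, hk'⟩
      exact hk s hs hk'
    obtain ⟨s, hs, hfr⟩ := h2
    have := wordDist_triangle hS 1 x (x * s)
    exact ⟨x * s, ⟨by have := hs.2; omega, hfr⟩, hs.2⟩
  choose! nxt hnxt using hstep
  let v : ℕ → Γ := fun m => Nat.rec 1 (fun m x => nxt m x) m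
  have hgood : ∀ m, Good m (v m) := by
    intro m
    induction m with
    | zero => exact ⟨by simp [v, wordDist_self], (Eventually.of_forall fun k => by simp [v]).frequently⟩
    | succ m ih => exact (hnxt m (v m) ih).1
  have hadj : ∀ m, wordDist S (v m) (v (m + 1)) = 1 := fun m => (hnxt m (v m) (hgood m)).2
  have hle : ∀ i k, wordDist S (v i) (v (i + k)) ≤ k := by
    intro i k
    induction k with
    | zero => simp [wordDist_self]
    | succ k ih =>
      have h1 := wordDist_triangle hS (v i) (v (i + k)) (v (i + (k + 1)))
      have h2 := hadj (i + k)
      rw [← add_assoc] at h1 ⊢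
      omega
  have hnorm : ∀ m, wordDist S 1 (v m) = m := by
    intro m
    refine le_antisymm (hgood m).1 ?_
    obtain ⟨k, hk⟩ := (hgood m).2.exists
    have := wordDist_triangle hS 1 (v m) (y k)
    omega
  refine ⟨⟨v, fun i k => le_antisymm (hle i k) ?_⟩, rfl, fun m => (hgood m).2⟩
  have := wordDist_triangle hS 1 (v i) (v (i + k))
  rw [hnorm, hnorm] at this
  omega

/-- Two rays of the same class stay at bounded distance. -/
lemma asymptotic_iff (hS : Subgroup.closure (S : Set Γ) = ⊤) (f g : GeodesicRay S) :
    (Quotient.mk (asymptoticSetoid S) f : GromovBoundary S) = Quotient.mk _ g ↔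
      ∃ C : ℕ, ∀ i, wordDist S (f.vertex i) (g.vertex i) ≤ C := by
  rw [Quotient.eq]
  change (∃ C : ℕ, ∀ i, _ ≤ _) ↔ _
  simp only [edist_eq_wordDist hS, Nat.cast_le]

lemma GeodesicRay.dist_of_le (f : GeodesicRay S) {i k : ℕ} (h : i ≤ k) :
    (wordDist S (f.vertex i) (f.vertex k) : ℝ) = k - i := by
  obtain ⟨j, rfl⟩ := Nat.exists_eq_add_of_le h
  rw [f.isGeodesic]; push_cast; ring

lemma GeodesicRay.dist_one (f : GeodesicRay S) (hf : f.vertex 0 = 1) (k : ℕ) :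
    wordDist S 1 (f.vertex k) = k := by
  have := f.isGeodesic 0 k
  rwa [hf, zero_add] at this

lemma wordDist_triangle_real (hS : Subgroup.closure (S : Set Γ) = ⊤) (x y z : Γ) :
    (wordDist S x z : ℝ) ≤ wordDist S x y + wordDist S y z := by
  exact_mod_cast wordDist_triangle hS x y z

lemma IsHyperbolicGroup.exists_nonneg (h : IsHyperbolicGroup S) : ∃ δ : ℝ, 0 ≤ δ ∧
    ∀ w x y z : Γ,
    min (gromovProduct S w x y) (gromovProduct S w y z) - δ ≤ gromovProduct S w x z := by
  obtain ⟨δ, hδ⟩ := h.hyperbolic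
  refine ⟨max δ 0, le_max_right _ _, fun w x y z => ?_⟩
  have := hδ w x y z
  have := le_max_left δ 0
  linarith

/-- Every ray is asymptotic to a ray from `1`. -/
lemma exists_ray_from_one (h : IsHyperbolicGroup S) (g : GeodesicRay S) :
    ∃ f : GeodesicRay S, f.vertex 0 = 1 ∧
      (Quotient.mk (asymptoticSetoid S) f : GromovBoundary S) = Quotient.mk _ g := by
  have hS := h.generates
  obtain ⟨δ, hδ0, hδ⟩ := h.exists_nonneg
  set C₀ := wordDist S 1 (g.vertex 0) with hC₀
  have hg1 : ∀ k : ℕ, (k : ℝ) ≤ wordDist S 1 (g.vertex k) + C₀ := by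
    intro k
    have := wordDist_triangle_real hS (g.vertex 0) 1 (g.vertex k)
    rw [wordDist_comm (g.vertex 0) 1, g.dist_of_le (Nat.zero_le k)] at this
    push_cast at this
    linarith
  have hg2 : ∀ k : ℕ, (wordDist S 1 (g.vertex k) : ℝ) ≤ k + C₀ := by
    intro k
    have := wordDist_triangle_real hS 1 (g.vertex 0) (g.vertex k)
    rw [g.dist_of_le (Nat.zero_le k)] at this
    push_cast at this
    linarith
  have hy : Tendsto (fun k => wordDist S 1 (g.vertex k)) atTop atTop := by
    refine tendsto_atTop_mono (f := fun k => k - C₀) (fun k => ?_) (tendsto_sub_atTop_nat C₀)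
    have : k ≤ wordDist S 1 (g.vertex k) + C₀ := by exact_mod_cast hg1 k
    omega
  obtain ⟨f, hf0, hf⟩ := exists_limit_ray hS g.vertex hy
  -- The four-point inequality through `g.vertex k` gives `(f_m | g_m) ≥ m - C₀ - δ`. Together with
  -- `|g_m| ≤ m + C₀` this bounds the distance by `3 C₀ + 2 δ`.
  refine ⟨f, hf0, (asymptotic_iff hS f g).2 ⟨⌈3 * (C₀ : ℝ) + 2 * δ⌉₊, fun m => ?_⟩⟩
  obtain ⟨k, hk, hmk⟩ := ((hf m).and_eventually (eventually_ge_atTop m)).exists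
  have hk' : (wordDist S (f.vertex m) (g.vertex k) : ℝ) + m = wordDist S 1 (g.vertex k) := by
    exact_mod_cast hk
  have hfm : (wordDist S 1 (f.vertex m) : ℝ) = m := by rw [f.dist_one hf0]
  have e1 : gromovProduct S 1 (f.vertex m) (g.vertex k) = m := by
    simp only [gromovProduct, wordDist_comm _ (1 : Γ)]
    linarith
  have e2 : (m : ℝ) - C₀ ≤ gromovProduct S 1 (g.vertex k) (g.vertex m) := by
    simp only [gromovProduct, wordDist_comm _ (1 : Γ), wordDist_comm (g.vertex k)]
    rw [g.dist_of_le hmk]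
    linarith [hg1 k, hg1 m]
  have e3 := hδ 1 (f.vertex m) (g.vertex k) (g.vertex m)
  rw [e1] at e3
  have e4 : (m : ℝ) - C₀ ≤ min (m : ℝ) (gromovProduct S 1 (g.vertex k) (g.vertex m)) :=
    le_min (by have : (0 : ℝ) ≤ C₀ := by positivity
               linarith) e2
  have e5 : gromovProduct S 1 (f.vertex m) (g.vertex m) =
      ((m : ℝ) + wordDist S 1 (g.vertex m) - wordDist S (f.vertex m) (g.vertex m)) / 2 := by
    simp only [gromovProduct, wordDist_comm _ (1 : Γ), hfm]
  have : (wordDist S (f.vertex m) (g.vertex m) : ℝ) ≤ ⌈3 * (C₀ : ℝ) + 2 * δ⌉₊ :=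
    le_trans (by linarith [hg2 m]) (Nat.le_ceil _)
  exact_mod_cast this

/-- The rays from `1` form a compact space. -/
lemma isCompact_rays_from_one (hS : Subgroup.closure (S : Set Γ) = ⊤) :
    IsCompact {f : GeodesicRay S | f.vertex 0 = 1} := by
  let : TopologicalSpace Γ := ⊥
  have : DiscreteTopology Γ := ⟨rfl⟩
  have hind : IsInducing (GeodesicRay.vertex : GeodesicRay S → ℕ → Γ) := ⟨rfl⟩
  rw [hind.isCompact_iff]
  have hK : IsCompact (Set.univ.pi fun m : ℕ => {g : Γ | wordDist S 1 g ≤ m}) :=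
    isCompact_univ_pi fun m => (finite_wordDist_le hS 1 m).isCompact
  refine hK.of_isClosed_subset ?_ ?_
  · have : (GeodesicRay.vertex '' {f : GeodesicRay S | f.vertex 0 = 1}) =
        {v : ℕ → Γ | v 0 = 1} ∩ ⋂ i, ⋂ k, {v : ℕ → Γ | wordDist S (v i) (v (i + k)) = k} := by
      ext v
      constructor
      · rintro ⟨f, hf, rfl⟩
        exact ⟨hf, Set.mem_iInter₂.2 fun i k => f.isGeodesic i k⟩
      · rintro ⟨h0, h⟩
        exact ⟨⟨v, fun i k => Set.mem_iInter₂.1 h i k⟩, h0, rfl⟩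
    rw [this]
    refine IsClosed.inter ?_ (isClosed_iInter fun i => isClosed_iInter fun k => ?_)
    · exact (isClosed_discrete {(1 : Γ)}).preimage
        (continuous_apply 0 : Continuous fun v : ℕ → Γ => v 0)
    · exact (isClosed_discrete {p : Γ × Γ | wordDist S p.1 p.2 = k}).preimage
        ((continuous_apply i : Continuous fun v : ℕ → Γ => v i).prodMk
          (continuous_apply (i + k) : Continuous fun v : ℕ → Γ => v (i + k)))
  · rintro _ ⟨f, hf, rfl⟩ m -
    exact (f.dist_one hf m).le

lemma continuous_boundary_mk : Continuous fun f : GeodesicRay S =>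
    (Quotient.mk (asymptoticSetoid S) f : GromovBoundary S) :=
  continuous_quotient_mk'

/-- Every class has a representative starting at `1`, so the boundary is the image of the compact
space of such rays. -/
lemma compactSpace_boundary (h : IsHyperbolicGroup S) : CompactSpace (GromovBoundary S) := by
  constructor
  have := (isCompact_rays_from_one h.generates).image (continuous_boundary_mk (S := S))
  refine this.of_isClosed_subset isClosed_univ fun η _ => ?_
  induction η using Quotient.inductionOn with
  | h g =>
    obtain ⟨f, hf, hfg⟩ := exists_ray_from_one h g
    exact ⟨f, hf, hfg⟩

/-- Along an ultrafilter, rays from `1` converge pointwise (hence in the boundary). -/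
lemma exists_ray_limit (hS : Subgroup.closure (S : Set Γ) = ⊤) {ι : Type*} (l : Ultrafilter ι)
    (r : ι → GeodesicRay S) (hr : ∀ i, (r i).vertex 0 = 1) :
    ∃ f : GeodesicRay S, f.vertex 0 = 1 ∧ (∀ m, ∀ᶠ i in l, (r i).vertex m = f.vertex m) ∧
      Tendsto (fun i => (Quotient.mk (asymptoticSetoid S) (r i) : GromovBoundary S)) l
        (𝓝 (Quotient.mk _ f)) := by
  obtain ⟨f, hf, hlim⟩ := (isCompact_rays_from_one hS).ultrafilter_le_nhds (l.map r)
    (by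
      rw [Filter.le_principal_iff, Ultrafilter.coe_map, Filter.mem_map]
      exact Filter.univ_mem' hr)
  have hlim' : Tendsto r l (𝓝 f) := hlim
  refine ⟨f, hf, fun m => ?_, ((continuous_boundary_mk (S := S)).tendsto f).comp hlim'⟩
  let : TopologicalSpace Γ := ⊥
  have : DiscreteTopology Γ := ⟨rfl⟩
  have hcont : Continuous (GeodesicRay.vertex : GeodesicRay S → ℕ → Γ) := continuous_induced_dom
  have h1 : Tendsto (fun i => (r i).vertex m) l (𝓝 (f.vertex m)) :=
    (((continuous_apply m).comp hcont).tendsto f).comp hlim'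
  rw [nhds_discrete] at h1
  exact tendsto_pure.1 h1

/-! ### Gromov products of powers and existence of loxodromic elements -/

lemma gromovProduct_nonneg (hS : Subgroup.closure (S : Set Γ) = ⊤) (w x y : Γ) :
    0 ≤ gromovProduct S w x y := by
  have := wordDist_triangle_real hS x w y
  simp only [gromovProduct, wordDist_comm y w]
  linarith

lemma gromovProduct_one_left (w x : Γ) : gromovProduct S w w x = 0 := by
  simp only [gromovProduct, wordDist_self, wordDist_comm w x]; simp

lemma gromovProduct_add (v w x : Γ) :
    gromovProduct S v x w + gromovProduct S w x v = wordDist S v w := by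
  simp only [gromovProduct, wordDist_comm w v]; ring

/-- The four-point inequality in the form used for chains of points. -/
lemma gromovProduct_chain {δ : ℝ} (hδ : ∀ w x y z : Γ,
    min (gromovProduct S w x y) (gromovProduct S w y z) - δ ≤ gromovProduct S w x z)
    {B : ℝ} {w x y z : Γ} (h1 : B ≤ gromovProduct S w x y) (h2 : B ≤ gromovProduct S w y z) :
    B - δ ≤ gromovProduct S w x z := by
  have := hδ w x y z
  have := le_min h1 h2
  linarith

/-- Induction on `k`. Translation by `z` gives `(z⁻ᵏ⁻¹ | z⁻¹) + (z⁻ᵏ | z) = |z|`, so the bound at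
`k` makes `z⁻ᵏ⁻¹` follow `z⁻¹` for a long time. If it also followed `z` for longer than `(z | z⁻¹) +
δ`, the four-point inequality would make `(z | z⁻¹)` larger than itself. -/
lemma gromovProduct_inv_pow_le (hS : Subgroup.closure (S : Set Γ) = ⊤) {δ : ℝ} (hδ0 : 0 ≤ δ)
    (hδ : ∀ w x y z : Γ,
      min (gromovProduct S w x y) (gromovProduct S w y z) - δ ≤ gromovProduct S w x z)
    (z : Γ) (hz : 2 * gromovProduct S 1 z z⁻¹ + 3 * δ < wordDist S 1 z) (k : ℕ) :
    gromovProduct S 1 (z⁻¹ ^ k) z ≤ gromovProduct S 1 z z⁻¹ + δ := by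
  have ha := gromovProduct_nonneg hS 1 z z⁻¹
  induction k with
  | zero => rw [pow_zero, gromovProduct_one_left]; linarith
  | succ k ih =>
    by_contra hcon
    push Not at hcon
    have h1 : gromovProduct S 1 (z⁻¹ ^ (k + 1)) z⁻¹ + gromovProduct S 1 (z⁻¹ ^ k) z =
        wordDist S 1 z := by
      have := gromovProduct_mul_left (S := S) z 1 (z⁻¹ ^ (k + 1)) z⁻¹
      rw [mul_one, mul_inv_cancel, pow_succ', mul_inv_cancel_left] at this
      rw [pow_succ', ← this, ← gromovProduct_add 1 z (z⁻¹ ^ k)]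
      ring
    have h2 := hδ 1 z⁻¹ (z⁻¹ ^ (k + 1)) z
    rw [gromovProduct_comm 1 z⁻¹ z, gromovProduct_comm 1 z⁻¹ (z⁻¹ ^ (k + 1))] at h2
    have h3 : gromovProduct S 1 z z⁻¹ + δ <
        min (gromovProduct S 1 (z⁻¹ ^ (k + 1)) z⁻¹) (gromovProduct S 1 (z⁻¹ ^ (k + 1)) z) :=
      lt_min (by linarith) hcon
    linarith

lemma wordDist_one_inv (z : Γ) : wordDist S 1 z⁻¹ = wordDist S 1 z := by
  have := wordDist_mul_left S z 1 z⁻¹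
  rw [mul_one, mul_inv_cancel] at this
  rw [← this, wordDist_comm]

/-- Negative and positive powers diverge near `1`: this separates the two boundary points of `z`. It
follows from the preceding bound applied to both `z` and `z⁻¹`. -/
lemma gromovProduct_inv_pow_pow_le (hS : Subgroup.closure (S : Set Γ) = ⊤) {δ : ℝ} (hδ0 : 0 ≤ δ)
    (hδ : ∀ w x y z : Γ,
      min (gromovProduct S w x y) (gromovProduct S w y z) - δ ≤ gromovProduct S w x z)
    (z : Γ) (hz : 2 * gromovProduct S 1 z z⁻¹ + 3 * δ < wordDist S 1 z) (k m : ℕ) :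
    gromovProduct S 1 (z⁻¹ ^ k) (z ^ m) ≤ gromovProduct S 1 z z⁻¹ + 2 * δ := by
  have ha := gromovProduct_nonneg hS 1 z z⁻¹
  cases m with
  | zero => rw [pow_zero, gromovProduct_comm, gromovProduct_one_left]; linarith
  | succ m =>
    have h0 := gromovProduct_inv_pow_le hS hδ0 hδ z hz k
    have hz' : 2 * gromovProduct S 1 z⁻¹ z⁻¹⁻¹ + 3 * δ < wordDist S 1 z⁻¹ := by
      rw [inv_inv, gromovProduct_comm, wordDist_one_inv]; exact hz
    have h1 := gromovProduct_inv_pow_le hS hδ0 hδ z⁻¹ hz' m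
    rw [inv_inv, gromovProduct_comm 1 z⁻¹ z] at h1
    have h2 : gromovProduct S 1 (z ^ (m + 1)) z + gromovProduct S 1 (z ^ m) z⁻¹ =
        wordDist S 1 z := by
      have := gromovProduct_mul_left (S := S) z 1 (z ^ m) z⁻¹
      rw [mul_one, mul_inv_cancel, ← pow_succ'] at this
      rw [← this, ← gromovProduct_add 1 z (z ^ (m + 1))]
    by_contra hcon
    push Not at hcon
    have h3 := hδ 1 (z⁻¹ ^ k) (z ^ (m + 1)) z
    have h4 : gromovProduct S 1 z z⁻¹ + 2 * δ <
        min (gromovProduct S 1 (z⁻¹ ^ k) (z ^ (m + 1))) (gromovProduct S 1 (z ^ (m + 1)) z) :=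
      lt_min hcon (by linarith)
    linarith

/-- Each further power gains `|z| - 2 (z⁻ᵏ | z)`, because `|zᵏ⁺¹| = d(z⁻ᵏ, z)`. So the powers of `z`
go to infinity at linear speed. -/
lemma wordDist_pow_ge (hS : Subgroup.closure (S : Set Γ) = ⊤) {δ : ℝ} (hδ0 : 0 ≤ δ)
    (hδ : ∀ w x y z : Γ,
      min (gromovProduct S w x y) (gromovProduct S w y z) - δ ≤ gromovProduct S w x z)
    (z : Γ) (hz : 2 * gromovProduct S 1 z z⁻¹ + 3 * δ < wordDist S 1 z) (k : ℕ) :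
    (k : ℝ) * (wordDist S 1 z - 2 * gromovProduct S 1 z z⁻¹ - 2 * δ) ≤ wordDist S 1 (z ^ k) := by
  induction k with
  | zero => simp [wordDist_self]
  | succ k ih =>
    have h0 := gromovProduct_inv_pow_le hS hδ0 hδ z hz k
    have h1 : (wordDist S (z⁻¹ ^ k) z : ℝ) = wordDist S 1 (z ^ (k + 1)) := by
      rw [← wordDist_mul_left S (z ^ k) (z⁻¹ ^ k) z, inv_pow, mul_inv_cancel, ← pow_succ]
    have h2 : wordDist S (z⁻¹ ^ k) 1 = wordDist S 1 (z ^ k) := by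
      rw [wordDist_comm, inv_pow, wordDist_one_inv]
    rw [gromovProduct, h1, h2, wordDist_comm z 1] at h0
    push_cast
    linarith

/-- Sufficient condition for an element to act loxodromically. -/
lemma exists_attracting_ray (hS : Subgroup.closure (S : Set Γ) = ⊤) {δ : ℝ} (hδ0 : 0 ≤ δ)
    (hδ : ∀ w x y z : Γ,
      min (gromovProduct S w x y) (gromovProduct S w y z) - δ ≤ gromovProduct S w x z)
    (z : Γ) (hz : 2 * gromovProduct S 1 z z⁻¹ + 3 * δ < wordDist S 1 z) :
    ∃ f : GeodesicRay S, f.vertex 0 = 1 ∧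
      (∀ m : ℕ, ∃ k, (m : ℝ) ≤ gromovProduct S 1 (z ^ k) (f.vertex m)) ∧
      Tendsto (fun p : ℕ × ℕ => gromovProduct S 1 (z ^ p.1) (f.vertex p.2)) atTop atTop := by
  set a := gromovProduct S 1 z z⁻¹ with ha
  set c := (wordDist S 1 z : ℝ) - 2 * a - 2 * δ with hc
  have hc0 : 0 < c := by linarith
  have hgrow := wordDist_pow_ge hS hδ0 hδ z hz
  rw [← ha, ← hc] at hgrow
  have hlin : Tendsto (fun k : ℕ => (k : ℝ) * c) atTop atTop :=
    tendsto_natCast_atTop_atTop.atTop_mul_const hc0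
  have hy : Tendsto (fun k => wordDist S 1 (z ^ k)) atTop atTop :=
    tendsto_natCast_atTop_iff.1 (tendsto_atTop_mono hgrow hlin)
  obtain ⟨f, hf0, hf⟩ := exists_limit_ray hS (fun k => z ^ k) hy
  have hgp : ∀ m k, wordDist S (f.vertex m) (z ^ k) + m = wordDist S 1 (z ^ k) →
      gromovProduct S 1 (z ^ k) (f.vertex m) = m := by
    intro m k h
    have h' : (wordDist S (f.vertex m) (z ^ k) : ℝ) + m = wordDist S 1 (z ^ k) := by
      exact_mod_cast h
    have hfm : (wordDist S 1 (f.vertex m) : ℝ) = m := by rw [f.dist_one hf0]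
    simp only [gromovProduct, wordDist_comm _ (1 : Γ), wordDist_comm (z ^ k)]
    linarith
  refine ⟨f, hf0, fun m => ?_, ?_⟩
  · obtain ⟨k, hk⟩ := (hf m).exists
    exact ⟨k, (hgp m k hk).ge⟩
  · rw [tendsto_atTop]
    intro B
    obtain ⟨K, hK⟩ := (hlin.eventually_ge_atTop (B + a + 3 * δ)).exists_forall_of_atTop
    obtain ⟨M, hM⟩ := exists_nat_ge (B + δ)
    refine (eventually_ge_atTop (K, M)).mono ?_
    rintro ⟨k, m⟩ ⟨hk, hm⟩
    have hk' : K ≤ k := hk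
    have hm' : M ≤ m := hm
    obtain ⟨j, hj, hkj⟩ := ((hf m).and_eventually (eventually_ge_atTop k)).exists
    -- Moving the base point from `1` to `zᵏ` gives `(zᵏ | zʲ) = |zᵏ| - (z⁻ᵏ | zʲ⁻ᵏ)`, where the
    -- last product is bounded and `|zᵏ|` grows linearly.
    have h1 : B + δ ≤ gromovProduct S 1 (z ^ k) (z ^ j) := by
      obtain ⟨i, rfl⟩ := Nat.exists_eq_add_of_le hkj
      have e1 := gromovProduct_add (S := S) (z ^ k) 1 (z ^ (k + i))
      have e2 : gromovProduct S (z ^ k) (z ^ (k + i)) 1 =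
          gromovProduct S 1 (z⁻¹ ^ k) (z ^ i) := by
        rw [gromovProduct_comm, ← gromovProduct_mul_left (z ^ k) 1, pow_add, mul_one, inv_pow,
          mul_inv_cancel]
      have e3 := gromovProduct_inv_pow_pow_le hS hδ0 hδ z hz k i
      rw [gromovProduct_comm]
      have := hgrow k
      have := hK k hk'
      rw [e2, wordDist_comm] at e1
      linarith
    have h2 : B + δ ≤ gromovProduct S 1 (z ^ j) (f.vertex m) := by
      rw [hgp m j hj]
      exact hM.trans (by exact_mod_cast hm')
    have := gromovProduct_chain hδ h1 h2
    linarith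

/-- A hyperbolic group with an infinite set of elements contains an element with two distinct
boundary points attracting its positive and negative powers. -/
lemma exists_loxodromic (h : IsHyperbolicGroup S) [Infinite Γ] :
    ∃ (z : Γ) (η₁ η₂ : GromovBoundary S), η₁ ≠ η₂ ∧ IsBoundaryAttractingPoint S z η₁ ∧
      IsBoundaryAttractingPoint S z⁻¹ η₂ := by
  have hS := h.generates
  obtain ⟨δ, hδ0, hδ⟩ := h.exists_nonneg
  have hz : ∃ z : Γ, 2 * gromovProduct S 1 z z⁻¹ + 3 * δ < wordDist S 1 z := by
    -- Otherwise `(z | z⁻¹) ≥ |z| / 2 - 3 δ / 2` for every `z`. Cut a long geodesic word `w = x u`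
    -- into halves of length `N`. Chaining through `x⁻¹, x, w, w⁻¹, u⁻¹, u` makes `(x⁻¹ | u)` at
    -- least `N / 2 - 11 δ / 2`, yet it vanishes because `d(x⁻¹, u) = |w| = 2 N`.
    by_contra hcon
    push Not at hcon
    have hx : ∀ k : ℕ, ∃ x : Γ, k ≤ wordDist S 1 x := by
      intro k
      by_contra hk
      push Not at hk
      exact Set.infinite_univ ((finite_wordDist_le hS (1 : Γ) k).subset fun g _ => (hk g).le)
    choose y hy using hx
    obtain ⟨f, hf0, -⟩ := exists_limit_ray hS y (tendsto_atTop_mono hy tendsto_id)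
    obtain ⟨N, hN⟩ := exists_nat_gt (20 * δ)
    have d1 : (wordDist S 1 (f.vertex N) : ℝ) = N := by rw [f.dist_one hf0]
    have d2 : (wordDist S 1 (f.vertex (N + N)) : ℝ) = N + N := by
      rw [f.dist_one hf0]; push_cast; rfl
    have d3 : (wordDist S (f.vertex N) (f.vertex (N + N)) : ℝ) = N := by rw [f.isGeodesic]
    set x := f.vertex N
    set w := f.vertex (N + N)
    set u := x⁻¹ * w with hu
    have d4 : (wordDist S 1 u : ℝ) = N := by
      rw [← d3, ← wordDist_mul_left S x 1 u, mul_one, hu, mul_inv_cancel_left]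
    have hx1 := hcon x
    have hu1 := hcon u
    have hw1 := hcon w
    rw [d1] at hx1; rw [d4] at hu1; rw [d2] at hw1
    have e1 : gromovProduct S 1 x w = N := by
      simp only [gromovProduct, wordDist_comm _ (1 : Γ)]
      rw [d1, d2, d3]; ring
    have e2 : gromovProduct S 1 w⁻¹ u⁻¹ = N := by
      have : (wordDist S w⁻¹ u⁻¹ : ℝ) = N := by
        rw [← d1, ← wordDist_mul_left S w w⁻¹ u⁻¹, mul_inv_cancel]
        simp [hu]
      simp only [gromovProduct, wordDist_comm _ (1 : Γ)]
      rw [wordDist_one_inv, wordDist_one_inv, d2, d4, this]; ring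
    have e3 : gromovProduct S 1 x⁻¹ u = 0 := by
      have : (wordDist S x⁻¹ u : ℝ) = N + N := by
        rw [← d2, ← wordDist_mul_left S x x⁻¹ u, mul_inv_cancel, hu, mul_inv_cancel_left]
      simp only [gromovProduct, wordDist_comm _ (1 : Γ)]
      rw [wordDist_one_inv, d1, d4, this]; ring
    have s1 : (N : ℝ) - 3 / 2 * δ - δ ≤ gromovProduct S 1 x w⁻¹ :=
      gromovProduct_chain hδ (y := w) (by linarith) (by linarith)
    have s2 : (N : ℝ) - 5 / 2 * δ - δ ≤ gromovProduct S 1 x u⁻¹ :=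
      gromovProduct_chain hδ (y := w⁻¹) (by linarith) (by linarith)
    have s3 : (N : ℝ) / 2 - 7 / 2 * δ - δ ≤ gromovProduct S 1 x⁻¹ u⁻¹ :=
      gromovProduct_chain hδ (y := x) (by rw [gromovProduct_comm]; linarith) (by linarith)
    have s4 : (N : ℝ) / 2 - 9 / 2 * δ - δ ≤ gromovProduct S 1 x⁻¹ u :=
      gromovProduct_chain hδ (y := u⁻¹) (by linarith) (by rw [gromovProduct_comm]; linarith)
    linarith
  obtain ⟨z, hz⟩ := hz
  have hz' : 2 * gromovProduct S 1 z⁻¹ z⁻¹⁻¹ + 3 * δ < wordDist S 1 z⁻¹ := by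
    rw [inv_inv, gromovProduct_comm, wordDist_one_inv]; exact hz
  obtain ⟨f, hf0, hf, hft⟩ := exists_attracting_ray hS hδ0 hδ z hz
  obtain ⟨f', hf0', hf', hft'⟩ := exists_attracting_ray hS hδ0 hδ z⁻¹ hz'
  refine ⟨z, Quotient.mk _ f, Quotient.mk _ f', ?_, ⟨f, rfl, hft⟩, ⟨f', rfl, hft'⟩⟩
  -- If the two rays were asymptotic, some positive and negative powers of `z` would have a large
  -- Gromov product, against `gromovProduct_inv_pow_pow_le`.
  intro heq
  obtain ⟨C, hC⟩ := (asymptotic_iff hS f f').1 heq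
  obtain ⟨m, hm⟩ := exists_nat_gt (gromovProduct S 1 z z⁻¹ + C + 4 * δ)
  obtain ⟨k, hk⟩ := hf m
  obtain ⟨k', hk'⟩ := hf' m
  have h1 : (m : ℝ) - C ≤ gromovProduct S 1 (f.vertex m) (f'.vertex m) := by
    have := hC m
    have : (wordDist S (f.vertex m) (f'.vertex m) : ℝ) ≤ C := by exact_mod_cast this
    have hC0 : (0 : ℝ) ≤ C := by positivity
    simp only [gromovProduct, wordDist_comm _ (1 : Γ)]
    rw [f.dist_one hf0, f'.dist_one hf0']
    linarith
  have hC0 : (0 : ℝ) ≤ C := by positivity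
  have h2 : (m : ℝ) - C - δ ≤ gromovProduct S 1 (z ^ k) (f'.vertex m) :=
    gromovProduct_chain hδ (y := f.vertex m) (by linarith) h1
  have h3 : (m : ℝ) - C - δ - δ ≤ gromovProduct S 1 (z ^ k) (z⁻¹ ^ k') :=
    gromovProduct_chain hδ (y := f'.vertex m) h2 (by rw [gromovProduct_comm]; linarith)
  have h4 := gromovProduct_inv_pow_pow_le hS hδ0 hδ z hz k' k
  rw [gromovProduct_comm] at h4
  linarith

/-! ### Boundary points of a hyperbolic group are conical -/

lemma GeodesicRay.gromovProduct_self (f : GeodesicRay S) (hf : f.vertex 0 = 1) {m k : ℕ}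
    (h : m ≤ k) : gromovProduct S 1 (f.vertex m) (f.vertex k) = m := by
  simp only [gromovProduct, wordDist_comm _ (1 : Γ)]
  rw [f.dist_one hf, f.dist_one hf, f.dist_of_le h]
  ring

lemma gromovProduct_le_left (hS : Subgroup.closure (S : Set Γ) = ⊤) (x y : Γ) :
    gromovProduct S 1 x y ≤ wordDist S 1 x := by
  have := wordDist_triangle_real hS 1 x y
  simp only [gromovProduct, wordDist_comm _ (1 : Γ)]
  linarith

/-- Rays from `1` that are not asymptotic have bounded Gromov products. -/
lemma exists_gromovProduct_le (h : IsHyperbolicGroup S) (f f' : GeodesicRay S)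
    (hf : f.vertex 0 = 1) (hf' : f'.vertex 0 = 1)
    (hne : (Quotient.mk (asymptoticSetoid S) f : GromovBoundary S) ≠ Quotient.mk _ f') :
    ∃ K : ℝ, ∀ m k, gromovProduct S 1 (f.vertex m) (f'.vertex k) ≤ K := by
  have hS := h.generates
  obtain ⟨δ, hδ0, hδ⟩ := h.exists_nonneg
  by_contra hcon
  push Not at hcon
  refine hne ((asymptotic_iff hS f f').2 ⟨⌈4 * δ⌉₊, fun m => ?_⟩)
  obtain ⟨p, q, hpq⟩ := hcon m
  have hp : (m : ℝ) < p := by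
    have := gromovProduct_le_left hS (f.vertex p) (f'.vertex q)
    rw [f.dist_one hf] at this
    exact hpq.trans_le this
  have hq : (m : ℝ) < q := by
    have := gromovProduct_le_left hS (f'.vertex q) (f.vertex p)
    rw [f'.dist_one hf', gromovProduct_comm] at this
    exact hpq.trans_le this
  have hp' : m ≤ p := by exact_mod_cast hp.le
  have hq' : m ≤ q := by exact_mod_cast hq.le
  have h1 : (m : ℝ) - δ ≤ gromovProduct S 1 (f.vertex m) (f'.vertex q) :=
    gromovProduct_chain hδ (y := f.vertex p) (f.gromovProduct_self hf hp').ge hpq.le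
  have h2 : (m : ℝ) - δ - δ ≤ gromovProduct S 1 (f.vertex m) (f'.vertex m) :=
    gromovProduct_chain hδ h1 (by
      rw [gromovProduct_comm, f'.gromovProduct_self hf' hq']; linarith)
  simp only [gromovProduct, wordDist_comm _ (1 : Γ)] at h2
  rw [f.dist_one hf, f'.dist_one hf'] at h2
  have : (wordDist S (f.vertex m) (f'.vertex m) : ℝ) ≤ ⌈4 * δ⌉₊ :=
    le_trans (by linarith) (Nat.le_ceil _)
  exact_mod_cast this

lemma exists_le_gromovProduct_of_asymptotic (hS : Subgroup.closure (S : Set Γ) = ⊤)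
    (r g : GeodesicRay S) (hr : r.vertex 0 = 1)
    (h : (Quotient.mk (asymptoticSetoid S) r : GromovBoundary S) = Quotient.mk _ g) (B : ℝ) :
    ∀ᶠ k in atTop, B ≤ gromovProduct S 1 (r.vertex k) (g.vertex k) := by
  obtain ⟨C, hC⟩ := (asymptotic_iff hS r g).1 h
  obtain ⟨k₀, hk₀⟩ := exists_nat_ge (B + C)
  refine (eventually_ge_atTop k₀).mono fun k hk => ?_
  have h1 : (wordDist S (r.vertex k) (g.vertex k) : ℝ) ≤ C := by exact_mod_cast hC k
  have h2 := wordDist_triangle_real hS 1 (g.vertex k) (r.vertex k)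
  have h3 : (k₀ : ℝ) ≤ k := by exact_mod_cast hk
  rw [wordDist_comm (g.vertex k), r.dist_one hr] at h2
  simp only [gromovProduct, wordDist_comm _ (1 : Γ)]
  rw [r.dist_one hr]
  linarith

/-- Translated rays no longer start at `1`. This passes from them to representatives based at `1`,
as needed for compactness, at the price of four applications of the four-point inequality. -/
lemma gromovProduct_le_of_asymptotic (hS : Subgroup.closure (S : Set Γ) = ⊤) {δ : ℝ}
    (hδ0 : 0 ≤ δ) (hδ : ∀ w x y z : Γ,
      min (gromovProduct S w x y) (gromovProduct S w y z) - δ ≤ gromovProduct S w x z)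
    (r r' g g' : GeodesicRay S) (hr : r.vertex 0 = 1) (hr' : r'.vertex 0 = 1)
    (hrg : (Quotient.mk (asymptoticSetoid S) r : GromovBoundary S) = Quotient.mk _ g)
    (hrg' : (Quotient.mk (asymptoticSetoid S) r' : GromovBoundary S) = Quotient.mk _ g')
    {K : ℝ} (hK : ∀ᶠ k in atTop, gromovProduct S 1 (g.vertex k) (g'.vertex k) ≤ K) (m : ℕ) :
    gromovProduct S 1 (r.vertex m) (r'.vertex m) ≤ K + 4 * δ := by
  set B := gromovProduct S 1 (r.vertex m) (r'.vertex m) with hB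
  obtain ⟨k, ⟨⟨h1, h2⟩, h3⟩, hmk⟩ := (((exists_le_gromovProduct_of_asymptotic hS r g hr hrg B).and
    (exists_le_gromovProduct_of_asymptotic hS r' g' hr' hrg' B)).and hK).and
    (eventually_ge_atTop m) |>.exists
  have hBm : B ≤ m := by
    have := gromovProduct_le_left hS (r.vertex m) (r'.vertex m)
    rwa [r.dist_one hr] at this
  have s1 : B - δ ≤ gromovProduct S 1 (g.vertex k) (r.vertex m) :=
    gromovProduct_chain hδ (y := r.vertex k) (by rwa [gromovProduct_comm])
      (by rw [gromovProduct_comm, r.gromovProduct_self hr hmk]; exact hBm)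
  have s2 : B - δ - δ ≤ gromovProduct S 1 (g.vertex k) (r'.vertex m) :=
    gromovProduct_chain hδ s1 (by linarith)
  have s3 : B - δ - δ - δ ≤ gromovProduct S 1 (g.vertex k) (r'.vertex k) :=
    gromovProduct_chain hδ s2 (by rw [r'.gromovProduct_self hr' hmk]; linarith)
  have s4 : B - δ - δ - δ - δ ≤ gromovProduct S 1 (g.vertex k) (g'.vertex k) :=
    gromovProduct_chain hδ s3 (by linarith)
  linarith

/-- Counterpart for lower bounds, at a fixed depth `m`, with the same loss `4 δ`. -/
lemma le_gromovProduct_of_asymptotic (hS : Subgroup.closure (S : Set Γ) = ⊤) {δ : ℝ}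
    (hδ0 : 0 ≤ δ) (hδ : ∀ w x y z : Γ,
      min (gromovProduct S w x y) (gromovProduct S w y z) - δ ≤ gromovProduct S w x z)
    (r r' g g' : GeodesicRay S) (hr : r.vertex 0 = 1) (hr' : r'.vertex 0 = 1)
    (hrg : (Quotient.mk (asymptoticSetoid S) r : GromovBoundary S) = Quotient.mk _ g)
    (hrg' : (Quotient.mk (asymptoticSetoid S) r' : GromovBoundary S) = Quotient.mk _ g')
    {m : ℕ} (hK : ∀ᶠ k in atTop, (m : ℝ) ≤ gromovProduct S 1 (g.vertex k) (g'.vertex k)) :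
    m - 4 * δ ≤ gromovProduct S 1 (r.vertex m) (r'.vertex m) := by
  obtain ⟨k, ⟨⟨h1, h2⟩, h3⟩, hmk⟩ := (((exists_le_gromovProduct_of_asymptotic hS r g hr hrg m).and
    (exists_le_gromovProduct_of_asymptotic hS r' g' hr' hrg' m)).and hK).and
    (eventually_ge_atTop m) |>.exists
  have s1 : (m : ℝ) - δ ≤ gromovProduct S 1 (r.vertex m) (g.vertex k) :=
    gromovProduct_chain hδ (y := r.vertex k) (r.gromovProduct_self hr hmk).ge h1
  have s2 : (m : ℝ) - δ - δ ≤ gromovProduct S 1 (r.vertex m) (g'.vertex k) :=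
    gromovProduct_chain hδ s1 (by linarith)
  have s3 : (m : ℝ) - δ - δ - δ ≤ gromovProduct S 1 (r.vertex m) (r'.vertex k) :=
    gromovProduct_chain hδ s2 (by rw [gromovProduct_comm]; linarith)
  have s4 : (m : ℝ) - δ - δ - δ - δ ≤ gromovProduct S 1 (r.vertex m) (r'.vertex m) :=
    gromovProduct_chain hδ s3 (by
      rw [gromovProduct_comm, r'.gromovProduct_self hr' hmk]; linarith)
  linarith

lemma vertex_smul (a : Γ) (f : GeodesicRay S) (i : ℕ) :
    (a • f).vertex i = a * f.vertex i := rfl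

/-- The endpoint of a ray. -/
abbrev GeodesicRay.endpoint (f : GeodesicRay S) : GromovBoundary S :=
  Quotient.mk (asymptoticSetoid S) f

/-- Every boundary point is conical: pulling back along a ray towards `η` separates `η` from all
other points, which are collapsed to a single point. -/
lemma exists_conical_limit (h : IsHyperbolicGroup S) (η : GromovBoundary S) :
    ∃ γ : ℕ → Γ, ∀ (l : Ultrafilter ℕ), (l : Filter ℕ) ≤ atTop → ∀ ζ₁ ζ₂ : GromovBoundary S,
      ζ₁ ≠ η → ζ₂ ≠ η → ∃ η' η'' : GromovBoundary S, η' ≠ η'' ∧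
        Tendsto (fun i => (γ i)⁻¹ • η) l (𝓝 η') ∧ Tendsto (fun i => (γ i)⁻¹ • ζ₁) l (𝓝 η'') ∧
        Tendsto (fun i => (γ i)⁻¹ • ζ₂) l (𝓝 η'') := by
  have hS := h.generates
  obtain ⟨δ, hδ0, hδ⟩ := h.exists_nonneg
  have hrep : ∀ ζ : GromovBoundary S, ∃ f : GeodesicRay S, f.vertex 0 = 1 ∧
      (Quotient.mk (asymptoticSetoid S) f : GromovBoundary S) = ζ := by
    intro ζ
    induction ζ using Quotient.inductionOn with
    | h g => exact exists_ray_from_one h g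
  obtain ⟨f, hf, rfl⟩ := hrep η
  -- The sequence consists of the vertices of a ray towards `η`.
  refine ⟨f.vertex, fun l hl ζ₁ ζ₂ h₁ h₂ => ?_⟩
  obtain ⟨f₁, hf₁, rfl⟩ := hrep ζ₁
  obtain ⟨f₂, hf₂, rfl⟩ := hrep ζ₂
  obtain ⟨K₁, hK₁⟩ := exists_gromovProduct_le h f f₁ hf hf₁ h₁.symm
  obtain ⟨K₂, hK₂⟩ := exists_gromovProduct_le h f f₂ hf hf₂ h₂.symm
  choose r hr hrf using fun i => hrep ((f.vertex i)⁻¹ • f.endpoint)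
  choose r₁ hr₁ hrf₁ using fun i => hrep ((f.vertex i)⁻¹ • f₁.endpoint)
  choose r₂ hr₂ hrf₂ using fun i => hrep ((f.vertex i)⁻¹ • f₂.endpoint)
  have hgp : ∀ (i : ℕ) (a b : Γ), gromovProduct S 1 ((f.vertex i)⁻¹ * a) ((f.vertex i)⁻¹ * b) =
      gromovProduct S (f.vertex i) a b := by
    intro i a b
    rw [← gromovProduct_mul_left (f.vertex i) 1]
    simp
  -- the class of `f` is separated from that of `f₁`
  have hsep : ∀ i m, gromovProduct S 1 ((r i).vertex m) ((r₁ i).vertex m) ≤ K₁ + 4 * δ := by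
    intro i m
    refine gromovProduct_le_of_asymptotic hS hδ0 hδ (r i) (r₁ i) ((f.vertex i)⁻¹ • f)
      ((f.vertex i)⁻¹ • f₁) (hr i) (hr₁ i) (hrf i) (hrf₁ i) ?_ m
    refine (eventually_ge_atTop i).mono fun k hk => ?_
    rw [vertex_smul, vertex_smul, hgp]
    -- Moving the base point from `1` forward along `f` can only lower the product with a later
    -- vertex of `f`, so the bound `K₁` survives the translation.
    have e1 := hK₁ k k
    have e2 := gromovProduct_nonneg hS 1 (f.vertex i) (f₁.vertex k)
    simp only [gromovProduct, wordDist_comm _ (1 : Γ)] at e1 e2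
    simp only [gromovProduct]
    rw [f.dist_one hf] at e1 e2
    rw [wordDist_comm (f.vertex k) (f.vertex i), f.dist_of_le hk,
      wordDist_comm (f₁.vertex k) (f.vertex i)]
    linarith
  -- the classes of `f₁` and `f₂` are collapsed
  have hcol : ∀ m, ∀ᶠ i in atTop,
      m - 4 * δ ≤ gromovProduct S 1 ((r₁ i).vertex m) ((r₂ i).vertex m) := by
    intro m
    obtain ⟨i₀, hi₀⟩ := exists_nat_ge (m + K₁ + K₂)
    refine (eventually_ge_atTop i₀).mono fun i hi => ?_
    refine le_gromovProduct_of_asymptotic hS hδ0 hδ (r₁ i) (r₂ i) ((f.vertex i)⁻¹ • f₁)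
      ((f.vertex i)⁻¹ • f₂) (hr₁ i) (hr₂ i) (hrf₁ i) (hrf₂ i) ?_
    refine Eventually.of_forall fun k => ?_
    rw [vertex_smul, vertex_smul, hgp]
    have hi' : (i₀ : ℝ) ≤ i := by exact_mod_cast hi
    have e1 := hK₁ i k
    have e2 := hK₂ i k
    have e3 := gromovProduct_nonneg hS 1 (f₁.vertex k) (f₂.vertex k)
    have e4 := wordDist_triangle_real hS (f₁.vertex k) 1 (f₂.vertex k)
    simp only [gromovProduct, wordDist_comm _ (1 : Γ)] at e1 e2 e4
    simp only [gromovProduct]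
    rw [f.dist_one hf, f₁.dist_one hf₁, wordDist_comm] at e1
    rw [f.dist_one hf, f₂.dist_one hf₂, wordDist_comm] at e2
    rw [f₁.dist_one hf₁, f₂.dist_one hf₂] at e4
    linarith
  obtain ⟨s, hs, hsl, hst⟩ := exists_ray_limit hS l r hr
  obtain ⟨s₁, hs₁, hsl₁, hst₁⟩ := exists_ray_limit hS l r₁ hr₁
  obtain ⟨s₂, hs₂, hsl₂, hst₂⟩ := exists_ray_limit hS l r₂ hr₂
  have heq : (Quotient.mk (asymptoticSetoid S) s₁ : GromovBoundary S) = Quotient.mk _ s₂ := by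
    refine (asymptotic_iff hS s₁ s₂).2 ⟨⌈8 * δ⌉₊, fun m => ?_⟩
    obtain ⟨i, ⟨hi1, hi2⟩, hi3⟩ := (((hsl₁ m).and (hsl₂ m)).and ((hcol m).filter_mono hl)).exists
    rw [hi1, hi2] at hi3
    simp only [gromovProduct, wordDist_comm _ (1 : Γ)] at hi3
    rw [s₁.dist_one hs₁, s₂.dist_one hs₂] at hi3
    have : (wordDist S (s₁.vertex m) (s₂.vertex m) : ℝ) ≤ ⌈8 * δ⌉₊ :=
      le_trans (by linarith) (Nat.le_ceil _)
    exact_mod_cast this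
  refine ⟨Quotient.mk _ s, Quotient.mk _ s₁, ?_, ?_, ?_, ?_⟩
  · intro hss
    obtain ⟨C, hC⟩ := (asymptotic_iff hS s s₁).1 hss
    obtain ⟨m, hm⟩ := exists_nat_gt (C + K₁ + 4 * δ)
    obtain ⟨i, hi1, hi2⟩ := ((hsl m).and (hsl₁ m)).exists
    have h3 := hsep i m
    rw [hi1, hi2] at h3
    simp only [gromovProduct, wordDist_comm _ (1 : Γ)] at h3
    rw [s.dist_one hs, s₁.dist_one hs₁] at h3
    have h4 : (wordDist S (s.vertex m) (s₁.vertex m) : ℝ) ≤ C := by exact_mod_cast hC m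
    have hC0 : (0 : ℝ) ≤ C := by positivity
    linarith
  · simp only [hrf] at hst
    exact hst
  · simp only [hrf₁] at hst₁
    exact hst₁
  · rw [heq]
    simp only [hrf₂] at hst₂
    exact hst₂

lemma infinite_of_boundary (η : GromovBoundary S) :
    Infinite Γ := by
  induction η using Quotient.inductionOn with
  | h f =>
    refine Infinite.of_injective f.vertex fun i j hij => ?_
    rcases le_total i j with h | h
    · have := f.dist_of_le h
      rw [hij, wordDist_self] at this
      have : (i : ℝ) = j := by push_cast at this; linarith
      exact_mod_cast this
    · have := f.dist_of_le h
      rw [hij, wordDist_self] at this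
      have : (i : ℝ) = j := by push_cast at this; linarith
      exact_mod_cast this

end Hyperbolic

/-! ### The form in coordinates and the Cartan decomposition -/

section Linear

variable {n : ℕ}

/-- The negative coordinates of a vector. -/
def negPart : R2n n →L[ℝ] EuclideanSpace ℝ (Fin 2) :=
  LinearMap.toContinuousLinearMap
    { toFun := fun x => WithLp.toLp 2 fun i => x (Sum.inl i)
      map_add' := fun x y => by ext i; simp
      map_smul' := fun a x => by ext i; simp }

/-- The positive coordinates of a vector. -/
def posPart : R2n n →L[ℝ] EuclideanSpace ℝ (Fin n) :=
  LinearMap.toContinuousLinearMap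
    { toFun := fun x => WithLp.toLp 2 fun j => x (Sum.inr j)
      map_add' := fun x y => by ext i; simp
      map_smul' := fun a x => by ext i; simp }

/-- The inclusion of the negative coordinates. -/
def inNeg : EuclideanSpace ℝ (Fin 2) →L[ℝ] R2n n :=
  LinearMap.toContinuousLinearMap
    { toFun := fun u => WithLp.toLp 2 (Sum.elim (fun i => u i) fun _ => 0)
      map_add' := fun x y => by ext (i | i) <;> simp
      map_smul' := fun a x => by ext (i | i) <;> simp }

/-- The inclusion of the positive coordinates. -/
def inPos : EuclideanSpace ℝ (Fin n) →L[ℝ] R2n n :=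
  LinearMap.toContinuousLinearMap
    { toFun := fun w => WithLp.toLp 2 (Sum.elim (fun _ => 0) fun j => w j)
      map_add' := fun x y => by ext (i | i) <;> simp
      map_smul' := fun a x => by ext (i | i) <;> simp }

@[simp] lemma negPart_apply (x : R2n n) (i : Fin 2) : negPart x i = x (Sum.inl i) := rfl
@[simp] lemma posPart_apply (x : R2n n) (j : Fin n) : posPart x j = x (Sum.inr j) := rfl
@[simp] lemma inNeg_inl (u : EuclideanSpace ℝ (Fin 2)) (i : Fin 2) :
    (inNeg u : R2n n) (Sum.inl i) = u i := rfl
@[simp] lemma inNeg_inr (u : EuclideanSpace ℝ (Fin 2)) (j : Fin n) :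
    (inNeg u : R2n n) (Sum.inr j) = 0 := rfl
@[simp] lemma inPos_inl (w : EuclideanSpace ℝ (Fin n)) (i : Fin 2) :
    (inPos w : R2n n) (Sum.inl i) = 0 := rfl
@[simp] lemma inPos_inr (w : EuclideanSpace ℝ (Fin n)) (j : Fin n) :
    (inPos w : R2n n) (Sum.inr j) = w j := rfl

@[simp] lemma negPart_inNeg (u : EuclideanSpace ℝ (Fin 2)) : negPart (inNeg u : R2n n) = u := rfl
@[simp] lemma posPart_inPos (w : EuclideanSpace ℝ (Fin n)) : posPart (inPos w : R2n n) = w := rfl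
@[simp] lemma posPart_inNeg (u : EuclideanSpace ℝ (Fin 2)) : posPart (inNeg u : R2n n) = 0 := rfl
@[simp] lemma negPart_inPos (w : EuclideanSpace ℝ (Fin n)) : negPart (inPos w : R2n n) = 0 := rfl

lemma inNeg_add_inPos (x : R2n n) : inNeg (negPart x) + inPos (posPart x) = x := by
  ext (i | i) <;> simp

lemma norm_sq_eq_parts (x : R2n n) : ‖x‖ ^ 2 = ‖negPart x‖ ^ 2 + ‖posPart x‖ ^ 2 := by
  simp only [EuclideanSpace.real_norm_sq_eq, Fintype.sum_sum_type, negPart_apply, posPart_apply]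

lemma bil_eq_parts (x y : R2n n) :
    bil x y = -inner ℝ (negPart x) (negPart y) + inner ℝ (posPart x) (posPart y) := by
  simp only [bil, PiLp.inner_apply, negPart_apply, posPart_apply, RCLike.inner_apply,
    conj_trivial, mul_comm]

lemma quad_eq_parts (x : R2n n) : quad x = ‖posPart x‖ ^ 2 - ‖negPart x‖ ^ 2 := by
  rw [quad, bil_eq_parts, real_inner_self_eq_norm_sq, real_inner_self_eq_norm_sq]; ring

/-- The reflection that changes the sign of the negative coordinates. -/
def negFlip : R2n n →L[ℝ] R2n n := inPos.comp posPart - inNeg.comp negPart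

lemma negPart_negFlip (x : R2n n) : negPart (negFlip x) = -negPart x := by
  simp [negFlip]

lemma posPart_negFlip (x : R2n n) : posPart (negFlip x) = posPart x := by
  simp [negFlip]

lemma inner_eq_parts (x y : R2n n) :
    inner ℝ x y = inner ℝ (negPart x) (negPart y) + inner ℝ (posPart x) (posPart y) := by
  simp only [PiLp.inner_apply, negPart_apply, posPart_apply, Fintype.sum_sum_type]

lemma bil_eq_inner (x y : R2n n) : bil x y = inner ℝ (negFlip x) y := by
  rw [inner_eq_parts, bil_eq_parts, negPart_negFlip, posPart_negFlip, inner_neg_left]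

lemma norm_negFlip (x : R2n n) : ‖negFlip x‖ = ‖x‖ := by
  have : ‖negFlip x‖ ^ 2 = ‖x‖ ^ 2 := by
    rw [norm_sq_eq_parts, norm_sq_eq_parts x, negPart_negFlip, posPart_negFlip, norm_neg]
  exact (sq_eq_sq₀ (norm_nonneg _) (norm_nonneg _)).1 this

lemma bil_comm (x y : R2n n) : bil x y = bil y x := by
  rw [bil_eq_parts, bil_eq_parts, real_inner_comm, real_inner_comm (posPart x)]

lemma bil_add_right (x y z : R2n n) : bil x (y + z) = bil x y + bil x z := by
  simp only [bil_eq_inner, inner_add_right]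

lemma bil_sub_right (x y z : R2n n) : bil x (y - z) = bil x y - bil x z := by
  simp only [bil_eq_inner, inner_sub_right]

lemma bil_smul_right (a : ℝ) (x y : R2n n) : bil x (a • y) = a * bil x y := by
  simp only [bil_eq_inner, real_inner_smul_right]

lemma bil_add_left (x y z : R2n n) : bil (x + y) z = bil x z + bil y z := by
  simp only [bil_comm _ z, bil_add_right]

lemma bil_sub_left (x y z : R2n n) : bil (x - y) z = bil x z - bil y z := by
  simp only [bil_comm _ z, bil_sub_right]

lemma bil_smul_left (a : ℝ) (x y : R2n n) : bil (a • x) y = a * bil x y := by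
  simp only [bil_comm _ y, bil_smul_right]

lemma bil_negFlip_self (x : R2n n) : bil x (negFlip x) = ‖x‖ ^ 2 := by
  rw [bil_eq_inner, real_inner_self_eq_norm_sq, norm_negFlip]

lemma abs_bil_le (x y : R2n n) : |bil x y| ≤ ‖x‖ * ‖y‖ := by
  rw [bil_eq_inner, ← norm_negFlip x]
  exact abs_real_inner_le_norm _ _

lemma tendsto_bil {ι : Type*} {l : Filter ι} {x y : ι → R2n n} {a b : R2n n}
    (hx : Tendsto x l (𝓝 a)) (hy : Tendsto y l (𝓝 b)) :
    Tendsto (fun i => bil (x i) (y i)) l (𝓝 (bil a b)) := by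
  simp only [bil_eq_inner]
  exact ((negFlip.continuous.tendsto a).comp hx).inner hy

lemma continuous_quad : Continuous (quad : R2n n → ℝ) :=
  continuous_iff_continuousAt.2 fun _ => tendsto_bil tendsto_id tendsto_id

lemma smul_eq_toGL (g : O0 n) (x : R2n n) : g • x = g.toGL.1 x := rfl

lemma continuous_smul_vec (g : O0 n) : Continuous fun x : R2n n => g • x := g.toGL.1.continuous

lemma bil_inv_smul (g : O0 n) (x y : R2n n) : bil (g⁻¹ • x) y = bil x (g • y) := by
  rw [← bil_smul g, smul_inv_smul]

/-- `g` is, up to an error of size `r`, the rank one map `s • b(F, ·) E`. -/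
structure NearRankOne (g : O0 n) (s r : ℝ) (E F : R2n n) : Prop where
  one_le : 1 ≤ r
  norm_E : ‖E‖ ^ 2 = 2
  norm_F : ‖F‖ ^ 2 = 2
  quad_E : quad E = 0
  quad_F : quad F = 0
  fwd : ∀ x : R2n n, ‖g • x - (s * bil F x) • E‖ ≤ r * ‖x‖
  bwd : ∀ x : R2n n, ‖g⁻¹ • x - (s * bil E x) • F‖ ≤ r * ‖x‖
  lower : ∀ x : R2n n, ‖x‖ ^ 2 - (inner ℝ F x) ^ 2 / 2 ≤ r ^ 2 * ‖g • x‖ ^ 2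

lemma ePos_apply_inl (j : Fin n) (i : Fin 2) : (ePos j : R2n n) (Sum.inl i) = 0 := by
  simp [ePos]

lemma ePos_apply_inr (j k : Fin n) : (ePos j : R2n n) (Sum.inr k) = if k = j then 1 else 0 := by
  simp [ePos]

lemma eNeg_apply_inl (j i : Fin 2) : (eNeg j : R2n n) (Sum.inl i) = if i = j then 1 else 0 := by
  simp [eNeg]

lemma eNeg_apply_inr (i : Fin 2) (j : Fin n) : (eNeg i : R2n n) (Sum.inr j) = 0 := by
  simp [eNeg]

/-- The component of a vector fixed by the Weyl chamber elements. -/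
def weylRest {m : ℕ} (x : R2n (m + 2)) : R2n (m + 2) :=
  ∑ j : Fin m, x (Sum.inr j.succ.succ) • (ePos j.succ.succ : R2n (m + 2))

lemma weylRest_inl {m : ℕ} (x : R2n (m + 2)) (i : Fin 2) : weylRest x (Sum.inl i) = 0 := by
  simp [weylRest, ePos_apply_inl]

lemma weylRest_zero {m : ℕ} (x : R2n (m + 2)) : weylRest x (Sum.inr 0) = 0 := by
  simp [weylRest, ePos_apply_inr, (Fin.succ_ne_zero _).symm]

lemma weylRest_one {m : ℕ} (x : R2n (m + 2)) : weylRest x (Sum.inr 1) = 0 := by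
  simp only [weylRest, ePos_apply_inr, WithLp.ofLp_sum, Finset.sum_apply, PiLp.smul_apply]
  refine Finset.sum_eq_zero fun j _ => ?_
  have : (1 : Fin (m + 2)) ≠ j.succ.succ := by
    intro h
    have := congrArg Fin.val h
    simp at this
  simp [this]

lemma weylRest_succ {m : ℕ} (x : R2n (m + 2)) (j : Fin m) :
    weylRest x (Sum.inr j.succ.succ) = x (Sum.inr j.succ.succ) := by
  simp [weylRest, ePos_apply_inr]

/-- A vector written in the basis that diagonalises the Weyl chamber elements. -/
def weylVec {m : ℕ} (p q : Fin 2 → ℝ) (x : R2n (m + 2)) : R2n (m + 2) :=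
  p 0 • (ePos 0 + eNeg 0) + q 0 • (ePos 0 - eNeg 0) + p 1 • (ePos 1 + eNeg 1) +
    q 1 • (ePos 1 - eNeg 1) + weylRest x

lemma norm_weylVec {m : ℕ} (p q : Fin 2 → ℝ) (x : R2n (m + 2)) :
    ‖weylVec p q x‖ ^ 2 = 2 * p 0 ^ 2 + 2 * q 0 ^ 2 + 2 * p 1 ^ 2 + 2 * q 1 ^ 2 +
      ∑ j : Fin m, x (Sum.inr j.succ.succ) ^ 2 := by
  have h2 : ∀ j : Fin m, j.succ.succ ≠ (1 : Fin (m + 2)) := by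
    intro j h
    have := congrArg Fin.val h
    simp at this
  rw [EuclideanSpace.real_norm_sq_eq, Fintype.sum_sum_type, Fin.sum_univ_two, Fin.sum_univ_succ,
    Fin.sum_univ_succ]
  simp only [weylVec, PiLp.add_apply, PiLp.sub_apply, PiLp.smul_apply, ePos_apply_inl,
    ePos_apply_inr, eNeg_apply_inl, eNeg_apply_inr, weylRest_inl, weylRest_zero, weylRest_one,
    weylRest_succ, Fin.succ_zero_eq_one, smul_eq_mul, Fin.succ_ne_zero, h2, if_false, if_true,
    one_ne_zero, zero_ne_one]
  simp only [mul_zero, add_zero, zero_add, sub_zero]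
  ring

/-- Half the coordinates of `x` along the expanding isotropic vectors. -/
def weylP {m : ℕ} (x : R2n (m + 2)) : Fin 2 → ℝ :=
  ![(x (Sum.inr 0) + x (Sum.inl 0)) / 2, (x (Sum.inr 1) + x (Sum.inl 1)) / 2]

/-- Half the coordinates of `x` along the contracting isotropic vectors. -/
def weylQ {m : ℕ} (x : R2n (m + 2)) : Fin 2 → ℝ :=
  ![(x (Sum.inr 0) - x (Sum.inl 0)) / 2, (x (Sum.inr 1) - x (Sum.inl 1)) / 2]

lemma weylVec_self {m : ℕ} (x : R2n (m + 2)) : weylVec (weylP x) (weylQ x) x = x := by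
  have h2 : ∀ j : Fin m, j.succ.succ ≠ (1 : Fin (m + 2)) := by
    intro j h
    have := congrArg Fin.val h
    simp at this
  ext (i | j)
  · fin_cases i <;>
    simp [weylVec, weylP, weylQ, ePos_apply_inl, eNeg_apply_inl, weylRest_inl] <;> ring
  · refine Fin.cases ?_ (fun j => Fin.cases ?_ (fun j => ?_) j) j
    · simp [weylVec, weylP, weylQ, ePos_apply_inr, eNeg_apply_inr, weylRest_zero]; ring
    · simp [weylVec, weylP, weylQ, ePos_apply_inr, eNeg_apply_inr, weylRest_one]; ring
    · simp [weylVec, ePos_apply_inr, eNeg_apply_inr, weylRest_succ, h2]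

lemma IsWeylElement.apply {m : ℕ} {a : GL2n (m + 2)} {t : Fin 2 → ℝ} (ha : IsWeylElement a t)
    (x : R2n (m + 2)) : a.1 x = weylVec (fun i => Real.exp (t i) * weylP x i)
      (fun i => Real.exp (-t i) * weylQ x i) x := by
  have hrest : a.1 (weylRest x) = weylRest x := by
    rw [weylRest, map_sum]
    refine Finset.sum_congr rfl fun j _ => ?_
    rw [map_smul, ha.fixed _ (by simp)]
  conv_lhs => rw [← weylVec_self x]
  simp only [weylVec, map_add a.1, map_smul]
  rw [hrest, ← map_add, ← map_add, ha.expand 0 0 rfl, ha.contract 0 0 rfl, ha.expand 1 1 rfl,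
    ha.contract 1 1 rfl]
  simp only [smul_smul, mul_comm]

lemma inner_eq_of_norm_eq (k : R2n n →L[ℝ] R2n n) (hk : ∀ x, ‖k x‖ = ‖x‖) (x y : R2n n) :
    inner ℝ (k x) (k y) = inner ℝ x y :=
  LinearIsometry.inner_map_map ⟨(k : R2n n →ₗ[ℝ] R2n n), hk⟩ x y

/-- For the form, `g⁻¹` is the adjoint of `g`, and the adjoint of `b(F, ·) E` is `b(E, ·) F`. The
error `w` is tested against `negFlip w`, which has the same norm and pairs with `w` to `‖w‖²`. -/
lemma bwd_of_fwd (g : O0 n) (s r : ℝ) (E F : R2n n)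
    (h : ∀ x : R2n n, ‖g • x - (s * bil F x) • E‖ ≤ r * ‖x‖) (x : R2n n) :
    ‖g⁻¹ • x - (s * bil E x) • F‖ ≤ r * ‖x‖ := by
  set w := g⁻¹ • x - (s * bil E x) • F with hw
  have h1 : ‖w‖ ^ 2 = bil x (g • negFlip w - (s * bil F (negFlip w)) • E) := by
    rw [← bil_negFlip_self]
    conv_lhs => rw [hw]
    rw [bil_sub_left, bil_sub_right, bil_inv_smul, bil_smul_left, bil_smul_right, bil_comm x E]
    ring
  have h2 : ‖w‖ ^ 2 ≤ ‖x‖ * (r * ‖w‖) := by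
    rw [h1]
    refine (le_abs_self _).trans ((abs_bil_le _ _).trans ?_)
    refine mul_le_mul_of_nonneg_left ?_ (norm_nonneg _)
    have := h (negFlip w)
    rwa [norm_negFlip] at this
  rcases eq_or_lt_of_le (norm_nonneg w) with h0 | h0
  · have h3 := (norm_nonneg _).trans (h x)
    rw [← h0]; exact h3
  · have h3 : ‖w‖ * ‖w‖ ≤ (r * ‖x‖) * ‖w‖ := by nlinarith
    exact le_of_mul_le_mul_right h3 h0

lemma weylP_zero {m : ℕ} (y : R2n (m + 2)) :
    2 * weylP y 0 = bil (ePos 0 - eNeg 0) y := by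
  simp only [weylP, Matrix.cons_val_zero]
  rw [bil_eq_inner, inner_eq_parts]
  rw [negPart_negFlip, posPart_negFlip]
  simp [PiLp.inner_apply, ePos_apply_inl, ePos_apply_inr, eNeg_apply_inl, eNeg_apply_inr]
  ring

lemma weylQ_zero {m : ℕ} (y : R2n (m + 2)) :
    2 * weylQ y 0 = inner ℝ (ePos 0 - eNeg 0) y := by
  simp only [weylQ, Matrix.cons_val_zero]
  rw [inner_eq_parts]
  simp [PiLp.inner_apply, ePos_apply_inl, ePos_apply_inr, eNeg_apply_inl, eNeg_apply_inr]
  ring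

lemma norm_sq_weyl_basis {m : ℕ} :
    ‖(ePos 0 + eNeg 0 : R2n (m + 2))‖ ^ 2 = 2 ∧ ‖(ePos 0 - eNeg 0 : R2n (m + 2))‖ ^ 2 = 2 ∧
    quad (ePos 0 + eNeg 0 : R2n (m + 2)) = 0 ∧ quad (ePos 0 - eNeg 0 : R2n (m + 2)) = 0 := by
  refine ⟨?_, ?_, ?_, ?_⟩
  · simp [EuclideanSpace.real_norm_sq_eq, ePos_apply_inl, ePos_apply_inr, eNeg_apply_inl,
      eNeg_apply_inr]; norm_num
  · simp [EuclideanSpace.real_norm_sq_eq, ePos_apply_inl, ePos_apply_inr, eNeg_apply_inl,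
      eNeg_apply_inr]; norm_num
  · simp [quad, bil, ePos_apply_inl, ePos_apply_inr, eNeg_apply_inl, eNeg_apply_inr]
  · simp [quad, bil, ePos_apply_inl, ePos_apply_inr, eNeg_apply_inl, eNeg_apply_inr]

/-- The Cartan decomposition shows that elements with a gap in their Cartan projection are close
to rank one maps. -/
lemma exists_nearRankOne (hn : 2 ≤ n) (g : O0 n) (t : Fin 2 → ℝ)
    (h : IsCartanProjection g.toGL t) : ∃ E F : R2n n,
      NearRankOne g (Real.exp (t 0) / 2) (Real.exp (t 1)) E F := by
  obtain ⟨m, rfl⟩ := Nat.exists_eq_add_of_le' hn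
  obtain ⟨k, ⟨hkO, hk⟩, l, ⟨hlO, hl⟩, a, ha, hg⟩ := h
  obtain ⟨ht1, ht01⟩ := ha.chamber
  obtain ⟨nE, nF, qE, qF⟩ := norm_sq_weyl_basis (m := m)
  have hll : ∀ x, l.1 (l⁻¹.1 x) = x := fun x => DFunLike.congr_fun l.mul_inv x
  have hlin : ∀ x, ‖l⁻¹.1 x‖ = ‖x‖ := fun x => by rw [← hl, hll]
  have hgx : ∀ x, g • x = k.1 (a.1 (l.1 x)) := by
    intro x
    rw [smul_eq_toGL, hg]; rfl
  set E : R2n (m + 2) := ePos 0 + eNeg 0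
  set F : R2n (m + 2) := ePos 0 - eNeg 0
  -- Pairing with the contracted vector reads off twice the expanding coordinate. This is the origin
  -- of the factor `1 / 2` in the scale `exp (t 0) / 2`.
  have hbilF : ∀ x, bil (l⁻¹.1 F) x = 2 * weylP (l.1 x) 0 := by
    intro x
    rw [weylP_zero, ← hlO, hll]
  have hinF : ∀ x, inner ℝ (l⁻¹.1 F) x = 2 * weylQ (l.1 x) 0 := by
    intro x
    rw [weylQ_zero, ← inner_eq_of_norm_eq l.1 hl, hll]
  have e0 : 1 ≤ Real.exp (t 1) := Real.one_le_exp ht1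
  have e1 : Real.exp (t 1) * Real.exp (-t 1) = 1 := by rw [← Real.exp_add]; simp
  have e2 : Real.exp (t 0) * Real.exp (-t 0) = 1 := by rw [← Real.exp_add]; simp
  have e3 : Real.exp (t 1) ≤ Real.exp (t 0) := Real.exp_le_exp.2 ht01
  have p1 := Real.exp_pos (-t 1)
  have p0 := Real.exp_pos (-t 0)
  set e := Real.exp (t 1)
  set e' := Real.exp (-t 1)
  set d := Real.exp (t 0)
  set d' := Real.exp (-t 0)
  have he' : e' ≤ 1 := by nlinarith
  have hd' : d' ≤ 1 := by nlinarith
  have hee : 1 ≤ e ^ 2 := by nlinarith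
  have hee' : e' ^ 2 ≤ e ^ 2 := by nlinarith
  have hdd' : d' ^ 2 ≤ e ^ 2 := by nlinarith
  -- Once the top eigenvalue is removed, all remaining eigenvalues are at most `e = exp (t 1)`, and
  -- the diagonalising basis is orthogonal.
  have hfwd : ∀ x : R2n (m + 2), ‖g • x - (d / 2 * bil (l⁻¹.1 F) x) • k.1 E‖ ≤ e * ‖x‖ := by
    intro x
    set y := l.1 x with hy
    have h1 : g • x - (d / 2 * bil (l⁻¹.1 F) x) • k.1 E =
        k.1 (weylVec ![0, e * weylP y 1] (fun i => Real.exp (-t i) * weylQ y i) y) := by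
      rw [hgx, hbilF, ← hy, ha.apply, ← map_smul, ← map_sub]
      congr 1
      simp only [weylVec, Matrix.cons_val_zero, Matrix.cons_val_one, zero_smul, zero_add]
      rw [show d / 2 * (2 * weylP y 0) = d * weylP y 0 by ring]
      abel
    rw [h1, hk]
    refine le_of_sq_le_sq ?_ (by positivity)
    have h2 : ‖x‖ ^ 2 = ‖weylVec (weylP y) (weylQ y) y‖ ^ 2 := by rw [weylVec_self, hy, hl]
    rw [mul_pow, h2, norm_weylVec, norm_weylVec]
    simp only [Matrix.cons_val_zero, Matrix.cons_val_one]
    have hs : 0 ≤ ∑ j : Fin m, y (Sum.inr j.succ.succ) ^ 2 :=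
      Finset.sum_nonneg fun _ _ => sq_nonneg _
    have a1 := mul_le_mul_of_nonneg_right hdd' (sq_nonneg (weylQ y 0))
    have a2 := mul_le_mul_of_nonneg_right hee' (sq_nonneg (weylQ y 1))
    have a3 := mul_le_mul_of_nonneg_right hee hs
    have a4 : 0 ≤ e ^ 2 * weylP y 0 ^ 2 := by positivity
    change 2 * 0 ^ 2 + 2 * (d' * weylQ y 0) ^ 2 + 2 * (e * weylP y 1) ^ 2 +
      2 * (e' * weylQ y 1) ^ 2 + _ ≤ _
    linarith [mul_pow d' (weylQ y 0) 2, mul_pow e' (weylQ y 1) 2, mul_pow e (weylP y 1) 2]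
  refine ⟨k.1 E, l⁻¹.1 F, e0, by rw [hk, nE], by rw [hlin, nF], ?_, ?_, hfwd,
    bwd_of_fwd _ _ _ _ _ hfwd, ?_⟩
  · rw [quad, hkO]; exact qE
  · rw [quad, ← hlO, hll]; exact qF
  -- Since `‖F‖² = 2`, the subtracted term is the squared component along `F`, the most contracted
  -- direction. On its orthogonal complement the contraction is by at most `exp (-t 1)`.
  · intro x
    rw [hgx, hk, hinF]
    set y := l.1 x with hy
    have h2 : ‖x‖ ^ 2 = ‖weylVec (weylP y) (weylQ y) y‖ ^ 2 := by rw [weylVec_self, hy, hl]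
    rw [h2, ha.apply, norm_weylVec, norm_weylVec]
    have hs : 0 ≤ ∑ j : Fin m, y (Sum.inr j.succ.succ) ^ 2 :=
      Finset.sum_nonneg fun _ _ => sq_nonneg _
    change _ ≤ e ^ 2 * (2 * (d * weylP y 0) ^ 2 + 2 * (d' * weylQ y 0) ^ 2 +
      2 * (e * weylP y 1) ^ 2 + 2 * (e' * weylQ y 1) ^ 2 + _)
    have b1 : 1 ≤ e ^ 2 * d ^ 2 := by nlinarith
    have b2 : 1 ≤ e ^ 2 * e ^ 2 := by nlinarith
    have b3 : e ^ 2 * e' ^ 2 = 1 := by rw [← mul_pow, e1]; norm_num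
    have a1 := mul_le_mul_of_nonneg_right b1 (sq_nonneg (weylP y 0))
    have a2 := mul_le_mul_of_nonneg_right b2 (sq_nonneg (weylP y 1))
    have a3 := mul_le_mul_of_nonneg_right hee hs
    have a4 : 0 ≤ e ^ 2 * (d' * weylQ y 0) ^ 2 := by positivity
    have a5 : e ^ 2 * (e' * weylQ y 1) ^ 2 = weylQ y 1 ^ 2 := by
      rw [mul_pow, ← mul_assoc, b3, one_mul]
    have a6 : e ^ 2 * (d * weylP y 0) ^ 2 = e ^ 2 * d ^ 2 * weylP y 0 ^ 2 := by ring
    have a7 : e ^ 2 * (e * weylP y 1) ^ 2 = e ^ 2 * e ^ 2 * weylP y 1 ^ 2 := by ring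
    linarith

end Linear

/-! ### Convergence of lines and attracting fixed points -/

section Projective

variable {n : ℕ}

lemma exists_smul_of_mem_submodule {p : ℙ ℝ (R2n n)} {y v : R2n n} (hy : y ∈ p.submodule)
    (hy0 : y ≠ 0) (hv : v ∈ p.submodule) : ∃ c : ℝ, v = c • y := by
  induction p using Projectivization.ind with
  | h w hw =>
    rw [Projectivization.submodule_mk, Submodule.mem_span_singleton] at hy hv
    obtain ⟨a, rfl⟩ := hy
    obtain ⟨b, rfl⟩ := hv
    have ha : a ≠ 0 := fun h => hy0 (by simp [h])
    exact ⟨b / a, by rw [smul_smul, div_mul_cancel₀ _ ha]⟩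

lemma exists_ne_zero_mem_submodule (p : ℙ ℝ (R2n n)) : ∃ y ∈ p.submodule, y ≠ 0 := by
  induction p using Projectivization.ind with
  | h w hw =>
    exact ⟨w, by rw [Projectivization.submodule_mk]; exact Submodule.mem_span_singleton_self w, hw⟩

instance (p : ℙ ℝ (R2n n)) : p.submodule.HasOrthogonalProjection := inferInstance

/-- The orthogonal projection onto a line. -/
def lineProj (p : ℙ ℝ (R2n n)) : R2n n →L[ℝ] R2n n := p.submodule.starProjection

/-- Membership of a vector in a line becomes the closed condition `lineProj p y = y`. Continuity is
checked on the quotient by the explicit formula `⟨v, ·⟩ v / ‖v‖²`. -/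
lemma continuous_lineProj : Continuous (lineProj (n := n)) := by
  refine continuous_coinduced_dom.2 ?_
  have h : (lineProj ∘ fun v : {v : R2n n // v ≠ 0} => Projectivization.mk' ℝ v) =
      fun v : {v : R2n n // v ≠ 0} =>
        (‖v.1‖ ^ 2)⁻¹ • (innerSL ℝ v.1).smulRight v.1 := by
    funext v
    ext1 w
    have : (Projectivization.mk' ℝ v).submodule = Submodule.span ℝ {v.1} := by
      rw [Projectivization.mk'_eq_mk, Projectivization.submodule_mk]
    simp only [Function.comp, lineProj, this]
    rw [Submodule.starProjection_singleton]
    simp [smul_smul, div_eq_inv_mul]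
  rw [h]
  have h1 : Continuous fun v : {v : R2n n // v ≠ 0} => (‖v.1‖ ^ 2)⁻¹ :=
    Continuous.inv₀ (by fun_prop) fun v => pow_ne_zero _ (norm_ne_zero_iff.2 v.2)
  have h2 : Continuous fun v : R2n n => (innerSL ℝ v).smulRight v := by
    refine continuous_clm_apply.2 fun w => ?_
    simp only [ContinuousLinearMap.smulRight_apply, innerSL_apply_apply]
    fun_prop
  exact h1.smul (h2.comp continuous_subtype_val)

lemma lineProj_eq_self_iff (p : ℙ ℝ (R2n n)) (y : R2n n) :
    lineProj p y = y ↔ y ∈ p.submodule := Submodule.starProjection_eq_self_iff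

lemma tendsto_lineProj_apply {ι : Type*} {l : Filter ι} {p : ι → ℙ ℝ (R2n n)}
    {p₀ : ℙ ℝ (R2n n)} {y : ι → R2n n} {y₀ : R2n n} (hp : Tendsto p l (𝓝 p₀))
    (hy : Tendsto y l (𝓝 y₀)) :
    Tendsto (fun i => lineProj (p i) (y i)) l (𝓝 (lineProj p₀ y₀)) := by
  have h0 := continuous_lineProj.tendsto p₀
  have h1 : Tendsto (fun i => lineProj (p i)) l (𝓝 (lineProj p₀)) := h0.comp hp
  have h2 := (isBoundedBilinearMap_apply.continuous.tendsto (lineProj p₀, y₀)).comp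
    (h1.prodMk_nhds hy)
  exact h2

lemma mem_submodule_of_tendsto {ι : Type*} {l : Filter ι} [l.NeBot] {p : ι → ℙ ℝ (R2n n)}
    {p₀ : ℙ ℝ (R2n n)} {y : ι → R2n n} {y₀ : R2n n} (hp : Tendsto p l (𝓝 p₀))
    (hy : Tendsto y l (𝓝 y₀)) (h : ∀ᶠ i in l, y i ∈ (p i).submodule) : y₀ ∈ p₀.submodule := by
  rw [← lineProj_eq_self_iff]
  have h1 := tendsto_lineProj_apply hp hy
  have h2 : Tendsto (fun i => lineProj (p i) (y i)) l (𝓝 y₀) := by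
    refine (hy.congr' ?_)
    exact h.mono fun i hi => ((lineProj_eq_self_iff _ _).2 hi).symm
  exact tendsto_nhds_unique h1 h2

lemma smul_mem_smul_submodule (g : O0 n) (p : ℙ ℝ (R2n n)) {v : R2n n} (hv : v ∈ p.submodule) :
    g • v ∈ (g • p).submodule := by
  rw [mem_smul_submodule, inv_smul_smul]; exact hv

lemma bil_eq_zero_of_mem_ein {x : Ein n} {v w : R2n n} (hv : v ∈ x.1.submodule)
    (hw : w ∈ x.1.submodule) : bil v w = 0 := by
  have h1 := x.2 _ (add_mem hv hw)
  have h2 := x.2 v hv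
  have h3 := x.2 w hw
  simp only [quad] at h1 h2 h3
  rw [bil_add_left, bil_add_right, bil_add_right, h2, h3, bil_comm w v] at h1
  linarith

lemma negPart_ne_zero_of_quad_nonpos {x : R2n n} (hx : quad x ≤ 0) (h0 : x ≠ 0) :
    negPart x ≠ 0 := by
  intro h
  rw [quad_eq_parts, h] at hx
  have h1 := norm_sq_eq_parts x
  rw [h] at h1
  have h2 : 0 < ‖x‖ := norm_pos_iff.2 h0
  simp only [norm_zero] at hx h1
  nlinarith

/-- Rotation by the angle `t` of the negative coordinates. -/
def rotNeg (t : ℝ) (x : R2n n) : R2n n :=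
  inNeg !₂[Real.cos t * x (Sum.inl 0) - Real.sin t * x (Sum.inl 1),
    Real.sin t * x (Sum.inl 0) + Real.cos t * x (Sum.inl 1)] + inPos (posPart x)

lemma continuous_rotNeg (x : R2n n) : Continuous fun t => rotNeg t x := by
  unfold rotNeg
  refine Continuous.add (inNeg.continuous.comp ?_) continuous_const
  refine (PiLp.continuous_toLp 2 _).comp (continuous_pi fun i => ?_)
  fin_cases i
  · simp; fun_prop
  · simp; fun_prop

lemma rotNeg_zero (x : R2n n) : rotNeg 0 x = x := by
  ext (i | j)
  · fin_cases i <;> simp [rotNeg]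
  · simp [rotNeg]

lemma quad_rotNeg (t : ℝ) (x : R2n n) : quad (rotNeg t x) = quad x := by
  rw [quad_eq_parts, quad_eq_parts]
  simp only [rotNeg, map_add, negPart_inNeg, negPart_inPos, posPart_inNeg, posPart_inPos,
    add_zero, zero_add]
  simp only [EuclideanSpace.real_norm_sq_eq (n := Fin 2), Fin.sum_univ_two, negPart_apply]
  simp
  nlinarith [Real.sin_sq_add_cos_sq t]

lemma rotNeg_ne_zero (t : ℝ) {x : R2n n} (hx : quad x = 0) (h0 : x ≠ 0) : rotNeg t x ≠ 0 := by
  intro h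
  have h1 : posPart x = 0 := by
    have := congrArg posPart h
    simpa [rotNeg] using this
  apply negPart_ne_zero_of_quad_nonpos hx.le h0
  rw [quad_eq_parts, h1] at hx
  simp only [norm_zero] at hx
  have : ‖negPart x‖ ^ 2 = 0 := by linarith
  exact norm_eq_zero.1 (pow_eq_zero_iff (two_ne_zero)|>.1 this)

lemma bil_rotNeg (F : R2n n) (t : ℝ) (x : R2n n) : bil F (rotNeg t x) =
    inner ℝ (posPart F) (posPart x)
      - Real.cos t * (F (Sum.inl 0) * x (Sum.inl 0) + F (Sum.inl 1) * x (Sum.inl 1))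
      - Real.sin t * (F (Sum.inl 1) * x (Sum.inl 0) - F (Sum.inl 0) * x (Sum.inl 1)) := by
  rw [bil_eq_parts]
  simp only [rotNeg, map_add, negPart_inNeg, negPart_inPos, posPart_inNeg, posPart_inPos,
    add_zero, zero_add]
  simp only [PiLp.inner_apply (ι := Fin 2), Fin.sum_univ_two]
  simp
  ring

/-- As a function of `t` the pairing is `C - A cos t - B sin t`. Vanishing at `0` and `±s` forces `A
= B = 0`, whereas `A² + B²` is the product of the squared norms of the negative parts, nonzero for
nonzero isotropic vectors. -/
lemma exists_bil_rotNeg_ne_zero {F x : R2n n} (hF : quad F = 0) (hF0 : F ≠ 0) (hx : quad x = 0)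
    (hx0 : x ≠ 0) {ε : ℝ} (hε : 0 < ε) : ∃ t, |t| < ε ∧ bil F (rotNeg t x) ≠ 0 := by
  by_contra hcon
  push Not at hcon
  set s := min (ε / 2) 1 with hs
  have hs0 : 0 < s := lt_min (by linarith) one_pos
  have hsε : s < ε := (min_le_left _ _).trans_lt (by linarith)
  have hs1 : s ≤ 1 := min_le_right _ _
  have e0 := hcon 0 (by simpa using hε)
  have e1 := hcon s (by rwa [abs_of_pos hs0])
  have e2 := hcon (-s) (by rwa [abs_neg, abs_of_pos hs0])
  rw [bil_rotNeg] at e0 e1 e2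
  rw [Real.cos_neg, Real.sin_neg] at e2
  rw [Real.cos_zero, Real.sin_zero] at e0
  have hsin : 0 < Real.sin s := Real.sin_pos_of_pos_of_lt_pi hs0 (by linarith [Real.pi_gt_three])
  have hcos : Real.cos s < 1 := by
    have := Real.sin_sq_add_cos_sq s
    nlinarith [Real.cos_le_one s]
  set A := F (Sum.inl 0) * x (Sum.inl 0) + F (Sum.inl 1) * x (Sum.inl 1) with hA
  set B := F (Sum.inl 1) * x (Sum.inl 0) - F (Sum.inl 0) * x (Sum.inl 1) with hB
  have hB0 : B = 0 := by
    have : Real.sin s * B = 0 := by linarith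
    exact (mul_eq_zero.1 this).resolve_left hsin.ne'
  have hA0 : A = 0 := by
    have : (1 - Real.cos s) * A = 0 := by rw [hB0] at e1 e0; linarith
    exact (mul_eq_zero.1 this).resolve_left (by linarith)
  have h1 : ‖negPart F‖ ^ 2 * ‖negPart x‖ ^ 2 = A ^ 2 + B ^ 2 := by
    simp only [EuclideanSpace.real_norm_sq_eq, Fin.sum_univ_two, negPart_apply, hA, hB]
    ring
  rw [hA0, hB0] at h1
  have h2 : 0 < ‖negPart F‖ := norm_pos_iff.2 (negPart_ne_zero_of_quad_nonpos hF.le hF0)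
  have h3 : 0 < ‖negPart x‖ := norm_pos_iff.2 (negPart_ne_zero_of_quad_nonpos hx.le hx0)
  have : 0 < ‖negPart F‖ ^ 2 * ‖negPart x‖ ^ 2 := by positivity
  linarith

/-- Neighbourhoods in the Einstein universe are not contained in hyperplanes `F^⊥`, `F`
isotropic. -/
lemma exists_mem_nhds_bil_ne_zero {x : Ein n} {V : Set (Ein n)} (hV : V ∈ 𝓝 x) {F : R2n n}
    (hF : quad F = 0) (hF0 : F ≠ 0) : ∃ y ∈ V, ∃ Y ∈ y.1.submodule, bil F Y ≠ 0 := by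
  obtain ⟨X, hX, hX0⟩ := exists_ne_zero_mem_submodule x.1
  have hXq : quad X = 0 := x.2 X hX
  have hmem : ∀ t, ∀ v ∈ (Projectivization.mk ℝ (rotNeg t X)
      (rotNeg_ne_zero t hXq hX0)).submodule, quad v = 0 := by
    intro t v hv
    rw [Projectivization.submodule_mk, Submodule.mem_span_singleton] at hv
    obtain ⟨a, rfl⟩ := hv
    rw [quad, bil_smul_left, bil_smul_right]
    change a * (a * quad (rotNeg t X)) = 0
    rw [quad_rotNeg, hXq, mul_zero, mul_zero]
  let c : ℝ → Ein n := fun t => ⟨Projectivization.mk ℝ (rotNeg t X) _, hmem t⟩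
  have hc : Continuous c := by
    refine Continuous.subtype_mk ?_ _
    have h1 : Continuous fun t : ℝ =>
        (⟨rotNeg t X, rotNeg_ne_zero t hXq hX0⟩ : {v : R2n n // v ≠ 0}) :=
      (continuous_rotNeg X).subtype_mk _
    have h2 : Continuous fun v : {v : R2n n // v ≠ 0} => Projectivization.mk' ℝ v :=
      continuous_coinduced_rng
    exact h2.comp h1
  have hc0 : c 0 = x := by
    apply Subtype.ext
    apply Projectivization.submodule_injective
    change (Projectivization.mk ℝ (rotNeg 0 X) _).submodule = _
    rw [Projectivization.submodule_mk, rotNeg_zero]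
    ext v
    rw [Submodule.mem_span_singleton]
    constructor
    · rintro ⟨a, rfl⟩; exact Submodule.smul_mem _ _ hX
    · intro hv
      obtain ⟨a, rfl⟩ := exists_smul_of_mem_submodule hX hX0 hv
      exact ⟨a, rfl⟩
  have hV' : c ⁻¹' V ∈ 𝓝 (0 : ℝ) := hc.continuousAt (by rw [hc0]; exact hV)
  obtain ⟨ε, hε, hball⟩ := Metric.mem_nhds_iff.1 hV'
  obtain ⟨t, ht, hbt⟩ := exists_bil_rotNeg_ne_zero hF hF0 hXq hX0 hε
  refine ⟨c t, hball (by simpa using ht), rotNeg t X, ?_, hbt⟩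
  change _ ∈ (Projectivization.mk ℝ (rotNeg t X) _).submodule
  rw [Projectivization.submodule_mk]
  exact Submodule.mem_span_singleton_self _

lemma IsAttractingFixedPoint.tendsto_pow {g : O0 n} {x : Ein n} {V : Set (Ein n)}
    (hV : Tendsto (fun p : ℕ × Ein n => g ^ p.1 • p.2) (atTop ×ˢ 𝓟 V) (𝓝 x)) {y : Ein n}
    (hy : y ∈ V) : Tendsto (fun k : ℕ => ((g ^ k • y : Ein n) : ℙ ℝ (R2n n))) atTop (𝓝 x.1) := by
  have h1 : Tendsto (fun k : ℕ => (k, y)) atTop (atTop ×ˢ 𝓟 V) :=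
    tendsto_id.prodMk (tendsto_principal.2 (Eventually.of_forall fun _ => hy))
  have h2 : Continuous fun y : Ein n => (y : ℙ ℝ (R2n n)) := continuous_subtype_val
  have h3 := hV.comp h1
  have h4 := (h2.tendsto x).comp h3
  exact h4

/-- If `g` had finite order, every point of the attracting neighbourhood would equal `x`, but that
neighbourhood contains a point not orthogonal to `x`. -/
lemma IsAttractingFixedPoint.injective_pow {g : O0 n} {x : Ein n}
    (h : IsAttractingFixedPoint g x) : Function.Injective fun k : ℕ => g ^ k := by
  rw [injective_pow_iff_not_isOfFinOrder]
  intro hfin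
  obtain ⟨m, hm, hgm⟩ := isOfFinOrder_iff_pow_eq_one.1 hfin
  obtain ⟨-, V, hV, hlim⟩ := h
  obtain ⟨X, hX, hX0⟩ := exists_ne_zero_mem_submodule x.1
  obtain ⟨y, hy, Y, hY, hXY⟩ := exists_mem_nhds_bil_ne_zero hV (x.2 X hX) hX0
  apply hXY
  refine bil_eq_zero_of_mem_ein hX ?_
  have h1 := (IsAttractingFixedPoint.tendsto_pow hlim hy).comp
    (tendsto_id.const_mul_atTop' hm : Tendsto (fun k : ℕ => m * k) atTop atTop)
  refine mem_submodule_of_tendsto h1 (tendsto_const_nhds (x := Y)) (Eventually.of_forall ?_)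
  intro k
  simp only [Function.comp, pow_mul, hgm, one_pow, one_smul]
  exact hY

end Projective

/-! ### Limits close to rank one maps -/

section Proximal

variable {n : ℕ} {ι : Type*}

/-- Along `l`, the elements `g i` are closer and closer, projectively, to the rank one map
`b(F, ·) E`, and their inverses to `b(E, ·) F`. -/
def ProximalLimit (l : Filter ι) (g : ι → O0 n) (E F : R2n n) : Prop :=
  ∃ (s r : ι → ℝ) (E' F' : ι → R2n n), (∀ᶠ i in l, NearRankOne (g i) (s i) (r i) (E' i) (F' i)) ∧
    Tendsto (fun i => s i / r i) l atTop ∧ Tendsto E' l (𝓝 E) ∧ Tendsto F' l (𝓝 F)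

lemma ProximalLimit.facts {l : Filter ι} [l.NeBot] {g : ι → O0 n} {E F : R2n n}
    (h : ProximalLimit l g E F) : ‖E‖ ^ 2 = 2 ∧ ‖F‖ ^ 2 = 2 ∧ quad E = 0 ∧ quad F = 0 := by
  obtain ⟨s, r, E', F', hnear, -, hE, hF⟩ := h
  refine ⟨?_, ?_, ?_, ?_⟩
  · exact tendsto_nhds_unique (hE.norm.pow 2)
      (tendsto_const_nhds.congr' (hnear.mono fun i hi => hi.norm_E.symm))
  · exact tendsto_nhds_unique (hF.norm.pow 2)
      (tendsto_const_nhds.congr' (hnear.mono fun i hi => hi.norm_F.symm))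
  · exact tendsto_nhds_unique ((continuous_quad.tendsto E).comp hE)
      (tendsto_const_nhds.congr' (hnear.mono fun i hi => hi.quad_E.symm))
  · exact tendsto_nhds_unique ((continuous_quad.tendsto F).comp hF)
      (tendsto_const_nhds.congr' (hnear.mono fun i hi => hi.quad_F.symm))

lemma ProximalLimit.E_ne_zero {l : Filter ι} [l.NeBot] {g : ι → O0 n} {E F : R2n n}
    (h : ProximalLimit l g E F) : E ≠ 0 := by
  rintro rfl
  have := h.facts.1
  simp at this

lemma ProximalLimit.F_ne_zero {l : Filter ι} [l.NeBot] {g : ι → O0 n} {E F : R2n n}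
    (h : ProximalLimit l g E F) : F ≠ 0 := by
  rintro rfl
  have := h.facts.2.1
  simp at this

/-- After division by `s` the error is of order `r / s`, which tends to zero. -/
lemma tendsto_scaled_of_near {l : Filter ι} {T : ι → R2n n → R2n n} {s r : ι → ℝ}
    {E' F' : ι → R2n n} {E F : R2n n} (hr : ∀ᶠ i in l, 1 ≤ r i) (hs : ∀ᶠ i in l, 0 < s i)
    (hsr : Tendsto (fun i => s i / r i) l atTop) (hE : Tendsto E' l (𝓝 E))
    (hF : Tendsto F' l (𝓝 F))
    (h : ∀ᶠ i in l, ∀ x, ‖T i x - (s i * bil (F' i) x) • E' i‖ ≤ r i * ‖x‖)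
    {x : ι → R2n n} {x₀ : R2n n} (hx : Tendsto x l (𝓝 x₀)) :
    Tendsto (fun i => (s i)⁻¹ • T i (x i)) l (𝓝 (bil F x₀ • E)) := by
  have h1 : Tendsto (fun i => bil (F' i) (x i) • E' i) l (𝓝 (bil F x₀ • E)) :=
    (tendsto_bil hF hx).smul hE
  have h2 : Tendsto (fun i => (s i)⁻¹ • T i (x i) - bil (F' i) (x i) • E' i) l (𝓝 0) := by
    have h3 : Tendsto (fun i => (s i / r i)⁻¹ * ‖x i‖) l (𝓝 (0 * ‖x₀‖)) :=
      hsr.inv_tendsto_atTop.mul hx.norm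
    rw [zero_mul] at h3
    refine squeeze_zero_norm' ?_ h3
    filter_upwards [hr, hs, h] with i hri hsi hi
    have h4 : (s i)⁻¹ • T i (x i) - bil (F' i) (x i) • E' i =
        (s i)⁻¹ • (T i (x i) - (s i * bil (F' i) (x i)) • E' i) := by
      rw [smul_sub, smul_smul, ← mul_assoc, inv_mul_cancel₀ hsi.ne', one_mul]
    rw [h4, norm_smul, norm_inv, Real.norm_of_nonneg hsi.le, inv_div, div_eq_inv_mul, mul_assoc]
    exact mul_le_mul_of_nonneg_left (hi _) (inv_nonneg.2 hsi.le)
  have := h2.add h1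
  simpa using this

lemma ProximalLimit.eventually_pos {l : Filter ι} {s r : ι → ℝ} {g : ι → O0 n}
    {E' F' : ι → R2n n} (hnear : ∀ᶠ i in l, NearRankOne (g i) (s i) (r i) (E' i) (F' i))
    (hsr : Tendsto (fun i => s i / r i) l atTop) : ∀ᶠ i in l, 0 < s i := by
  filter_upwards [hnear, hsr.eventually_gt_atTop 0] with i hi hpos
  have : 0 < r i := one_pos.trans_le hi.one_le
  rw [lt_div_iff₀ this] at hpos
  simpa using hpos

/-- The normalised action of the elements and their inverses converges. -/
lemma ProximalLimit.exists_scale {l : Filter ι} {g : ι → O0 n} {E F : R2n n}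
    (h : ProximalLimit l g E F) : ∃ c : ι → ℝ, ∀ (x : ι → R2n n) (x₀ : R2n n),
      Tendsto x l (𝓝 x₀) → Tendsto (fun i => c i • g i • x i) l (𝓝 (bil F x₀ • E)) ∧
        Tendsto (fun i => c i • (g i)⁻¹ • x i) l (𝓝 (bil E x₀ • F)) := by
  obtain ⟨s, r, E', F', hnear, hsr, hE, hF⟩ := h
  have hpos := ProximalLimit.eventually_pos hnear hsr
  have hr : ∀ᶠ i in l, 1 ≤ r i := hnear.mono fun i hi => hi.one_le
  refine ⟨fun i => (s i)⁻¹, fun x x₀ hx => ⟨?_, ?_⟩⟩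
  · exact tendsto_scaled_of_near (T := fun i x => g i • x) hr hpos hsr hE hF
      (hnear.mono fun i hi => hi.fwd) hx
  · exact tendsto_scaled_of_near (T := fun i x => (g i)⁻¹ • x) hr hpos hsr hF hE
      (hnear.mono fun i hi => hi.bwd) hx

/-- The attracting direction of the powers of an element with an attracting fixed point. -/
lemma IsAttractingFixedPoint.mem_of_proximalLimit {g : O0 n} {x : Ein n}
    (hx : IsAttractingFixedPoint g x) {l : Filter ℕ} [l.NeBot] (hl : l ≤ atTop) {E F : R2n n}
    (h : ProximalLimit l (fun k => g ^ k) E F) : E ∈ x.1.submodule := by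
  obtain ⟨-, V, hV, hlim⟩ := hx
  -- The neighbourhood is not contained in `F^⊥`. For `Y` outside it, the rescaled images `g ^ k •
  -- Y` converge to a nonzero multiple of `E`, while their lines converge to `x`.
  obtain ⟨y, hy, Y, hY, hFY⟩ := exists_mem_nhds_bil_ne_zero hV h.facts.2.2.2 h.F_ne_zero
  obtain ⟨c, hc⟩ := h.exists_scale
  have h1 := (hc (fun _ => Y) Y tendsto_const_nhds).1
  have h2 := (IsAttractingFixedPoint.tendsto_pow hlim hy).mono_left hl
  have h3 := mem_submodule_of_tendsto h2 h1 (Eventually.of_forall fun k =>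
    Submodule.smul_mem _ _ (smul_mem_smul_submodule (g ^ k) y.1 hY))
  have h4 := Submodule.smul_mem _ (bil F Y)⁻¹ h3
  rwa [smul_smul, inv_mul_cancel₀ hFY, one_smul] at h4

end Proximal

/-! ### A finiteness criterion for almost invariant subsets -/

/-- A subset of a group that is almost invariant under translations on both sides, and meets the
powers of an element of infinite order in a finite set, is finite. -/
lemma finite_of_almost_invariant {G : Type*} [Group G] (D : Set G) (z : G)
    (hz : Function.Injective fun k : ℕ => z ^ k)
    (h₁ : {d ∈ D | z * d ∉ D}.Finite) (h₂ : {d ∈ D | z⁻¹ * d ∉ D}.Finite)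
    (h₃ : ∀ d ∈ D, {x ∈ D | x * d⁻¹ ∉ D}.Finite)
    (h₄ : {k : ℕ | z ^ k ∈ D}.Finite) (h₅ : {k : ℕ | z⁻¹ ^ k ∈ D}.Finite) : D.Finite := by
  -- If `yᵏ d` stayed in `D` for all `k`, right translation by `d⁻¹` would put all but finitely many
  -- powers `yᵏ` in `D`. So the orbit leaves `D`, and just before leaving it passes through the
  -- finite exit set.
  have key : ∀ y : G, (Function.Injective fun k : ℕ => y ^ k) → {k : ℕ | y ^ k ∈ D}.Finite →
      ∀ d ∈ D, ∃ k : ℕ, y ^ k * d ∈ {d ∈ D | y * d ∉ D} := by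
    intro y hy hfin d hd
    by_contra hcon
    push Not at hcon
    have hall : ∀ k : ℕ, y ^ k * d ∈ D := by
      intro k
      induction k with
      | zero => simpa using hd
      | succ k ih =>
        by_contra hk
        refine hcon k ⟨ih, ?_⟩
        rwa [← mul_assoc, ← pow_succ']
    have hinj : Function.Injective fun k : ℕ => y ^ k * d := fun i j hij =>
      hy (mul_right_cancel hij)
    refine Set.infinite_univ ((hfin.union ((h₃ d hd).preimage hinj.injOn)).subset ?_)
    intro k _
    by_cases hk : y ^ k ∈ D
    · exact Or.inl hk
    · right
      exact ⟨hall k, by rwa [mul_inv_cancel_right]⟩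
  have hz' : Function.Injective fun k : ℕ => z⁻¹ ^ k := by
    intro i j hij
    simp only [inv_pow, inv_inj] at hij
    exact hz hij
  have hfin : (Set.image2 (fun a b => a * b⁻¹) {d ∈ D | z * d ∉ D} {d ∈ D | z⁻¹ * d ∉ D}).Finite :=
    h₁.image2 _ h₂
  obtain ⟨M, hM⟩ := (hfin.preimage hz.injOn).bddAbove
  refine (Set.Finite.biUnion (Set.finite_Iic M) fun k _ => h₁.image fun x => (z ^ k)⁻¹ * x).subset
    fun d hd => ?_
  obtain ⟨k, hk⟩ := key z hz h₄ d hd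
  obtain ⟨j, hj⟩ := key z⁻¹ hz' h₅ d hd
  refine Set.mem_biUnion (x := k) ?_ ⟨z ^ k * d, hk, by simp⟩
  -- With exit points `a = zᵏ d` and `b = z⁻ʲ d`, the product `a b⁻¹ = zᵏ⁺ʲ` lies in a finite set.
  -- This bounds `k`, leaving finitely many `d = z⁻ᵏ a`.
  refine (Nat.le_add_right k j).trans (hM ?_)
  refine ⟨_, hk, _, hj, ?_⟩
  simp only [mul_inv_rev, inv_pow, inv_inv]
  rw [mul_assoc, mul_inv_cancel_left, ← pow_add]

/-! ### Attracting and repelling directions lie over the limit set -/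

section Anosov

variable {n : ℕ} {Γ : Type*} [Group Γ] {S : Finset Γ} {ρ : Γ →* O0 n} {ξ : GromovBoundary S → Ein n}

/-- The cone over the limit set. -/
def limitCone (ξ : GromovBoundary S → Ein n) : Set (R2n n) := {y | ∃ η, y ∈ (ξ η).1.submodule}

lemma smul_mem_limitCone {y : R2n n} (hy : y ∈ limitCone ξ) (c : ℝ) : c • y ∈ limitCone ξ := by
  obtain ⟨η, h⟩ := hy
  exact ⟨η, Submodule.smul_mem _ _ h⟩

lemma mem_limitCone_of_smul {y : R2n n} {c : ℝ} (hc : c ≠ 0) (hy : c • y ∈ limitCone ξ) :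
    y ∈ limitCone ξ := by
  have := smul_mem_limitCone hy c⁻¹
  rwa [smul_smul, inv_mul_cancel₀ hc, one_smul] at this

lemma quad_of_mem_limitCone {y : R2n n} (hy : y ∈ limitCone ξ) : quad y = 0 := by
  obtain ⟨η, h⟩ := hy
  exact (ξ η).2 y h

lemma IsP1Anosov.smul_mem (hρ : IsP1Anosov S ρ ξ) {η : GromovBoundary S} {y : R2n n}
    (hy : y ∈ (ξ η).1.submodule) (γ : Γ) : ρ γ • y ∈ (ξ (γ • η)).1.submodule := by
  rw [hρ.equivariant]
  exact smul_mem_smul_submodule _ _ hy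

lemma IsP1Anosov.smul_mem_limitCone (hρ : IsP1Anosov S ρ ξ) {g : O0 n} (hg : g ∈ ρ.range)
    {y : R2n n} (hy : y ∈ limitCone ξ) : g • y ∈ limitCone ξ := by
  obtain ⟨γ, rfl⟩ := hg
  obtain ⟨η, h⟩ := hy
  exact ⟨γ • η, hρ.smul_mem h γ⟩

lemma IsP1Anosov.bil_ne_zero (hρ : IsP1Anosov S ρ ξ) {η η' : GromovBoundary S} (hne : η ≠ η')
    {y w : R2n n} (hy : y ∈ (ξ η).1.submodule) (hw : w ∈ (ξ η').1.submodule) (hy0 : y ≠ 0)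
    (hw0 : w ≠ 0) : bil y w ≠ 0 := by
  intro h
  refine hρ.transverse η η' hne fun v hv u hu => ?_
  obtain ⟨a, rfl⟩ := exists_smul_of_mem_submodule hw hw0 hv
  obtain ⟨b, rfl⟩ := exists_smul_of_mem_submodule hy hy0 hu
  rw [bil_smul_left, bil_smul_right, bil_comm, h, mul_zero, mul_zero]

/-- The incidence set in `∂Γ × ℝ^{n+2}` is closed, and projecting along the compact factor `∂Γ`
preserves closedness. -/
lemma isClosed_limitCone (hΓ : IsHyperbolicGroup S) (hξ : Continuous ξ) :
    IsClosed (limitCone ξ) := by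
  have := compactSpace_boundary hΓ
  have hproj : Continuous fun η => (ξ η).1 := continuous_subtype_val.comp hξ
  have h1 : Continuous fun η => lineProj (ξ η).1 := continuous_lineProj.comp hproj
  have h2 : Continuous fun p : GromovBoundary S × R2n n => lineProj (ξ p.1).1 p.2 :=
    (h1.comp continuous_fst).clm_apply continuous_snd
  have h3 : IsClosed {p : GromovBoundary S × R2n n | lineProj (ξ p.1).1 p.2 = p.2} :=
    isClosed_eq h2 continuous_snd
  have h4 := isClosedMap_snd_of_compactSpace _ h3
  convert h4 using 1
  ext y
  constructor
  · rintro ⟨η, hη⟩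
    exact ⟨(η, y), (lineProj_eq_self_iff _ _).2 hη, rfl⟩
  · rintro ⟨⟨η, y'⟩, hη, rfl⟩
    exact ⟨η, (lineProj_eq_self_iff _ _).1 hη⟩

lemma exists_proximalLimit (hn : 2 ≤ n) (hΓ : IsHyperbolicGroup S) (hρ : IsP1Anosov S ρ ξ)
    {ι : Type*} (l : Ultrafilter ι) (g : ι → O0 n) (hg : ∀ i, g i ∈ ρ.range)
    (hl : Tendsto g l cofinite) : ∃ E F, ProximalLimit (l : Filter ι) g E F := by
  have hΓc := countable_of_generates hΓ.generates
  have hinf : Infinite ρ.range := by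
    by_contra hfin
    rw [not_infinite_iff_finite] at hfin
    have h1 : ((ρ.range : Set (O0 n))).Finite := Set.toFinite _
    obtain ⟨i, hi⟩ := (hl.eventually h1.eventually_cofinite_notMem).exists
    exact hi (hg i)
  have hcount : Countable ρ.range :=
    (ρ.rangeRestrict_surjective).countable
  obtain ⟨hden⟩ := nonempty_denumerable ρ.range
  let e : ℕ ≃ ρ.range := (Denumerable.eqv ρ.range).symm
  -- One enumeration of the whole group `ρ(Γ)` is divergent, and any family leaving finite sets
  -- factors through it. So the index type and repetitions do not matter.
  obtain ⟨t, ht, hlim⟩ := hρ.divergent (fun k => (e k : O0 n)) (fun k => (e k).2)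
    (Subtype.val_injective.comp e.injective)
  choose E₀ F₀ hEF using fun k => exists_nearRankOne hn (e k : O0 n) (t k) (ht k)
  let k : ι → ℕ := fun i => e.symm ⟨g i, hg i⟩
  have hk : Tendsto k l atTop := by
    rw [← Nat.cofinite_eq_atTop]
    have h1 : Tendsto (fun i => (⟨g i, hg i⟩ : ρ.range)) l cofinite := by
      intro s hs
      have h2 : (Subtype.val '' sᶜ : Set (O0 n)).Finite := (mem_cofinite.1 hs).image _
      rw [mem_map]
      filter_upwards [hl.eventually h2.eventually_cofinite_notMem] with i hi
      by_contra hi'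
      exact hi ⟨_, hi', rfl⟩
    exact e.symm.injective.tendsto_cofinite.comp h1
  have hek : ∀ i, (e (k i) : O0 n) = g i := by
    intro i
    simp only [k, Equiv.apply_symm_apply]
  have hbd : ∀ v : R2n n, ‖v‖ ^ 2 = 2 → v ∈ Metric.closedBall (0 : R2n n) 2 := by
    intro v hv
    rw [mem_closedBall_zero_iff]
    nlinarith [norm_nonneg v]
  obtain ⟨E, -, hE⟩ := (isCompact_closedBall (0 : R2n n) 2).ultrafilter_le_nhds
    (l.map fun i => E₀ (k i)) (by
      rw [le_principal_iff, Ultrafilter.coe_map, mem_map]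
      exact univ_mem' fun i => hbd _ (hEF (k i)).norm_E)
  obtain ⟨F, -, hF⟩ := (isCompact_closedBall (0 : R2n n) 2).ultrafilter_le_nhds
    (l.map fun i => F₀ (k i)) (by
      rw [le_principal_iff, Ultrafilter.coe_map, mem_map]
      exact univ_mem' fun i => hbd _ (hEF (k i)).norm_F)
  refine ⟨E, F, fun i => Real.exp (t (k i) 0) / 2, fun i => Real.exp (t (k i) 1),
    fun i => E₀ (k i), fun i => F₀ (k i), Eventually.of_forall fun i => ?_, ?_, hE, hF⟩
  · rw [← hek i]; exact hEF (k i)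
  · have h1 : Tendsto (fun i => Real.exp (t (k i) 0 - t (k i) 1) * (1 / 2)) l atTop :=
      (Real.tendsto_exp_atTop.comp (hlim.comp hk)).atTop_mul_const (by norm_num)
    refine h1.congr fun i => ?_
    rw [Real.exp_sub]; ring

variable {ι : Type*}

/-- Relates the rescaling `1 / s` to the operator norm, in which `contractingSet` is defined. The
constant is `r + 2 s ≤ 3 s`, with `2 = ‖E'‖ ‖F'‖`. -/
lemma ProximalLimit.norm_bound {l : Filter ι} {g : ι → O0 n} {E F : R2n n}
    (h : ProximalLimit l g E F) : ∃ c : ι → ℝ, (∀ᶠ i in l, 0 < c i ∧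
      c i * ‖(g i).toGL.1‖ ≤ 3) ∧ ∀ x, Tendsto (fun i => c i • g i • x) l (𝓝 (bil F x • E)) := by
  obtain ⟨s, r, E', F', hnear, hsr, hE, hF⟩ := h
  have hpos := ProximalLimit.eventually_pos hnear hsr
  have hr : ∀ᶠ i in l, 1 ≤ r i := hnear.mono fun i hi => hi.one_le
  refine ⟨fun i => (s i)⁻¹, ?_, fun x => tendsto_scaled_of_near (T := fun i x => g i • x) hr hpos
    hsr hE hF (hnear.mono fun i hi => hi.fwd) tendsto_const_nhds⟩
  filter_upwards [hnear, hpos, hsr.eventually_ge_atTop 1] with i hi hsi hsri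
  have hri : 0 < r i := one_pos.trans_le hi.one_le
  rw [le_div_iff₀ hri, one_mul] at hsri
  refine ⟨inv_pos.2 hsi, ?_⟩
  have hnorm : ‖(g i).toGL.1‖ ≤ 3 * s i := by
    refine ContinuousLinearMap.opNorm_le_bound _ (by positivity) fun x => ?_
    have h1 := hi.fwd x
    have h2 : ‖(s i * bil (F' i) x) • E' i‖ ≤ 2 * s i * ‖x‖ := by
      rw [norm_smul, Real.norm_eq_abs, abs_mul, abs_of_pos hsi]
      have h3 := abs_bil_le (F' i) x
      have h4 : ‖F' i‖ * ‖E' i‖ = 2 := by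
        have h5 : ‖F' i‖ = ‖E' i‖ :=
          (sq_eq_sq₀ (norm_nonneg _) (norm_nonneg _)).1 (hi.norm_F.trans hi.norm_E.symm)
        rw [h5, ← sq, hi.norm_E]
      calc s i * |bil (F' i) x| * ‖E' i‖ ≤ s i * (‖F' i‖ * ‖x‖) * ‖E' i‖ := by gcongr
        _ = s i * ‖x‖ * (‖F' i‖ * ‖E' i‖) := by ring
        _ = 2 * s i * ‖x‖ := by rw [h4]; ring
    have h6 : ‖g i • x‖ ≤ r i * ‖x‖ + 2 * s i * ‖x‖ := by
      have := norm_add_le (g i • x - (s i * bil (F' i) x) • E' i) ((s i * bil (F' i) x) • E' i)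
      rw [sub_add_cancel] at this
      linarith
    have h7 : r i * ‖x‖ ≤ s i * ‖x‖ := mul_le_mul_of_nonneg_right hsri (norm_nonneg _)
    rw [← smul_eq_toGL]
    linarith
  rw [inv_mul_le_iff₀ hsi]
  linarith

/-- The rescaled images of `y` stay in the closed invariant cone and converge to a nonzero multiple
of `E`. -/
lemma IsP1Anosov.E_mem (hΓ : IsHyperbolicGroup S) (hρ : IsP1Anosov S ρ ξ) {l : Filter ι} [l.NeBot]
    {g : ι → O0 n} (hg : ∀ i, g i ∈ ρ.range) {E F : R2n n} (h : ProximalLimit l g E F)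
    {y : R2n n} (hy : y ∈ limitCone ξ) (hFy : bil F y ≠ 0) : E ∈ limitCone ξ := by
  obtain ⟨c, hc⟩ := h.exists_scale
  refine mem_limitCone_of_smul hFy ((isClosed_limitCone hΓ hρ.continuous).mem_of_tendsto
    (hc (fun _ => y) y tendsto_const_nhds).1 (Eventually.of_forall fun i => ?_))
  exact CausalGeod.smul_mem_limitCone (hρ.smul_mem_limitCone (hg i) hy) _

lemma IsP1Anosov.F_mem (hΓ : IsHyperbolicGroup S) (hρ : IsP1Anosov S ρ ξ) {l : Filter ι} [l.NeBot]
    {g : ι → O0 n} (hg : ∀ i, g i ∈ ρ.range) {E F : R2n n} (h : ProximalLimit l g E F)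
    {y : R2n n} (hy : y ∈ limitCone ξ) (hEy : bil E y ≠ 0) : F ∈ limitCone ξ := by
  obtain ⟨c, hc⟩ := h.exists_scale
  refine mem_limitCone_of_smul hEy ((isClosed_limitCone hΓ hρ.continuous).mem_of_tendsto
    (hc (fun _ => y) y tendsto_const_nhds).2 (Eventually.of_forall fun i => ?_))
  exact CausalGeod.smul_mem_limitCone (hρ.smul_mem_limitCone (inv_mem (hg i)) hy) _

lemma IsP1Anosov.exists_transverse (hρ : IsP1Anosov S ρ ξ) {η₁ η₂ : GromovBoundary S}
    (hne : η₁ ≠ η₂) {X₁ X₂ : R2n n} (h₁ : X₁ ∈ (ξ η₁).1.submodule) (h₂ : X₂ ∈ (ξ η₂).1.submodule)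
    (h₁0 : X₁ ≠ 0) (h₂0 : X₂ ≠ 0) {w : R2n n} (hw : w ∈ limitCone ξ) (hw0 : w ≠ 0) :
    bil w X₁ ≠ 0 ∨ bil w X₂ ≠ 0 := by
  obtain ⟨θ, hθ⟩ := hw
  by_cases h : θ = η₁
  · right
    exact hρ.bil_ne_zero (h.trans_ne hne) hθ h₂ hw0 h₂0
  · left
    exact hρ.bil_ne_zero h hθ h₁ hw0 h₁0

/-- By transversality a vector over the limit set cannot be orthogonal to two distinct limit points,
so the inverses bring one of them to the direction of `F`. -/
lemma IsP1Anosov.F_mem_of_E_mem (hΓ : IsHyperbolicGroup S) (hρ : IsP1Anosov S ρ ξ)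
    {η₁ η₂ : GromovBoundary S} (hne : η₁ ≠ η₂) {l : Filter ι} [l.NeBot] {g : ι → O0 n}
    (hg : ∀ i, g i ∈ ρ.range) {E F : R2n n} (h : ProximalLimit l g E F) (hE : E ∈ limitCone ξ) :
    F ∈ limitCone ξ := by
  obtain ⟨X₁, hX₁, hX₁0⟩ := exists_ne_zero_mem_submodule (ξ η₁).1
  obtain ⟨X₂, hX₂, hX₂0⟩ := exists_ne_zero_mem_submodule (ξ η₂).1
  rcases hρ.exists_transverse hne hX₁ hX₂ hX₁0 hX₂0 hE h.E_ne_zero with h1 | h1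
  · exact hρ.F_mem hΓ hg h ⟨η₁, hX₁⟩ h1
  · exact hρ.F_mem hΓ hg h ⟨η₂, hX₂⟩ h1

/-- A vector of the cone not orthogonal to `F` would bring `E`, and then `F`, into the cone. -/
lemma IsP1Anosov.bil_eq_zero (hΓ : IsHyperbolicGroup S) (hρ : IsP1Anosov S ρ ξ)
    {η₁ η₂ : GromovBoundary S} (hne : η₁ ≠ η₂) {l : Filter ι} [l.NeBot] {g : ι → O0 n}
    (hg : ∀ i, g i ∈ ρ.range) {E F : R2n n} (h : ProximalLimit l g E F) (hF : F ∉ limitCone ξ)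
    {y : R2n n} (hy : y ∈ limitCone ξ) : bil F y = 0 := by
  by_contra hFy
  exact hF (hρ.F_mem_of_E_mem hΓ hne hg h (hρ.E_mem hΓ hg h hy hFy))

/-- The elements of `ρ(Γ)` that contract both `X₁` and `X₂`. -/
def contractingSet (ρ : Γ →* O0 n) (ε : ℝ) (X₁ X₂ : R2n n) : Set (O0 n) :=
  {g | g ∈ ρ.range ∧ ‖g • X₁‖ < ε * ‖g.toGL.1‖ ∧ ‖g • X₂‖ < ε * ‖g.toGL.1‖}

lemma norm_smul_le (g : O0 n) (x : R2n n) : ‖g • x‖ ≤ ‖g.toGL.1‖ * ‖x‖ :=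
  g.toGL.1.le_opNorm x

/-- The rescaled image of `X` tends to zero, while that of the test vector `b⁻¹ • negFlip F` has a
nonzero limit and so bounds the operator norm from below. -/
lemma ProximalLimit.eventually_contract {l : Filter ι} [l.NeBot] {g : ι → O0 n} {E F : R2n n}
    (h : ProximalLimit l g E F) {ε : ℝ} (hε : 0 < ε) (a b : O0 n) {X : R2n n}
    (hX : bil F (b • X) = 0) :
    ∀ᶠ i in l, ‖(a * g i * b) • X‖ < ε * ‖(a * g i * b).toGL.1‖ := by
  obtain ⟨c, hc, hlim⟩ := h.norm_bound
  set x : R2n n := b⁻¹ • negFlip F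
  have h1 : Tendsto (fun i => a • c i • g i • (b • x)) l (𝓝 (a • (bil F (b • x) • E))) :=
    ((continuous_smul_vec a).tendsto _).comp (hlim (b • x))
  have h2 : Tendsto (fun i => a • c i • g i • (b • X)) l (𝓝 (a • (bil F (b • X) • E))) :=
    ((continuous_smul_vec a).tendsto _).comp (hlim (b • X))
  rw [hX, zero_smul, smul_zero] at h2
  have h3 : a • (bil F (b • x) • E) ≠ 0 := by
    rw [smul_ne_zero_iff_ne, smul_ne_zero_iff]
    refine ⟨?_, h.E_ne_zero⟩
    simp only [x]
    rw [smul_inv_smul, bil_negFlip_self]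
    exact pow_ne_zero _ (norm_ne_zero_iff.2 h.F_ne_zero)
  have h4 : Tendsto (fun i => ε * ‖a • c i • g i • (b • x)‖ - ‖a • c i • g i • (b • X)‖ * ‖x‖) l
      (𝓝 (ε * ‖a • (bil F (b • x) • E)‖ - ‖(0 : R2n n)‖ * ‖x‖)) :=
    (h1.norm.const_mul ε).sub (h2.norm.mul_const _)
  have h5 : 0 < ε * ‖a • (bil F (b • x) • E)‖ - ‖(0 : R2n n)‖ * ‖x‖ := by
    rw [norm_zero, zero_mul, sub_zero]
    exact mul_pos hε (norm_pos_iff.2 h3)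
  filter_upwards [hc, (tendsto_order.1 h4).1 0 h5] with i hci' hi
  have hci := hci'.1
  have e : ∀ y : R2n n, a • c i • g i • (b • y) = c i • (a * g i * b) • y := by
    intro y
    rw [smul_comm a (c i), mul_smul, mul_smul]
  have e' : ∀ y : R2n n, ‖c i • y‖ = c i * ‖y‖ := fun y => by
    rw [norm_smul, Real.norm_of_nonneg hci.le]
  rw [e, e, e', e'] at hi
  have h6 := norm_smul_le (a * g i * b) x
  have hx : 0 < ‖x‖ := by
    refine norm_pos_iff.2 ?_
    simp only [x]
    rw [smul_ne_zero_iff_ne, ← norm_ne_zero_iff, norm_negFlip, norm_ne_zero_iff]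
    exact h.F_ne_zero
  have h7 : c i * (‖(a * g i * b) • X‖ * ‖x‖) <
      c i * (ε * ‖(a * g i * b).toGL.1‖ * ‖x‖) := by
    have h8 : ε * (c i * ‖(a * g i * b) • x‖) ≤
        ε * (c i * (‖(a * g i * b).toGL.1‖ * ‖x‖)) := by gcongr
    nlinarith
  exact lt_of_mul_lt_mul_right (lt_of_mul_lt_mul_left h7 hci.le) hx.le

/-- Approximate converse of `eventually_contract`: uniform contraction of `X` makes `F` almost
orthogonal to `X`. -/
lemma ProximalLimit.abs_bil_le {l : Filter ι} [l.NeBot] {g : ι → O0 n} {E F : R2n n}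
    (h : ProximalLimit l g E F) {ε : ℝ} {X : R2n n}
    (hX : ∀ᶠ i in l, ‖g i • X‖ < ε * ‖(g i).toGL.1‖) (hε : 0 < ε) : |bil F X| ≤ 3 * ε := by
  obtain ⟨c, hc, hlim⟩ := h.norm_bound
  have h1 : ‖bil F X • E‖ ≤ 3 * ε := by
    refine le_of_tendsto (hlim X).norm ?_
    filter_upwards [hc, hX] with i ⟨hci, hi⟩ hXi
    rw [norm_smul, Real.norm_of_nonneg hci.le]
    have := mul_lt_mul_of_pos_left hXi hci
    nlinarith
  rw [norm_smul, Real.norm_eq_abs] at h1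
  have h2 : 1 ≤ ‖E‖ := by nlinarith [h.facts.1, norm_nonneg E]
  nlinarith [abs_nonneg (bil F X)]

/-- The two-sided dynamics: an element of `ρ(Γ)` acting with an attracting and a repelling fixed
point in the limit set. -/
structure IsLoxodromic (ρ : Γ →* O0 n) (ξ : GromovBoundary S → Ein n) (z : O0 n)
    (η₁ η₂ : GromovBoundary S) : Prop where
  mem : z ∈ ρ.range
  ne : η₁ ≠ η₂
  attr : IsAttractingFixedPoint z (ξ η₁)
  attr_inv : IsAttractingFixedPoint z⁻¹ (ξ η₂)

lemma IsP1Anosov.exists_isLoxodromic (hΓ : IsHyperbolicGroup S) (hρ : IsP1Anosov S ρ ξ)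
    [Infinite Γ] : ∃ z η₁ η₂, IsLoxodromic ρ ξ z η₁ η₂ := by
  obtain ⟨z, η₁, η₂, hne, h₁, h₂⟩ := exists_loxodromic hΓ
  refine ⟨ρ z, η₁, η₂, ⟨z, rfl⟩, hne, hρ.dynamicsPreserving z η₁ h₁, ?_⟩
  rw [← map_inv]
  exact hρ.dynamicsPreserving _ η₂ h₂

lemma IsLoxodromic.inv {z : O0 n} {η₁ η₂ : GromovBoundary S} (h : IsLoxodromic ρ ξ z η₁ η₂) :
    IsLoxodromic ρ ξ z⁻¹ η₂ η₁ :=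
  ⟨inv_mem h.mem, h.ne.symm, h.attr_inv, by rw [inv_inv]; exact h.attr⟩

lemma exists_ultrafilter_of_infinite {A : Set ι} (hA : A.Infinite) :
    ∃ l : Ultrafilter ι, (l : Filter ι) ≤ cofinite ∧ A ∈ l := by
  have : (cofinite ⊓ 𝓟 A).NeBot := cofinite_inf_principal_neBot_iff.2 hA
  obtain ⟨l, hl⟩ := Ultrafilter.exists_le (cofinite ⊓ 𝓟 A)
  exact ⟨l, hl.trans inf_le_left, le_principal_iff.1 (hl.trans inf_le_right)⟩

/-- Limits of sequences in `ρ(Γ)` have their attracting and repelling directions in the limit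
set. -/
theorem IsP1Anosov.limit_mem (hn : 2 ≤ n) (hΓ : IsHyperbolicGroup S) (hρ : IsP1Anosov S ρ ξ)
    {z : O0 n} {η₁ η₂ : GromovBoundary S} (hz : IsLoxodromic ρ ξ z η₁ η₂) (l : Ultrafilter ι)
    {g : ι → O0 n} (hg : ∀ i, g i ∈ ρ.range) (hl : Tendsto g l cofinite) {E F : R2n n}
    (h : ProximalLimit (l : Filter ι) g E F) : E ∈ limitCone ξ ∧ F ∈ limitCone ξ := by
  obtain ⟨X₁, hX₁, hX₁0⟩ := exists_ne_zero_mem_submodule (ξ η₁).1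
  obtain ⟨X₂, hX₂, hX₂0⟩ := exists_ne_zero_mem_submodule (ξ η₂).1
  have hX₁c : X₁ ∈ limitCone ξ := ⟨η₁, hX₁⟩
  have hX₂c : X₂ ∈ limitCone ξ := ⟨η₂, hX₂⟩
  have htr : ∀ w ∈ limitCone ξ, w ≠ 0 → bil w X₁ ≠ 0 ∨ bil w X₂ ≠ 0 := fun w hw hw0 =>
    hρ.exists_transverse hz.ne hX₁ hX₂ hX₁0 hX₂0 hw hw0
  -- a uniform lower bound on the limit set
  obtain ⟨ε, hε, hεb⟩ : ∃ ε : ℝ, 0 < ε ∧ ∀ w ∈ limitCone ξ, ‖w‖ ^ 2 = 2 →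
      3 * ε < |bil w X₁| ∨ 3 * ε < |bil w X₂| := by
    have hK : IsCompact {w | w ∈ limitCone ξ ∧ ‖w‖ ^ 2 = 2} := by
      refine (isCompact_closedBall (0 : R2n n) 2).of_isClosed_subset
        ((isClosed_limitCone hΓ hρ.continuous).inter
          (isClosed_eq (by fun_prop) continuous_const)) ?_
      rintro w ⟨-, hw⟩
      rw [mem_closedBall_zero_iff]
      nlinarith [norm_nonneg w]
    have hcont : ∀ X : R2n n, Continuous fun w : R2n n => |bil w X| := by
      intro X
      refine continuous_abs.comp ?_
      exact continuous_iff_continuousAt.2 fun w => tendsto_bil tendsto_id tendsto_const_nhds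
    rcases Set.eq_empty_or_nonempty {w | w ∈ limitCone ξ ∧ ‖w‖ ^ 2 = 2} with hem | hnem
    · exact ⟨1, one_pos, fun w hw hw2 => absurd hem (Set.Nonempty.ne_empty ⟨w, hw, hw2⟩)⟩
    · obtain ⟨w₀, ⟨hw₀, hw₀2⟩, hmin⟩ := hK.exists_isMinOn hnem
        (f := fun w => max |bil w X₁| |bil w X₂|)
        ((hcont X₁).max (hcont X₂)).continuousOn
      have hw₀0 : w₀ ≠ 0 := by
        rintro rfl
        simp at hw₀2
      have hpos : 0 < max |bil w₀ X₁| |bil w₀ X₂| := by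
        rcases htr w₀ hw₀ hw₀0 with h1 | h1
        · exact lt_max_of_lt_left (abs_pos.2 h1)
        · exact lt_max_of_lt_right (abs_pos.2 h1)
      refine ⟨max |bil w₀ X₁| |bil w₀ X₂| / 4, by positivity, fun w hw hw2 => ?_⟩
      have h1 : max |bil w₀ X₁| |bil w₀ X₂| ≤ max |bil w X₁| |bil w X₂| := hmin ⟨hw, hw2⟩
      exact lt_max_iff.1 (by linarith)
  set D := contractingSet ρ ε X₁ X₂ with hD
  -- Along `D` the vector `F'` is almost orthogonal to both `X₁` and `X₂`, which the choice of `ε`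
  -- excludes inside the cone.
  have hDlim : ∀ {κ : Type _} {l' : Filter κ} [l'.NeBot] {g' : κ → O0 n} {E' F' : R2n n},
      ProximalLimit l' g' E' F' → (∀ᶠ i in l', g' i ∈ D) → F' ∉ limitCone ξ := by
    intro κ l' _ g' E' F' h' hD' hF'
    have h1 := h'.abs_bil_le (hD'.mono fun i hi => hi.2.1) hε
    have h2 := h'.abs_bil_le (hD'.mono fun i hi => hi.2.2) hε
    rcases hεb F' hF' h'.facts.2.1 with h3 | h3 <;> linarith
  -- Were there infinitely many exceptions, a limit of them would have `F'` orthogonal to the whole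
  -- cone, hence to `b • X₁` and `b • X₂`. Then `a d b` would eventually contract `X₁` and `X₂` and
  -- lie in `D`.
  have hDtrans : ∀ a ∈ ρ.range, ∀ b ∈ ρ.range, {d ∈ D | a * d * b ∉ D}.Finite := by
    intro a ha b hb
    by_contra hinf
    obtain ⟨l', hl', hmem⟩ := exists_ultrafilter_of_infinite (ι := O0 n) hinf
    -- replace the identity by a map with values in `ρ(Γ)`
    classical
    let g' : O0 n → O0 n := fun d => if d ∈ ρ.range then d else 1
    have hg' : ∀ d, g' d ∈ ρ.range := by
      intro d
      by_cases hd : d ∈ ρ.range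
      · simp only [g', if_pos hd]; exact hd
      · simp only [g', if_neg hd]; exact one_mem _
    have heq : ∀ᶠ d in (l' : Filter (O0 n)), g' d = d := by
      filter_upwards [hmem] with d hd
      exact if_pos hd.1.1
    have ht : Tendsto g' l' cofinite := (tendsto_id.mono_right hl').congr'
      (heq.mono fun d hd => hd.symm)
    obtain ⟨E', F', h'⟩ := exists_proximalLimit hn hΓ hρ l' g' hg' ht
    have hF' : F' ∉ limitCone ξ := by
      refine hDlim h' ?_
      filter_upwards [hmem, heq] with d hd hd'
      rw [hd']; exact hd.1
    have hb' : ∀ {y}, y ∈ limitCone ξ → bil F' y = 0 := fun hy =>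
      hρ.bil_eq_zero hΓ hz.ne hg' h' hF' hy
    have e1 := h'.eventually_contract hε a b (X := X₁)
      (hb' (hρ.smul_mem_limitCone hb hX₁c))
    have e2 := h'.eventually_contract hε a b (X := X₂)
      (hb' (hρ.smul_mem_limitCone hb hX₂c))
    obtain ⟨d, ⟨⟨h1, h2⟩, h3⟩, h4⟩ := (((e1.and e2).and heq).and hmem).exists
    rw [h3] at h1 h2
    exact h4.2 ⟨mul_mem (mul_mem ha h4.1.1) hb, h1, h2⟩
  -- Powers of a loxodromic element have `E'` over its attracting point, hence `F'` in the cone, so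
  -- they cannot stay in `D`.
  have hpow : ∀ {y : O0 n} {θ₁ θ₂ : GromovBoundary S}, IsLoxodromic ρ ξ y θ₁ θ₂ →
      {k : ℕ | y ^ k ∈ D}.Finite := by
    intro y θ₁ θ₂ hy
    by_contra hinf
    obtain ⟨l', hl', hmem⟩ := exists_ultrafilter_of_infinite hinf
    have hg' : ∀ k : ℕ, y ^ k ∈ ρ.range := fun k => pow_mem hy.mem k
    obtain ⟨E', F', h'⟩ := exists_proximalLimit hn hΓ hρ l' (fun k => y ^ k) hg'
      (hy.attr.injective_pow.tendsto_cofinite.mono_left hl')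
    have hE' : E' ∈ limitCone ξ :=
      ⟨θ₁, hy.attr.mem_of_proximalLimit (hl'.trans_eq Nat.cofinite_eq_atTop) h'⟩
    exact hDlim h' hmem (hρ.F_mem_of_E_mem hΓ hz.ne hg' h' hE')
  have hDfin : D.Finite := by
    refine finite_of_almost_invariant D z hz.attr.injective_pow ?_ ?_ ?_ (hpow hz) (hpow hz.inv)
    · simpa using hDtrans z hz.mem 1 (one_mem _)
    · simpa using hDtrans z⁻¹ (inv_mem hz.mem) 1 (one_mem _)
    · intro d hd
      simpa using hDtrans 1 (one_mem _) d⁻¹ (inv_mem hd.1)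
  have hF : F ∈ limitCone ξ := by
    -- If `F` were outside the cone, the `g i` would eventually contract `X₁` and `X₂`, hence lie in
    -- the finite set `D` that they leave.
    by_contra hF
    have hb' : ∀ {y}, y ∈ limitCone ξ → bil F y = 0 := fun hy =>
      hρ.bil_eq_zero hΓ hz.ne hg h hF hy
    have e1 := h.eventually_contract hε 1 1 (X := X₁) (by rw [one_smul]; exact hb' hX₁c)
    have e2 := h.eventually_contract hε 1 1 (X := X₂) (by rw [one_smul]; exact hb' hX₂c)
    obtain ⟨i, ⟨h1, h2⟩, h3⟩ := ((e1.and e2).and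
      (hl.eventually hDfin.eventually_cofinite_notMem)).exists
    rw [one_mul, mul_one] at h1 h2
    exact h3 ⟨hg i, h1, h2⟩
  refine ⟨?_, hF⟩
  rcases htr F hF h.F_ne_zero with h1 | h1
  · exact hρ.E_mem hΓ hg h hX₁c h1
  · exact hρ.E_mem hΓ hg h hX₂c h1

end Anosov

/-! ### Causal geodesics as graphs of contractions -/

section Graph

variable {n : ℕ}

/-- Linear maps from the negative to the positive coordinates. -/
abbrev SlopeSpace (n : ℕ) : Type := EuclideanSpace ℝ (Fin 2) →L[ℝ] EuclideanSpace ℝ (Fin n)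

/-- The parametrisation of the graph of a linear map. -/
def graphMap (A : SlopeSpace n) : EuclideanSpace ℝ (Fin 2) →L[ℝ] R2n n := inNeg + inPos.comp A

@[simp] lemma negPart_graphMap (A : SlopeSpace n) (u : EuclideanSpace ℝ (Fin 2)) :
    negPart (graphMap A u) = u := by
  simp [graphMap]

@[simp] lemma posPart_graphMap (A : SlopeSpace n) (u : EuclideanSpace ℝ (Fin 2)) :
    posPart (graphMap A u) = A u := by
  simp [graphMap]

lemma graphMap_injective (A : SlopeSpace n) : Function.Injective (graphMap A) := by
  intro u v h
  simpa using congrArg negPart h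

/-- The graph of a linear map, as a 2-plane. -/
def graphPlane (A : SlopeSpace n) : Gr2 n :=
  ⟨LinearMap.range (graphMap A : EuclideanSpace ℝ (Fin 2) →ₗ[ℝ] R2n n), by
    rw [LinearMap.finrank_range_of_inj (graphMap_injective A)]; simp⟩

lemma mem_graphPlane {A : SlopeSpace n} {v : R2n n} :
    v ∈ (graphPlane A).plane ↔ posPart v = A (negPart v) := by
  change v ∈ LinearMap.range _ ↔ _
  rw [LinearMap.mem_range]
  constructor
  · rintro ⟨u, rfl⟩
    simp
  · intro h
    refine ⟨negPart v, ?_⟩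
    rw [← inNeg_add_inPos v]
    simp [graphMap, h]

lemma graphMap_mem (A : SlopeSpace n) (u : EuclideanSpace ℝ (Fin 2)) :
    graphMap A u ∈ (graphPlane A).plane := by
  rw [mem_graphPlane]; simp

lemma graphMap_negPart {A : SlopeSpace n} {v : R2n n} (h : v ∈ (graphPlane A).plane) :
    graphMap A (negPart v) = v := by
  rw [mem_graphPlane] at h
  conv_rhs => rw [← inNeg_add_inPos v, h]
  simp [graphMap]

lemma Gr2.eq_of_le {P Q : Gr2 n} (h : P.plane ≤ Q.plane) : P = Q :=
  Gr2.ext (Submodule.eq_of_le_of_finrank_eq h (P.finrank_eq.trans Q.finrank_eq.symm))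

lemma graphPlane_injective : Function.Injective (graphPlane (n := n)) := by
  intro A B h
  ext1 u
  have h1 := graphMap_mem A u
  rw [h, mem_graphPlane] at h1
  simpa using h1

/-- The linear map with a given 2-frame as the image of the standard basis. -/
def frameMap (v : Fin 2 → R2n n) : EuclideanSpace ℝ (Fin 2) →L[ℝ] R2n n :=
  ∑ i, (EuclideanSpace.proj i : EuclideanSpace ℝ (Fin 2) →L[ℝ] ℝ).smulRight (v i)

lemma frameMap_apply (v : Fin 2 → R2n n) (u : EuclideanSpace ℝ (Fin 2)) :
    frameMap v u = u 0 • v 0 + u 1 • v 1 := by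
  simp [frameMap, Fin.sum_univ_two]

lemma continuous_frameMap : Continuous (frameMap (n := n)) := by
  refine continuous_clm_apply.2 fun u => ?_
  simp only [frameMap_apply]
  fun_prop

lemma frameMap_mem (v : {v : Fin 2 → R2n n // LinearIndependent ℝ v})
    (u : EuclideanSpace ℝ (Fin 2)) : frameMap v.1 u ∈ (frameSpan v).plane := by
  rw [frameMap_apply]
  exact add_mem (Submodule.smul_mem _ _ (Submodule.subset_span ⟨0, rfl⟩))
    (Submodule.smul_mem _ _ (Submodule.subset_span ⟨1, rfl⟩))

lemma frameMap_injective (v : {v : Fin 2 → R2n n // LinearIndependent ℝ v}) :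
    Function.Injective (frameMap v.1) := by
  rw [injective_iff_map_eq_zero]
  intro u hu
  rw [frameMap_apply] at hu
  have h := Fintype.linearIndependent_iff.1 v.2 u (by rw [Fin.sum_univ_two]; exact hu)
  ext i
  exact h i

lemma frameSpan_eq_graphPlane_iff (v : {v : Fin 2 → R2n n // LinearIndependent ℝ v})
    (A : SlopeSpace n) : frameSpan v = graphPlane A ↔
      posPart.comp (frameMap v.1) = A.comp (negPart.comp (frameMap v.1)) := by
  constructor
  · intro h
    ext1 u
    have h1 := frameMap_mem v u
    rw [h, mem_graphPlane] at h1
    exact h1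
  · intro h
    refine Gr2.eq_of_le ?_
    refine Submodule.span_le.2 ?_
    rintro _ ⟨i, rfl⟩
    rw [SetLike.mem_coe, mem_graphPlane]
    have h1 := DFunLike.congr_fun h (EuclideanSpace.single i 1)
    have h2 : frameMap v.1 (EuclideanSpace.single i 1) = v.1 i := by
      rw [frameMap_apply]
      fin_cases i <;> simp
    simpa [h2] using h1

lemma continuous_frameSpan : Continuous (frameSpan (n := n)) := continuous_coinduced_rng

lemma linearIndependent_graphMap_single (A : SlopeSpace n) :
    LinearIndependent ℝ fun i : Fin 2 => graphMap A (EuclideanSpace.single i 1) := by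
  rw [Fintype.linearIndependent_iff]
  intro c hc i
  have h := congrArg negPart hc
  simp only [Fin.sum_univ_two, map_add, map_smul, negPart_graphMap, map_zero] at h
  have h2 := congrArg (fun w : EuclideanSpace ℝ (Fin 2) => w i) h
  fin_cases i <;> simpa using h2

lemma continuous_graphPlane : Continuous (graphPlane (n := n)) := by
  have h1 : Continuous fun A : SlopeSpace n =>
      (⟨_, linearIndependent_graphMap_single A⟩ :
        {v : Fin 2 → R2n n // LinearIndependent ℝ v}) := by
    refine Continuous.subtype_mk (continuous_pi fun i => ?_) _
    simp only [graphMap, add_apply, ContinuousLinearMap.comp_apply]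
    exact continuous_const.add (inPos.continuous.comp (by fun_prop))
  have h2 := continuous_frameSpan.comp h1
  refine h2.congr fun A => Gr2.eq_of_le ?_
  refine Submodule.span_le.2 ?_
  rintro _ ⟨i, rfl⟩
  exact graphMap_mem A _

/-- In a frame with negative block `M` and positive block `N`, being a graph means that `M` is
invertible, and the slope is then `N M⁻¹`. This is an open condition and a continuous formula. -/
lemma isOpenMap_graphPlane : IsOpenMap (graphPlane (n := n)) := by
  intro W hW
  refine isOpen_coinduced.2 ?_
  have hunit : ∀ (v : {v : Fin 2 → R2n n // LinearIndependent ℝ v}) (A : SlopeSpace n),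
      frameSpan v = graphPlane A → IsUnit (negPart.comp (frameMap v.1)) := by
    intro v A h
    rw [frameSpan_eq_graphPlane_iff] at h
    have hinj : Function.Injective (negPart.comp (frameMap v.1)) := by
      rw [injective_iff_map_eq_zero]
      intro u hu
      have h1 := DFunLike.congr_fun h u
      simp only [ContinuousLinearMap.comp_apply] at h1 hu
      rw [hu, map_zero] at h1
      apply frameMap_injective v
      rw [map_zero, ← inNeg_add_inPos (frameMap v.1 u), h1, hu, map_zero, map_zero, add_zero]
    let e := (LinearEquiv.ofInjectiveEndo
      (negPart.comp (frameMap v.1) : EuclideanSpace ℝ (Fin 2) →ₗ[ℝ] EuclideanSpace ℝ (Fin 2))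
      hinj).toContinuousLinearEquiv
    refine ⟨ContinuousLinearEquiv.toUnit e, ?_⟩
    ext1 u
    rfl
  have hset : frameSpan ⁻¹' (graphPlane '' W) = {v : {v : Fin 2 → R2n n // LinearIndependent ℝ v} |
      IsUnit (negPart.comp (frameMap v.1)) ∧
        (posPart.comp (frameMap v.1)).comp (Ring.inverse (negPart.comp (frameMap v.1))) ∈ W} := by
    ext v
    constructor
    · rintro ⟨A, hA, hAv⟩
      have hu := hunit v A hAv.symm
      refine ⟨hu, ?_⟩
      have h := (frameSpan_eq_graphPlane_iff v A).1 hAv.symm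
      rw [h, ContinuousLinearMap.comp_assoc]
      have h2 := Ring.mul_inverse_cancel _ hu
      rw [ContinuousLinearMap.mul_def] at h2
      rw [h2]
      exact hA
    · rintro ⟨hu, hW⟩
      refine ⟨_, hW, ?_⟩
      refine ((frameSpan_eq_graphPlane_iff v _).2 ?_).symm
      have h2 := Ring.inverse_mul_cancel _ hu
      rw [ContinuousLinearMap.mul_def] at h2
      rw [ContinuousLinearMap.comp_assoc, h2]
      rfl
  rw [hset, isOpen_iff_mem_nhds]
  rintro v ⟨hu, hv⟩
  have hM : Continuous fun v : {v : Fin 2 → R2n n // LinearIndependent ℝ v} =>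
      negPart.comp (frameMap v.1) :=
    continuous_const.clm_comp (continuous_frameMap.comp continuous_subtype_val)
  have hN : Continuous fun v : {v : Fin 2 → R2n n // LinearIndependent ℝ v} =>
      posPart.comp (frameMap v.1) :=
    continuous_const.clm_comp (continuous_frameMap.comp continuous_subtype_val)
  have h1 : ∀ᶠ w in 𝓝 v, IsUnit (negPart.comp (frameMap w.1)) :=
    (Units.isOpen.preimage hM).mem_nhds hu
  have h2 : ContinuousAt (fun w : {v : Fin 2 → R2n n // LinearIndependent ℝ v} =>
      (posPart.comp (frameMap w.1)).comp (Ring.inverse (negPart.comp (frameMap w.1)))) v := by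
    obtain ⟨x, hx⟩ := hu
    have h3 : ContinuousAt Ring.inverse (negPart.comp (frameMap v.1)) := by
      rw [← hx]
      exact NormedRing.inverse_continuousAt x
    have h4 : ContinuousAt (fun w : {v : Fin 2 → R2n n // LinearIndependent ℝ v} =>
      Ring.inverse (negPart.comp (frameMap w.1))) v :=
      ContinuousAt.comp (f := fun w : {v : Fin 2 → R2n n // LinearIndependent ℝ v} =>
        negPart.comp (frameMap w.1)) h3 hM.continuousAt
    exact hN.continuousAt.clm_comp h4
  filter_upwards [h1, h2.preimage_mem_nhds (hW.mem_nhds hv)] with w hw1 hw2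
  exact ⟨hw1, hw2⟩

lemma isOpenEmbedding_graphPlane : IsOpenEmbedding (graphPlane (n := n)) :=
  .of_continuous_injective_isOpenMap continuous_graphPlane graphPlane_injective
    isOpenMap_graphPlane

lemma quad_graphMap (A : SlopeSpace n) (u : EuclideanSpace ℝ (Fin 2)) :
    quad (graphMap A u) = ‖A u‖ ^ 2 - ‖u‖ ^ 2 := by
  rw [quad_eq_parts, negPart_graphMap, posPart_graphMap]

lemma quad_graphMap_nonpos {A : SlopeSpace n} (hA : ‖A‖ ≤ 1) (u : EuclideanSpace ℝ (Fin 2)) :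
    quad (graphMap A u) ≤ 0 := by
  rw [quad_graphMap]
  have h1 := A.le_opNorm u
  have h2 : ‖A‖ * ‖u‖ ≤ ‖u‖ := mul_le_of_le_one_left (norm_nonneg _) hA
  nlinarith [norm_nonneg (A u), norm_nonneg u]

lemma mem_causalGeodesics_iff {P : Gr2 n} :
    P ∈ causalGeodesics n ↔ ∀ v ∈ P.plane, quad v ≤ 0 := by
  have h0 : quad (0 : R2n n) = 0 := by simp [quad_eq_parts]
  constructor
  · rintro (h | h | h) v hv
    · rcases eq_or_ne v 0 with rfl | hv0
      · exact h0.le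
      · exact (h v hv hv0).le
    · exact h.1 v hv
    · exact (h v hv).le
  · intro h
    by_cases h1 : ∃ v ∈ P.plane, quad v < 0
    · by_cases h2 : ∃ v ∈ P.plane, v ≠ 0 ∧ quad v = 0
      · exact Or.inr (Or.inl ⟨h, h2, h1⟩)
      · push Not at h2
        exact Or.inl fun v hv hv0 => lt_of_le_of_ne (h v hv) (h2 v hv hv0)
    · push Not at h1
      exact Or.inr (Or.inr fun v hv => le_antisymm (h v hv) (h1 v hv))

/-- A nonzero vector with `quad ≤ 0` has nonzero negative part, so projecting `P` to the negative
coordinates is an isomorphism between planes. -/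
lemma exists_graphPlane {P : Gr2 n} (hP : P ∈ causalGeodesics n) :
    ∃ A : SlopeSpace n, ‖A‖ ≤ 1 ∧ graphPlane A = P := by
  rw [mem_causalGeodesics_iff] at hP
  let N : P.plane →ₗ[ℝ] EuclideanSpace ℝ (Fin 2) :=
    (negPart (n := n)).toLinearMap.comp P.plane.subtype
  have hN : Function.Injective N := by
    rw [injective_iff_map_eq_zero]
    intro v hv
    by_contra h0
    exact negPart_ne_zero_of_quad_nonpos (hP v.1 v.2) (fun h => h0 (Subtype.ext h)) hv
  let e := LinearMap.linearEquivOfInjective N hN (by rw [P.finrank_eq]; simp)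
  let A : SlopeSpace n := LinearMap.toContinuousLinearMap
    ((posPart (n := n)).toLinearMap.comp
      (P.plane.subtype.comp e.symm.toLinearMap))
  have hA : ∀ v : P.plane, A (negPart v.1) = posPart v.1 := by
    intro v
    have h1 : e v = negPart v.1 := rfl
    change posPart ((e.symm (negPart v.1) : P.plane) : R2n n) = _
    rw [← h1, LinearEquiv.symm_apply_apply]
  have hPA : P = graphPlane A := Gr2.eq_of_le fun v hv => mem_graphPlane.2 (hA ⟨v, hv⟩).symm
  refine ⟨A, ContinuousLinearMap.opNorm_le_bound _ zero_le_one fun u => ?_, hPA.symm⟩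
  have h1 := hP (graphMap A u) (by rw [hPA]; exact graphMap_mem A u)
  rw [quad_graphMap] at h1
  rw [one_mul]
  exact le_of_sq_le_sq (by linarith) (norm_nonneg _)

lemma graphPlane_mem_causalGeodesics {A : SlopeSpace n} (hA : ‖A‖ ≤ 1) :
    graphPlane A ∈ causalGeodesics n := by
  rw [mem_causalGeodesics_iff]
  intro v hv
  rw [← graphMap_negPart hv]
  exact quad_graphMap_nonpos hA _

lemma norm_le_one_of_mem {A : SlopeSpace n} (hA : graphPlane A ∈ causalGeodesics n) : ‖A‖ ≤ 1 := by
  obtain ⟨B, hB, h⟩ := exists_graphPlane hA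
  rwa [← graphPlane_injective h]

/-- Compactness of the unit circle turns the strict pointwise inequality into a strict bound on the
operator norm. -/
lemma isTimelike_graphPlane_iff {A : SlopeSpace n} : IsTimelike (graphPlane A) ↔ ‖A‖ < 1 := by
  constructor
  · intro h
    obtain ⟨u, hu, hmax⟩ := (isCompact_sphere (0 : EuclideanSpace ℝ (Fin 2)) 1).exists_isMaxOn
      (NormedSpace.sphere_nonempty.2 zero_le_one) (f := fun u => ‖A u‖) (by fun_prop)
    have hu1 : ‖u‖ = 1 := by simpa using hu
    have h1 := h (graphMap A u) (graphMap_mem A u) (by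
      intro h0
      have h2 := congrArg negPart h0
      rw [negPart_graphMap, map_zero] at h2
      rw [h2, norm_zero] at hu1
      exact zero_ne_one hu1)
    rw [quad_graphMap, hu1] at h1
    have h2 : ‖A u‖ < 1 := by nlinarith [norm_nonneg (A u)]
    refine lt_of_le_of_lt (ContinuousLinearMap.opNorm_le_of_unit_norm (norm_nonneg (A u)) ?_) h2
    intro w hw
    exact hmax (by simpa using hw)
  · intro h v hv hv0
    rw [← graphMap_negPart hv, quad_graphMap]
    have h0 := negPart_ne_zero_of_quad_nonpos
      ((mem_causalGeodesics_iff.1 (graphPlane_mem_causalGeodesics h.le)) v hv) hv0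
    have h1 := A.le_opNorm (negPart v)
    have h2 : 0 < ‖negPart v‖ := norm_pos_iff.2 h0
    have h3 : ‖A‖ * ‖negPart v‖ < ‖negPart v‖ := by nlinarith
    nlinarith [norm_nonneg (A (negPart v))]

end Graph

/-! ### Area distortion on causal planes -/

section Area

variable {n : ℕ}

/-- The determinant of two plane vectors. -/
def planeDet (a b : EuclideanSpace ℝ (Fin 2)) : ℝ := a 0 * b 1 - a 1 * b 0

lemma continuousLinearMap_apply_eq (X : EuclideanSpace ℝ (Fin 2) →L[ℝ] EuclideanSpace ℝ (Fin 2))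
    (a : EuclideanSpace ℝ (Fin 2)) :
    X a = a 0 • X (EuclideanSpace.single 0 1) + a 1 • X (EuclideanSpace.single 1 1) := by
  rw [← map_smul, ← map_smul, ← map_add]
  congr 1
  ext i
  fin_cases i <;> simp

/-- The determinant of a linear map of the plane. -/
def mapDet (X : EuclideanSpace ℝ (Fin 2) →L[ℝ] EuclideanSpace ℝ (Fin 2)) : ℝ :=
  planeDet (X (EuclideanSpace.single 0 1)) (X (EuclideanSpace.single 1 1))

lemma planeDet_map (X : EuclideanSpace ℝ (Fin 2) →L[ℝ] EuclideanSpace ℝ (Fin 2))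
    (a b : EuclideanSpace ℝ (Fin 2)) : planeDet (X a) (X b) = mapDet X * planeDet a b := by
  rw [continuousLinearMap_apply_eq X a, continuousLinearMap_apply_eq X b]
  simp only [mapDet, planeDet, PiLp.add_apply, PiLp.smul_apply, smul_eq_mul]
  ring

lemma mapDet_comp (X Y : EuclideanSpace ℝ (Fin 2) →L[ℝ] EuclideanSpace ℝ (Fin 2)) :
    mapDet (X.comp Y) = mapDet X * mapDet Y := planeDet_map X _ _

lemma continuous_mapDet : Continuous mapDet := by
  have h : ∀ (i : Fin 2) (a : EuclideanSpace ℝ (Fin 2)),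
      Continuous fun X : EuclideanSpace ℝ (Fin 2) →L[ℝ] EuclideanSpace ℝ (Fin 2) => X a i := by
    intro i a
    have h1 : Continuous fun X : EuclideanSpace ℝ (Fin 2) →L[ℝ] EuclideanSpace ℝ (Fin 2) => X a :=
      by fun_prop
    exact (PiLp.continuous_apply 2 (fun _ : Fin 2 => ℝ) i).comp h1
  unfold mapDet planeDet
  exact ((h 0 _).mul (h 1 _)).sub ((h 1 _).mul (h 0 _))

/-- The determinant dominates the product of the stretch in a given direction and the stretch in a
suitable second direction. -/
lemma exists_mul_le_abs_mapDet (X : EuclideanSpace ℝ (Fin 2) →L[ℝ] EuclideanSpace ℝ (Fin 2))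
    {u : EuclideanSpace ℝ (Fin 2)} (hu : ‖u‖ = 1) :
    ∃ u' : EuclideanSpace ℝ (Fin 2), ‖u'‖ = 1 ∧ ‖X u‖ * ‖X u'‖ ≤ |mapDet X| := by
  by_cases hXu : X u = 0
  · exact ⟨u, hu, by rw [hXu]; simp⟩
  set v : EuclideanSpace ℝ (Fin 2) := !₂[-u 1, u 0] with hv
  have hsq : ∀ a : EuclideanSpace ℝ (Fin 2), ‖a‖ ^ 2 = a 0 ^ 2 + a 1 ^ 2 := by
    intro a
    rw [EuclideanSpace.real_norm_sq_eq, Fin.sum_univ_two]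
  have hin : ∀ a b : EuclideanSpace ℝ (Fin 2), inner ℝ a b = a 0 * b 0 + a 1 * b 1 := by
    intro a b
    rw [PiLp.inner_apply, Fin.sum_univ_two]
    simp [mul_comm]
  have hu2 : u 0 ^ 2 + u 1 ^ 2 = 1 := by rw [← hsq, hu]; norm_num
  have hdet : planeDet u v = 1 := by
    simp only [planeDet, hv]
    simp
    nlinarith
  have hpos : 0 < ‖X u‖ := norm_pos_iff.2 hXu
  -- Gram-Schmidt in the image: `X w` is orthogonal to `X u`, so `‖X u‖ ‖X w‖ = |det X|`. As `v` is
  -- a unit vector orthogonal to `u`, `‖w‖ ≥ 1`, and normalising `w` only lowers the product.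
  set t := inner ℝ (X u) (X v) / ‖X u‖ ^ 2 with ht
  set w := v - t • u with hw
  have hXw : (‖X u‖ * ‖X w‖) ^ 2 = mapDet X ^ 2 := by
    have h1 : planeDet (X u) (X v) = mapDet X := by rw [planeDet_map, hdet, mul_one]
    have h2 : ‖X w‖ ^ 2 = ‖X v‖ ^ 2 - 2 * (t * inner ℝ (X u) (X v)) + t ^ 2 * ‖X u‖ ^ 2 := by
      rw [hw, map_sub, map_smul, norm_sub_sq_real, real_inner_smul_right, norm_smul, mul_pow,
        Real.norm_eq_abs, sq_abs, real_inner_comm]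
    have h3 : t * ‖X u‖ ^ 2 = inner ℝ (X u) (X v) := div_mul_cancel₀ _ (by positivity)
    have h4 : (‖X u‖ * ‖X w‖) ^ 2 = ‖X u‖ ^ 2 * ‖X v‖ ^ 2 - inner ℝ (X u) (X v) ^ 2 := by
      rw [mul_pow, h2, ← h3]; ring
    rw [h4, ← h1, hsq, hsq, hin, planeDet]
    ring
  have hw1 : 1 ≤ ‖w‖ := by
    have h1 : ‖w‖ ^ 2 = 1 + t ^ 2 := by
      rw [hsq, hw, hv]
      simp
      nlinarith
    nlinarith [norm_nonneg w, sq_nonneg t]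
  have hw0 : 0 < ‖w‖ := by linarith
  refine ⟨‖w‖⁻¹ • w, ?_, ?_⟩
  · rw [norm_smul, norm_inv, norm_norm, inv_mul_cancel₀ hw0.ne']
  · rw [map_smul, norm_smul, norm_inv, norm_norm]
    have h1 : ‖X u‖ * ‖X w‖ = |mapDet X| := by
      rw [← abs_of_nonneg (mul_nonneg (norm_nonneg (X u)) (norm_nonneg (X w)))]
      exact (sq_eq_sq_iff_abs_eq_abs _ _).1 hXw
    rw [← h1]
    refine mul_le_mul_of_nonneg_left ?_ (norm_nonneg _)
    exact mul_le_of_le_one_left (norm_nonneg _) (inv_le_one_of_one_le₀ hw1)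

/-- The action of `g` on the graph of `A`, read in the negative coordinates. -/
def graphAction (g : O0 n) (A : SlopeSpace n) :
    EuclideanSpace ℝ (Fin 2) →L[ℝ] EuclideanSpace ℝ (Fin 2) :=
  negPart.comp (g.toGL.1.comp (graphMap A))

lemma graphAction_apply (g : O0 n) (A : SlopeSpace n) (u : EuclideanSpace ℝ (Fin 2)) :
    graphAction g A u = negPart (g • graphMap A u) := rfl

/-- The area distortion of `g` on the graph of `A`, in the negative coordinates. -/
def jac (g : O0 n) (A : SlopeSpace n) : ℝ := mapDet (graphAction g A)

lemma continuous_graphMap : Continuous (graphMap (n := n)) :=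
  continuous_const.add (continuous_const.clm_comp continuous_id)

lemma continuous_jac (g : O0 n) : Continuous (jac g) :=
  continuous_mapDet.comp (continuous_const.clm_comp (continuous_const.clm_comp continuous_graphMap))

lemma smul_graphMap {g : O0 n} {A A' : SlopeSpace n} (h : g • graphPlane A = graphPlane A')
    (u : EuclideanSpace ℝ (Fin 2)) : g • graphMap A u = graphMap A' (graphAction g A u) := by
  rw [graphAction_apply, graphMap_negPart]
  rw [← h, mem_smul_plane, inv_smul_smul]
  exact graphMap_mem A u

/-- Cocycle rule, by multiplicativity of the determinant. It makes minimality along an orbit a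
condition on the translated plane alone. -/
lemma jac_mul {g : O0 n} {A A' : SlopeSpace n} (h : g • graphPlane A = graphPlane A') (k : O0 n) :
    jac (k * g) A = jac k A' * jac g A := by
  rw [jac, jac, jac, ← mapDet_comp]
  congr 1
  ext1 u
  rw [ContinuousLinearMap.comp_apply, graphAction_apply, graphAction_apply, ← smul_graphMap h,
    mul_smul]

lemma jac_one (A : SlopeSpace n) : jac 1 A = 1 := by
  have : graphAction 1 A = ContinuousLinearMap.id ℝ _ := by
    ext1 u
    rw [graphAction_apply, one_smul, negPart_graphMap]; rfl
  rw [jac, this]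
  simp [mapDet, planeDet]

lemma exists_smul_graphPlane (g : O0 n) {A : SlopeSpace n} (hA : ‖A‖ ≤ 1) :
    ∃ A' : SlopeSpace n, ‖A'‖ ≤ 1 ∧ g • graphPlane A = graphPlane A' := by
  obtain ⟨A', h, h'⟩ := exists_graphPlane
    ((causalGeodesics n).smul_mem g (graphPlane_mem_causalGeodesics hA))
  exact ⟨A', h, h'.symm⟩

/-- Let `y` be the point of the plane with the same negative part as `F`. If `F` were orthogonal to
the plane, `quad (y - F) = quad y ≤ 0`, but `y - F` is purely positive, so `y = F` would lie in the
plane. -/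
lemma exists_bil_graphMap_ne_zero {A : SlopeSpace n} (hA : ‖A‖ ≤ 1) {F : R2n n} (hF : quad F = 0)
    (hFA : F ∉ (graphPlane A).plane) :
    ∃ u : EuclideanSpace ℝ (Fin 2), ‖u‖ = 1 ∧ bil F (graphMap A u) ≠ 0 := by
  by_contra hcon
  push Not at hcon
  have hall : ∀ u, bil F (graphMap A u) = 0 := by
    intro u
    rcases eq_or_ne u 0 with rfl | hu
    · rw [map_zero, bil_eq_inner, inner_zero_right]
    · have h0 : 0 < ‖u‖ := norm_pos_iff.2 hu
      have h1 := hcon (‖u‖⁻¹ • u) (by rw [norm_smul, norm_inv, norm_norm, inv_mul_cancel₀ h0.ne'])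
      rw [map_smul, bil_smul_right] at h1
      exact (mul_eq_zero.1 h1).resolve_left (inv_ne_zero h0.ne')
  apply hFA
  set y := graphMap A (negPart F) with hy
  have h1 : quad (y - F) = quad y := by
    rw [quad, bil_sub_left, bil_sub_right, bil_sub_right, hall, bil_comm y F, hall]
    change quad y - 0 - (0 - quad F) = quad y
    rw [hF]; ring
  have h2 : negPart (y - F) = 0 := by rw [map_sub, hy, negPart_graphMap, sub_self]
  have h3 := quad_graphMap_nonpos hA (negPart F)
  rw [← hy, ← h1, quad_eq_parts, h2, norm_zero] at h3
  have h4 : posPart (y - F) = 0 := by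
    rw [← norm_eq_zero]
    have h5 := norm_nonneg (posPart (y - F))
    nlinarith
  rw [mem_graphPlane]
  rw [map_sub, hy, posPart_graphMap, sub_eq_zero] at h4
  exact h4.symm

/-- Strict Cauchy-Schwarz inequality for a vector outside a plane. -/
lemma lower_pos_of_notMem {P : Gr2 n} {F y : R2n n} (hF : ‖F‖ ^ 2 = 2) (hFP : F ∉ P.plane)
    (hy : y ∈ P.plane) (hy0 : y ≠ 0) : 0 < ‖y‖ ^ 2 - (inner ℝ F y) ^ 2 / 2 := by
  by_contra hcon
  push Not at hcon
  apply hFP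
  have hpos : 0 < ‖y‖ ^ 2 := by have := norm_pos_iff.2 hy0; positivity
  set t := inner ℝ F y / ‖y‖ ^ 2 with ht
  have h1 : t * ‖y‖ ^ 2 = inner ℝ F y := div_mul_cancel₀ _ hpos.ne'
  have h2 : ‖F - t • y‖ ^ 2 = 2 - t ^ 2 * ‖y‖ ^ 2 := by
    rw [norm_sub_sq_real, real_inner_smul_right, norm_smul, mul_pow, Real.norm_eq_abs, sq_abs,
      hF, ← h1]
    ring
  have h3 : 2 ≤ t ^ 2 * ‖y‖ ^ 2 := by
    rw [← h1] at hcon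
    have h4 : ‖y‖ ^ 2 * 2 ≤ ‖y‖ ^ 2 * (t ^ 2 * ‖y‖ ^ 2) := by nlinarith
    exact le_of_mul_le_mul_left h4 hpos
  have h5 : F - t • y = 0 := by
    rw [← norm_eq_zero]
    have h6 := norm_nonneg (F - t • y)
    nlinarith
  rw [sub_eq_zero.1 h5]
  exact Submodule.smul_mem _ _ hy

/-- Allows stretching on causal planes to be read off from the negative parts. -/
lemma norm_sq_le_of_quad_nonpos {x : R2n n} (hx : quad x ≤ 0) : ‖x‖ ^ 2 ≤ 2 * ‖negPart x‖ ^ 2 := by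
  rw [quad_eq_parts] at hx
  rw [norm_sq_eq_parts]
  linarith

lemma tendsto_graphMap {ι : Type*} {l : Filter ι} {A' : ι → SlopeSpace n} {A : SlopeSpace n}
    {u' : ι → EuclideanSpace ℝ (Fin 2)} {u : EuclideanSpace ℝ (Fin 2)}
    (hA : Tendsto A' l (𝓝 A)) (hu : Tendsto u' l (𝓝 u)) :
    Tendsto (fun i => graphMap (A' i) (u' i)) l (𝓝 (graphMap A u)) := by
  have h1 := continuous_graphMap.tendsto A
  have h2 := h1.comp hA
  have h3 := (isBoundedBilinearMap_apply.continuous.tendsto (graphMap A, u)).comp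
    (h2.prodMk_nhds hu)
  exact h3

/-- The area distortion tends to infinity on planes that avoid the repelling direction. -/
lemma tendsto_abs_jac {ι : Type*} (l : Ultrafilter ι) {g : ι → O0 n} {E F : R2n n}
    (h : ProximalLimit (l : Filter ι) g E F) {A' : ι → SlopeSpace n} {A : SlopeSpace n}
    (hA' : ∀ i, ‖A' i‖ ≤ 1) (hlim : Tendsto A' l (𝓝 A)) (hF : F ∉ (graphPlane A).plane) :
    Tendsto (fun i => |jac (g i) (A' i)|) l atTop := by
  have hA : ‖A‖ ≤ 1 := le_of_tendsto hlim.norm (Eventually.of_forall hA')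
  obtain ⟨-, hF2, -, hFq⟩ := h.facts
  have hE0 := h.E_ne_zero
  obtain ⟨u, hu, hbu⟩ := exists_bil_graphMap_ne_zero hA hFq hF
  -- The direction `u` is stretched at rate `s i`. The complementary unit direction `u' i` varies
  -- with `i`, so its limit `v` is extracted by compactness of the circle.
  choose u' hu' hdet using fun i => exists_mul_le_abs_mapDet (graphAction (g i) (A' i)) hu
  obtain ⟨v, hv, hvlim⟩ := (isCompact_sphere (0 : EuclideanSpace ℝ (Fin 2)) 1).ultrafilter_le_nhds
    (l.map u') (by
      rw [le_principal_iff, Ultrafilter.coe_map, mem_map]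
      exact univ_mem' fun i => by simpa using hu' i)
  have hvlim' : Tendsto u' l (𝓝 v) := hvlim
  obtain ⟨s, r, E', F', hnear, hsr, hEl, hFl⟩ := h
  have hpos := ProximalLimit.eventually_pos hnear hsr
  have hr : ∀ᶠ i in (l : Filter ι), 1 ≤ r i := hnear.mono fun i hi => hi.one_le
  have h1 := tendsto_scaled_of_near (T := fun i x => g i • x) hr hpos hsr hEl hFl
    (hnear.mono fun i hi => hi.fwd) (tendsto_graphMap hlim (tendsto_const_nhds (x := u)))
  have hκ : 0 < ‖bil F (graphMap A u) • E‖ := norm_pos_iff.2 (smul_ne_zero hbu hE0)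
  set κ := ‖bil F (graphMap A u) • E‖ / 2 with hκd
  have hκ0 : 0 < κ := by positivity
  have h2 := (tendsto_order.1 h1.norm).1 κ (by linarith)
  have h3 := tendsto_graphMap hlim hvlim'
  -- As `F` is not in the limit plane, `graphMap A v` is not parallel to the most contracted
  -- direction. The bound `lower` then limits the contraction of the second direction to a factor of
  -- order `r i`.
  have h4 : 0 < ‖graphMap A v‖ ^ 2 - (inner ℝ F (graphMap A v)) ^ 2 / 2 := by
    refine lower_pos_of_notMem hF2 hF (graphMap_mem A v) fun h0 => ?_
    have h5 := congrArg negPart h0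
    rw [negPart_graphMap, map_zero] at h5
    rw [h5] at hv
    simp at hv
  set τ := (‖graphMap A v‖ ^ 2 - (inner ℝ F (graphMap A v)) ^ 2 / 2) / 2 with hτ
  have hτ0 : 0 < τ := by positivity
  have h5 : Tendsto (fun i => ‖graphMap (A' i) (u' i)‖ ^ 2 -
      (inner ℝ (F' i) (graphMap (A' i) (u' i))) ^ 2 / 2) l
      (𝓝 (‖graphMap A v‖ ^ 2 - (inner ℝ F (graphMap A v)) ^ 2 / 2)) :=
    (h3.norm.pow 2).sub (((hFl.inner h3).pow 2).div_const 2)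
  have h6 := (tendsto_order.1 h5).1 τ (by linarith)
  have hC : 0 < κ * Real.sqrt τ / 2 := by positivity
  have h7 : Tendsto (fun i => κ * Real.sqrt τ / 2 * (s i / r i)) l atTop :=
    Tendsto.const_mul_atTop hC hsr
  refine tendsto_atTop_mono' (l : Filter ι) ?_ h7
  filter_upwards [hnear, hpos, h2, h6] with i hi hsi hκi hτi
  have hri : 0 < r i := one_pos.trans_le hi.one_le
  have hquad : ∀ w, quad (g i • graphMap (A' i) w) ≤ 0 := by
    intro w
    rw [quad_smul]
    exact quad_graphMap_nonpos (hA' i) w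
  have e1 : (κ * s i) ^ 2 ≤ 2 * ‖graphAction (g i) (A' i) u‖ ^ 2 := by
    rw [norm_smul, norm_inv, Real.norm_of_nonneg hsi.le, inv_mul_eq_div, lt_div_iff₀ hsi] at hκi
    exact (pow_le_pow_left₀ (by positivity) hκi.le 2).trans (norm_sq_le_of_quad_nonpos (hquad u))
  have e2 : τ ≤ r i ^ 2 * (2 * ‖graphAction (g i) (A' i) (u' i)‖ ^ 2) := by
    refine hτi.le.trans ((hi.lower _).trans ?_)
    exact mul_le_mul_of_nonneg_left (norm_sq_le_of_quad_nonpos (hquad (u' i))) (by positivity)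
  refine le_trans ?_ (hdet i)
  set a := ‖graphAction (g i) (A' i) u‖
  set b := ‖graphAction (g i) (A' i) (u' i)‖
  have ha : 0 ≤ a := norm_nonneg _
  have hb : 0 ≤ b := norm_nonneg _
  refine le_of_sq_le_sq ?_ (mul_nonneg ha hb)
  have e3 : (κ * s i) ^ 2 * τ ≤ (2 * a ^ 2) * (r i ^ 2 * (2 * b ^ 2)) :=
    mul_le_mul e1 e2 hτ0.le (by positivity)
  have e4 : (κ * Real.sqrt τ / 2 * (s i / r i)) ^ 2 = ((κ * s i) ^ 2 * τ) / (4 * r i ^ 2) := by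
    have := Real.sq_sqrt hτ0.le
    rw [mul_pow, div_pow, mul_pow, this, div_pow]
    ring
  rw [e4, div_le_iff₀ (by positivity)]
  linarith

end Area

/-! ### Topology of `U` and proper discontinuity -/

section Avoiding

variable {n : ℕ} {Γ : Type*} [Group Γ] {S : Finset Γ} {ρ : Γ →* O0 n} {ξ : GromovBoundary S → Ein n}

lemma mem_avoidingGeodesics_iff (hρ : IsP1Anosov S ρ ξ) {P : Gr2 n} :
    P ∈ avoidingGeodesics hρ ↔
      P ∈ causalGeodesics n ∧ ∀ y ∈ limitCone ξ, y ≠ 0 → y ∉ P.plane := by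
  refine and_congr_right fun _ => ?_
  rw [Set.eq_empty_iff_forall_notMem]
  constructor
  · rintro h y ⟨η, hy⟩ hy0 hyP
    refine h (ξ η).1 ⟨⟨fun v hv => ((ξ η).2 v hv).le, fun v hv => ?_⟩, η, rfl⟩
    obtain ⟨c, rfl⟩ := exists_smul_of_mem_submodule hy hy0 hv
    exact Submodule.smul_mem _ _ hyP
  · rintro h p ⟨⟨-, hp⟩, η, rfl⟩
    obtain ⟨y, hy, hy0⟩ := exists_ne_zero_mem_submodule (ξ η).1
    exact h y ⟨η, hy⟩ hy0 (hp hy)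

/-- The slopes of the causal geodesics that avoid the limit set. -/
def avoidingSlopes (hρ : IsP1Anosov S ρ ξ) : Set (SlopeSpace n) :=
  {A | graphPlane A ∈ avoidingGeodesics hρ}

/-- The slopes whose graph meets the compact set of unit vectors over the limit set form a closed
set, by projection along a compact factor. Local compactness of `U`, needed for a Hausdorff
quotient, follows. -/
lemma isLocallyClosed_avoidingSlopes (hΓ : IsHyperbolicGroup S) (hρ : IsP1Anosov S ρ ξ) :
    IsLocallyClosed (avoidingSlopes hρ) := by
  have hK : IsCompact (limitCone ξ ∩ Metric.sphere (0 : R2n n) 1) :=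
    (isCompact_sphere _ _).inter_left (isClosed_limitCone hΓ hρ.continuous)
  have : CompactSpace ↥(limitCone ξ ∩ Metric.sphere (0 : R2n n) 1) := isCompact_iff_compactSpace.1 hK
  have h1 : IsClosed {p : ↥(limitCone ξ ∩ Metric.sphere (0 : R2n n) 1) × SlopeSpace n |
      posPart p.1.1 = p.2 (negPart p.1.1)} := by
    refine isClosed_eq (by fun_prop) ?_
    exact continuous_snd.clm_apply (by fun_prop)
  have h2 := isClosedMap_snd_of_compactSpace _ h1
  have h3 : avoidingSlopes hρ = Metric.closedBall 0 1 ∩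
      (Prod.snd '' {p : ↥(limitCone ξ ∩ Metric.sphere (0 : R2n n) 1) × SlopeSpace n |
        posPart p.1.1 = p.2 (negPart p.1.1)})ᶜ := by
    ext A
    rw [avoidingSlopes, Set.mem_ofPred_eq, mem_avoidingGeodesics_iff, Set.mem_inter_iff,
      mem_closedBall_zero_iff]
    constructor
    · rintro ⟨hA, h⟩
      refine ⟨norm_le_one_of_mem hA, ?_⟩
      rintro ⟨⟨⟨y, hy, hy1⟩, B⟩, hyB, rfl⟩
      refine h y hy ?_ (mem_graphPlane.2 hyB)
      rintro rfl
      simp at hy1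
    · rintro ⟨hA, h⟩
      refine ⟨graphPlane_mem_causalGeodesics hA, fun y hy hy0 hyA => h ?_⟩
      have hpos : 0 < ‖y‖ := norm_pos_iff.2 hy0
      refine ⟨⟨⟨‖y‖⁻¹ • y, smul_mem_limitCone hy _, ?_⟩, A⟩, ?_, rfl⟩
      · rw [mem_sphere_zero_iff_norm, norm_smul, norm_inv, norm_norm, inv_mul_cancel₀ hpos.ne']
      · exact mem_graphPlane.1 (Submodule.smul_mem _ _ hyA)
  rw [h3]
  exact Metric.isClosed_closedBall.isLocallyClosed.inter h2.isOpen_compl.isLocallyClosed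

/-- The causal geodesics that avoid the limit set are parametrised by their slopes. -/
def slopeHomeo (hρ : IsP1Anosov S ρ ξ) : avoidingSlopes hρ ≃ₜ avoidingGeodesics hρ := by
  refine IsHomeomorph.homeomorph (fun A : avoidingSlopes hρ =>
    (⟨graphPlane A.1, A.2⟩ : avoidingGeodesics hρ)) ?_
  rw [isHomeomorph_iff_isEmbedding_surjective]
  constructor
  · exact (isOpenEmbedding_graphPlane.isEmbedding.comp IsEmbedding.subtypeVal).codRestrict _ _
  · rintro ⟨P, hP⟩
    obtain ⟨A, hA, rfl⟩ := exists_graphPlane ((mem_avoidingGeodesics_iff hρ).1 hP).1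
    exact ⟨⟨A, hP⟩, rfl⟩

lemma slopeHomeo_coe (hρ : IsP1Anosov S ρ ξ) (A : avoidingSlopes hρ) :
    (slopeHomeo hρ A : Gr2 n) = graphPlane A.1 := rfl

lemma graphPlane_slopeHomeo_symm (hρ : IsP1Anosov S ρ ξ) (P : avoidingGeodesics hρ) :
    graphPlane ((slopeHomeo hρ).symm P).1 = (P : Gr2 n) := by
  rw [← slopeHomeo_coe, Homeomorph.apply_symm_apply]

lemma t2Space_avoidingGeodesics (hρ : IsP1Anosov S ρ ξ) : T2Space (avoidingGeodesics hρ) :=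
  (slopeHomeo hρ).symm.isEmbedding.t2Space

lemma locallyCompactSpace_avoidingGeodesics (hΓ : IsHyperbolicGroup S) (hρ : IsP1Anosov S ρ ξ) :
    LocallyCompactSpace (avoidingGeodesics hρ) := by
  have := (isLocallyClosed_avoidingSlopes hΓ hρ).locallyCompactSpace
  exact (slopeHomeo hρ).symm.isClosedEmbedding.locallyCompactSpace

lemma continuous_smul_Gr2 (g : O0 n) : Continuous fun P : Gr2 n => g • P := by
  refine continuous_coinduced_dom.2 ?_
  have hli : ∀ v : {v : Fin 2 → R2n n // LinearIndependent ℝ v},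
      LinearIndependent ℝ fun i => g • v.1 i := by
    intro v
    exact v.2.map' (DistribMulAction.toLinearEquiv ℝ (R2n n) g).toLinearMap
      (LinearEquiv.ker _)
  have h1 : Continuous fun v : {v : Fin 2 → R2n n // LinearIndependent ℝ v} =>
      (⟨fun i => g • v.1 i, hli v⟩ : {v : Fin 2 → R2n n // LinearIndependent ℝ v}) := by
    refine Continuous.subtype_mk (continuous_pi fun i => ?_) _
    exact (continuous_smul_vec g).comp ((continuous_apply i).comp continuous_subtype_val)
  refine (continuous_frameSpan.comp h1).congr fun v => ?_
  refine Gr2.eq_of_le ?_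
  refine Submodule.span_le.2 ?_
  rintro _ ⟨i, rfl⟩
  rw [SetLike.mem_coe, Function.comp_apply, mem_smul_plane]
  simp only [inv_smul_smul]
  exact Submodule.subset_span ⟨i, rfl⟩

instance (hρ : IsP1Anosov S ρ ξ) : ContinuousConstSMul ρ.range (avoidingGeodesics hρ) :=
  ⟨fun g => ((continuous_smul_Gr2 g.1).comp continuous_subtype_val).subtype_mk _⟩

lemma mem_graphPlane_of_tendsto {ι : Type*} {l : Filter ι} [l.NeBot] {A' : ι → SlopeSpace n}
    {A : SlopeSpace n} {v : ι → R2n n} {w : R2n n} (hA : Tendsto A' l (𝓝 A))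
    (hv : Tendsto v l (𝓝 w)) (h : ∀ i, v i ∈ (graphPlane (A' i)).plane) :
    w ∈ (graphPlane A).plane := by
  rw [mem_graphPlane]
  have h1 := (posPart.continuous.tendsto w).comp hv
  have h2 := (negPart.continuous.tendsto w).comp hv
  have h3 := (isBoundedBilinearMap_apply.continuous.tendsto (A, negPart w)).comp
    (hA.prodMk_nhds h2)
  refine tendsto_nhds_unique h1 (h3.congr fun i => ?_)
  exact (mem_graphPlane.1 (h i)).symm

lemma infinite_of_range (hinf : Infinite ρ.range) : Infinite Γ :=
  Infinite.of_surjective _ ρ.rangeRestrict_surjective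

/-- Infinitely many returns from `K` to `L` give limits `P₀` and `Q₀` in `U`. Since `P₀` avoids `F`,
it contains a vector not orthogonal to `F`, whose rescaled images converge to a multiple of `E`. So
`Q₀` contains `E`, which lies over the limit set. -/
theorem properlyDiscontinuous_avoidingGeodesics (hn : 2 ≤ n) (hΓ : IsHyperbolicGroup S)
    (hρ : IsP1Anosov S ρ ξ) : ProperlyDiscontinuousSMul ρ.range (avoidingGeodesics hρ) := by
  constructor
  intro K L hK hL
  by_contra hinf
  have hι := Set.infinite_coe_iff.2 hinf
  have hrange : Infinite ρ.range := Infinite.of_injective _ (Subtype.val_injective (p := (· ∈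
    {γ : ρ.range | ((fun x => γ • x) '' K ∩ L).Nonempty})))
  have hΓi := infinite_of_range hrange
  obtain ⟨z, η₁, η₂, hz⟩ := hρ.exists_isLoxodromic hΓ
  set ι := ↥{γ : ρ.range | ((fun x => γ • x) '' K ∩ L).Nonempty} with hιd
  have hex : ∀ i : ι, ∃ P ∈ K, i.1 • P ∈ L := by
    rintro ⟨γ, hγ⟩
    obtain ⟨-, ⟨P, hP, rfl⟩, hPL⟩ := hγ
    exact ⟨P, hP, hPL⟩
  choose P hPK hPL using hex
  let l : Ultrafilter ι := hyperfilter ι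
  let g : ι → O0 n := fun i => i.1.1
  have hg : ∀ i, g i ∈ ρ.range := fun i => i.1.2
  have hgl : Tendsto g l cofinite :=
    ((Subtype.val_injective.comp Subtype.val_injective).tendsto_cofinite).mono_left
      (hyperfilter_le_cofinite)
  obtain ⟨E, F, h⟩ := exists_proximalLimit hn hΓ hρ l g hg hgl
  obtain ⟨hE, hF⟩ := hρ.limit_mem hn hΓ hz l hg hgl h
  obtain ⟨P₀, -, hP₀⟩ := hK.ultrafilter_le_nhds (l.map P) (by
    rw [le_principal_iff, Ultrafilter.coe_map, mem_map]
    exact univ_mem' hPK)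
  obtain ⟨Q₀, -, hQ₀⟩ := hL.ultrafilter_le_nhds (l.map fun i => i.1 • P i) (by
    rw [le_principal_iff, Ultrafilter.coe_map, mem_map]
    exact univ_mem' hPL)
  have hP₀' : Tendsto P l (𝓝 P₀) := hP₀
  have hQ₀' : Tendsto (fun i => i.1 • P i) l (𝓝 Q₀) := hQ₀
  let slope : avoidingGeodesics hρ → SlopeSpace n := fun Q => ((slopeHomeo hρ).symm Q).1
  have hslope : Continuous slope := continuous_subtype_val.comp (slopeHomeo hρ).symm.continuous
  have hsP : ∀ Q, graphPlane (slope Q) = (Q : Gr2 n) := graphPlane_slopeHomeo_symm hρ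
  have hA := (hslope.tendsto P₀).comp hP₀'
  have hB := (hslope.tendsto Q₀).comp hQ₀'
  have hnorm : ∀ Q, ‖slope Q‖ ≤ 1 := fun Q => norm_le_one_of_mem (by
    rw [hsP]; exact ((mem_avoidingGeodesics_iff hρ).1 Q.2).1)
  have hFP : F ∉ (graphPlane (slope P₀)).plane := by
    rw [hsP]
    exact ((mem_avoidingGeodesics_iff hρ).1 P₀.2).2 F hF h.F_ne_zero
  obtain ⟨u, -, hbu⟩ := exists_bil_graphMap_ne_zero (hnorm P₀) h.facts.2.2.2 hFP
  obtain ⟨c, hc⟩ := h.exists_scale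
  have h1 := (hc _ _ (tendsto_graphMap hA (tendsto_const_nhds (x := u)))).1
  have h2 := mem_graphPlane_of_tendsto hB h1 (fun i => by
    refine Submodule.smul_mem _ _ ?_
    have e1 : graphPlane ((slope ∘ fun i : ι => i.1 • P i) i) = g i • graphPlane (slope (P i)) := by
      rw [Function.comp_apply, hsP, hsP]; rfl
    rw [e1, mem_smul_plane, inv_smul_smul]
    exact graphMap_mem _ _)
  have h3 := Submodule.smul_mem _ (bil F (graphMap (slope P₀) u))⁻¹ h2
  rw [smul_smul, inv_mul_cancel₀ hbu, one_smul, hsP] at h3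
  exact ((mem_avoidingGeodesics_iff hρ).1 Q₀.2).2 E hE h.E_ne_zero h3

/-! ### Expansion at points of the limit set -/

/-- The repelling direction of the powers of an element whose inverse has an attracting fixed
point. -/
lemma IsAttractingFixedPoint.mem_of_proximalLimit_inv {g : O0 n} {x : Ein n}
    (hx : IsAttractingFixedPoint g⁻¹ x) {l : Filter ℕ} [l.NeBot] (hl : l ≤ atTop) {E F : R2n n}
    (h : ProximalLimit l (fun k => g ^ k) E F) : F ∈ x.1.submodule := by
  obtain ⟨-, V, hV, hlim⟩ := hx
  obtain ⟨y, hy, Y, hY, hEY⟩ := exists_mem_nhds_bil_ne_zero hV h.facts.2.2.1 h.E_ne_zero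
  obtain ⟨c, hc⟩ := h.exists_scale
  have h1 := (hc (fun _ => Y) Y tendsto_const_nhds).2
  have h2 := (IsAttractingFixedPoint.tendsto_pow hlim hy).mono_left hl
  have h3 := mem_submodule_of_tendsto h2 h1 (Eventually.of_forall fun k => by
    rw [← inv_pow]
    exact Submodule.smul_mem _ _ (smul_mem_smul_submodule (g⁻¹ ^ k) y.1 hY))
  have h4 := Submodule.smul_mem _ (bil E Y)⁻¹ h3
  rwa [smul_smul, inv_mul_cancel₀ hEY, one_smul] at h4

/-- A sequence in `ρ(Γ)` whose inverses pull the direction of `y` away from the orthogonal of the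
repelling direction. -/
def HasExpandingSequence (ρ : Γ →* O0 n) (y : R2n n) : Prop :=
  ∃ (l : Ultrafilter ℕ) (h : ℕ → O0 n) (E F : R2n n) (c : ℕ → ℝ) (w : R2n n),
    (∀ i, h i ∈ ρ.range) ∧ ProximalLimit (l : Filter ℕ) h E F ∧
      Tendsto (fun i => c i • (h i)⁻¹ • y) l (𝓝 w) ∧ bil F w ≠ 0

/-- The inverse powers preserve the line of `y`, so they can be rescaled to fix `y`. The repelling
direction `F` lies over the other fixed point, which is transverse to it. -/
lemma IsLoxodromic.hasExpandingSequence (hn : 2 ≤ n) (hΓ : IsHyperbolicGroup S)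
    (hρ : IsP1Anosov S ρ ξ) {z : O0 n} {η₁ η₂ : GromovBoundary S} (hz : IsLoxodromic ρ ξ z η₁ η₂)
    {y : R2n n} (hy : y ∈ (ξ η₁).1.submodule) (hy0 : y ≠ 0) : HasExpandingSequence ρ y := by
  have hl : (hyperfilter ℕ : Filter ℕ) ≤ cofinite := hyperfilter_le_cofinite
  have hr : ∀ k : ℕ, z ^ k ∈ ρ.range := fun k => pow_mem hz.mem k
  obtain ⟨E, F, h⟩ := exists_proximalLimit hn hΓ hρ (hyperfilter ℕ) (fun k => z ^ k) hr
    (hz.attr.injective_pow.tendsto_cofinite.mono_left hl)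
  have hF := hz.attr_inv.mem_of_proximalLimit_inv (hl.trans_eq Nat.cofinite_eq_atTop) h
  have hfix : ∀ k : ℕ, (z ^ k)⁻¹ • y ∈ (ξ η₁).1.submodule := by
    intro k
    have h1 : (z ^ k)⁻¹ • ξ η₁ = ξ η₁ := by
      have h2 : z ∈ MulAction.stabilizer (O0 n) (ξ η₁) := hz.attr.1
      exact inv_mem (pow_mem h2 k)
    have h2 := smul_mem_smul_submodule (z ^ k)⁻¹ (ξ η₁).1 hy
    have h3 : (z ^ k)⁻¹ • (ξ η₁).1 = (ξ η₁).1 := congrArg Subtype.val h1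
    rwa [h3] at h2
  have hc : ∀ k : ℕ, ∃ c : ℝ, y = c • (z ^ k)⁻¹ • y := fun k =>
    exists_smul_of_mem_submodule (hfix k) ((smul_ne_zero_iff_ne _).2 hy0) hy
  choose c hc using hc
  refine ⟨hyperfilter ℕ, fun k => z ^ k, E, F, c, y, hr, h, ?_, ?_⟩
  · exact tendsto_const_nhds.congr hc
  · exact hρ.bil_ne_zero hz.ne.symm hF hy h.F_ne_zero hy0

/-- Pulling back along a conical sequence sends `η` to `η'` and two reference points to the same
`η'' ≠ η'`. The second limit carries `F`, the first carries `w`, and transversality separates them.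
-/
theorem IsP1Anosov.hasExpandingSequence (hn : 2 ≤ n) (hΓ : IsHyperbolicGroup S)
    (hρ : IsP1Anosov S ρ ξ) {y : R2n n} (hy : y ∈ limitCone ξ) (hy0 : y ≠ 0) :
    HasExpandingSequence ρ y := by
  obtain ⟨η, hy⟩ := hy
  have := infinite_of_boundary η
  obtain ⟨z, η₁, η₂, hz⟩ := hρ.exists_isLoxodromic hΓ
  -- The fixed points of `z` are the reference points and must differ from `η`. When `η` is one of
  -- them, powers of `z` or `z⁻¹` are used instead.
  by_cases e1 : η₁ = η
  · subst e1
    exact hz.hasExpandingSequence hn hΓ hρ hy hy0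
  by_cases e2 : η₂ = η
  · subst e2
    exact hz.inv.hasExpandingSequence hn hΓ hρ hy hy0
  obtain ⟨γ, hγ⟩ := exists_conical_limit hΓ η
  set l : Ultrafilter ℕ := hyperfilter ℕ
  have hl : (l : Filter ℕ) ≤ atTop := hyperfilter_le_cofinite.trans_eq Nat.cofinite_eq_atTop
  obtain ⟨η', η'', hne, hη, h₁, h₂⟩ := hγ l hl η₁ η₂ e1 e2
  obtain ⟨X₁, hX₁, hX₁0⟩ := exists_ne_zero_mem_submodule (ξ η₁).1
  obtain ⟨X₂, hX₂, hX₂0⟩ := exists_ne_zero_mem_submodule (ξ η₂).1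
  have hproj : Continuous fun η => (ξ η).1 := continuous_subtype_val.comp hρ.continuous
  have hlim : ∀ {ζ ζ' : GromovBoundary S} {X Y : R2n n} {c : ℕ → ℝ}, X ∈ (ξ ζ).1.submodule →
      Tendsto (fun i => (γ i)⁻¹ • ζ) l (𝓝 ζ') →
      Tendsto (fun i => c i • (ρ (γ i))⁻¹ • X) l (𝓝 Y) → Y ∈ (ξ ζ').1.submodule := by
    intro ζ ζ' X Y c hX hζ hY
    refine mem_submodule_of_tendsto ((hproj.tendsto ζ').comp hζ) hY (Eventually.of_forall ?_)
    intro i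
    rw [← map_inv]
    exact Submodule.smul_mem _ _ (hρ.smul_mem hX _)
  have hb : bil X₁ X₂ ≠ 0 := hρ.bil_ne_zero hz.ne hX₁ hX₂ hX₁0 hX₂0
  have hr : ∀ i, ρ (γ i) ∈ ρ.range := fun i => ⟨γ i, rfl⟩
  -- An ultrafilter of values not finer than `cofinite` is principal. A constant value `a` would put
  -- `a⁻¹ • X₁` and `a⁻¹ • X₂` on one isotropic line, against `b(X₁, X₂) ≠ 0`.
  have hcof : Tendsto (fun i => ρ (γ i)) l cofinite := by
    rcases (l.map fun i => ρ (γ i)).le_cofinite_or_eq_pure with h | ⟨a, ha⟩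
    · exact h
    · exfalso
      have hev : ∀ᶠ i in (l : Filter ℕ), ρ (γ i) = a := by
        have h1 : ({a} : Set (O0 n)) ∈ l.map fun i => ρ (γ i) := by rw [ha]; exact rfl
        exact h1
      have hcon : ∀ X : R2n n,
          Tendsto (fun i => (1 : ℝ) • (ρ (γ i))⁻¹ • X) l (𝓝 (a⁻¹ • X)) := by
        intro X
        refine tendsto_const_nhds.congr' (hev.mono fun i hi => ?_)
        change _ = (1 : ℝ) • (ρ (γ i))⁻¹ • X
        rw [hi, one_smul]
      have h3 := bil_eq_zero_of_mem_ein (x := ξ η'') (hlim hX₁ h₁ (hcon X₁)) (hlim hX₂ h₂ (hcon X₂))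
      rw [bil_smul] at h3
      exact hb h3
  obtain ⟨E, F, h⟩ := exists_proximalLimit hn hΓ hρ l (fun i => ρ (γ i)) hr hcof
  have hE := (hρ.limit_mem hn hΓ hz l hr hcof h).1
  have hF : F ∈ (ξ η'').1.submodule := by
    obtain ⟨c, hc⟩ := h.exists_scale
    have key : ∀ {X : R2n n} {ζ : GromovBoundary S}, X ∈ (ξ ζ).1.submodule →
        Tendsto (fun i => (γ i)⁻¹ • ζ) l (𝓝 η'') → bil E X ≠ 0 → F ∈ (ξ η'').1.submodule := by
      intro X ζ hX hζ hEX
      have h1 := hlim hX hζ (hc (fun _ => X) X tendsto_const_nhds).2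
      have h2 := Submodule.smul_mem _ (bil E X)⁻¹ h1
      rwa [smul_smul, inv_mul_cancel₀ hEX, one_smul] at h2
    rcases hρ.exists_transverse hz.ne hX₁ hX₂ hX₁0 hX₂0 hE h.E_ne_zero with h3 | h3
    · exact key hX₁ h₁ h3
    · exact key hX₂ h₂ h3
  have hnorm : ∀ i, ‖‖(ρ (γ i))⁻¹ • y‖⁻¹ • (ρ (γ i))⁻¹ • y‖ = 1 := by
    intro i
    have h0 : 0 < ‖(ρ (γ i))⁻¹ • y‖ := norm_pos_iff.2 ((smul_ne_zero_iff_ne _).2 hy0)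
    generalize (ρ (γ i))⁻¹ • y = v at h0 ⊢
    rw [norm_smul, norm_inv, norm_norm, inv_mul_cancel₀ h0.ne']
  obtain ⟨w, hw, hwlim⟩ := (isCompact_sphere (0 : R2n n) 1).ultrafilter_le_nhds
    (l.map fun i => ‖(ρ (γ i))⁻¹ • y‖⁻¹ • (ρ (γ i))⁻¹ • y) (by
      rw [le_principal_iff, Ultrafilter.coe_map, mem_map]
      exact univ_mem' fun i => by simpa using hnorm i)
  have hw0 : w ≠ 0 := by
    rintro rfl
    simp at hw
  exact ⟨l, fun i => ρ (γ i), E, F, fun i => ‖(ρ (γ i))⁻¹ • y‖⁻¹, w, hr, h, hwlim,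
    hρ.bil_ne_zero hne.symm hF (hlim hy hη hwlim) h.F_ne_zero hw0⟩

/-- An isotropic vector of a negative semidefinite plane is orthogonal to the plane. -/
lemma bil_eq_zero_of_mem_graphPlane {A : SlopeSpace n} (hA : ‖A‖ ≤ 1) {F w : R2n n}
    (hFq : quad F = 0) (hF : F ∈ (graphPlane A).plane) (hw : w ∈ (graphPlane A).plane) :
    bil F w = 0 := by
  have hneg : ∀ v ∈ (graphPlane A).plane, quad v ≤ 0 := by
    intro v hv
    have h1 := quad_graphMap_nonpos hA (negPart v)
    rwa [graphMap_negPart hv] at h1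
  have hexp : ∀ t : ℝ, 2 * t * bil F w + quad w ≤ 0 := by
    intro t
    have h1 := hneg (t • F + w) (Submodule.add_mem _ (Submodule.smul_mem _ _ hF) hw)
    have h2 : quad (t • F + w) = t * t * quad F + 2 * t * bil F w + quad w := by
      simp only [quad, bil_add_left, bil_add_right, bil_smul_left, bil_smul_right, bil_comm w F]
      ring
    rw [h2, hFq] at h1
    linarith
  by_contra hb
  have h1 := hexp ((1 - quad w) / (2 * bil F w))
  have h2 : 2 * ((1 - quad w) / (2 * bil F w)) * bil F w = 1 - quad w := by field_simp
  linarith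

/-- A plane meeting the limit set is contracted by some element of `ρ(Γ)`. -/
theorem exists_abs_jac_lt_one (hn : 2 ≤ n) (hΓ : IsHyperbolicGroup S) (hρ : IsP1Anosov S ρ ξ)
    {A : SlopeSpace n} (hA : ‖A‖ ≤ 1) {y : R2n n} (hy : y ∈ limitCone ξ) (hy0 : y ≠ 0)
    (hyA : y ∈ (graphPlane A).plane) : ∃ g ∈ ρ.range, |jac g A| < 1 := by
  obtain ⟨l, h, E, F, c, w, hr, hprox, hw, hb⟩ := hρ.hasExpandingSequence hn hΓ hy hy0
  choose A' hA' hhA using fun i => exists_smul_graphPlane (h i)⁻¹ hA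
  obtain ⟨B, hB, hBlim⟩ := (isCompact_closedBall (0 : SlopeSpace n) 1).ultrafilter_le_nhds
    (l.map A') (by
      rw [le_principal_iff, Ultrafilter.coe_map, mem_map]
      exact univ_mem' fun i => by simpa using hA' i)
  have hBlim' : Tendsto A' l (𝓝 B) := hBlim
  rw [mem_closedBall_zero_iff] at hB
  have hwB : w ∈ (graphPlane B).plane := mem_graphPlane_of_tendsto hBlim' hw fun i => by
    refine Submodule.smul_mem _ _ ?_
    rw [← hhA, mem_smul_plane, inv_inv, smul_inv_smul]
    exact hyA
  -- An isotropic vector of a causal plane is orthogonal to that plane, whereas `w` lies in `B` and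
  -- `b(F, w) ≠ 0`.
  have hFB : F ∉ (graphPlane B).plane := fun hF =>
    hb (bil_eq_zero_of_mem_graphPlane hB hprox.facts.2.2.2 hF hwB)
  obtain ⟨i, hi⟩ := ((tendsto_abs_jac l hprox hA' hBlim' hFB).eventually_gt_atTop 1).exists
  refine ⟨(h i)⁻¹, inv_mem (hr i), ?_⟩
  -- The distortions of `h i` and of its inverse are reciprocal, so large expansion of the
  -- pulled-back plane means contraction of the original one by `(h i)⁻¹`.
  have h1 := jac_mul (hhA i) (h i)
  rw [mul_inv_cancel, jac_one] at h1
  have h2 := congrArg abs h1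
  rw [abs_one, abs_mul] at h2
  by_contra hcon
  push Not at hcon
  nlinarith

/-! ### A compact Dirichlet domain and cocompactness -/

/-- The slopes of the planes on which no element of `ρ(Γ)` contracts the area. -/
def dirichletSlopes (ρ : Γ →* O0 n) : Set (SlopeSpace n) :=
  {A | ‖A‖ ≤ 1 ∧ ∀ g ∈ ρ.range, 1 ≤ |jac g A|}

lemma isCompact_dirichletSlopes (ρ : Γ →* O0 n) : IsCompact (dirichletSlopes ρ) := by
  have h1 : dirichletSlopes ρ = Metric.closedBall 0 1 ∩ ⋂ g ∈ ρ.range, {A | 1 ≤ |jac g A|} := by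
    ext A
    simp [dirichletSlopes]
  rw [h1]
  refine (isCompact_closedBall _ _).inter_right (isClosed_biInter fun g _ => ?_)
  exact isClosed_le continuous_const (continuous_jac g).abs

lemma dirichletSlopes_subset (hn : 2 ≤ n) (hΓ : IsHyperbolicGroup S) (hρ : IsP1Anosov S ρ ξ) :
    dirichletSlopes ρ ⊆ avoidingSlopes hρ := by
  rintro A ⟨hA, h⟩
  refine (mem_avoidingGeodesics_iff hρ).2
    ⟨graphPlane_mem_causalGeodesics hA, fun y hy hy0 hyA => ?_⟩
  obtain ⟨g, hg, hlt⟩ := exists_abs_jac_lt_one hn hΓ hρ hA hy hy0 hyA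
  exact (h g hg).not_gt hlt

/-- Only finitely many elements of `ρ(Γ)` contract the area of a plane avoiding the limit set. -/
lemma finite_abs_jac_le_one (hn : 2 ≤ n) (hΓ : IsHyperbolicGroup S) (hρ : IsP1Anosov S ρ ξ)
    {A : SlopeSpace n} (hA : A ∈ avoidingSlopes hρ) :
    {g : ρ.range | |jac g.1 A| ≤ 1}.Finite := by
  by_contra hinf
  obtain ⟨l, hl, hmem⟩ := exists_ultrafilter_of_infinite hinf
  have hrange : Infinite ρ.range := Set.infinite_univ_iff.1 (Set.Infinite.mono (Set.subset_univ _) hinf)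
  have hΓi := infinite_of_range hrange
  obtain ⟨z, η₁, η₂, hz⟩ := hρ.exists_isLoxodromic hΓ
  have hg : ∀ g : ρ.range, g.1 ∈ ρ.range := fun g => g.2
  have hgl : Tendsto (fun g : ρ.range => g.1) l cofinite :=
    Subtype.val_injective.tendsto_cofinite.mono_left hl
  obtain ⟨E, F, h⟩ := exists_proximalLimit hn hΓ hρ l _ hg hgl
  have hF := (hρ.limit_mem hn hΓ hz l hg hgl h).2
  obtain ⟨hAc, hAΛ⟩ := (mem_avoidingGeodesics_iff hρ).1 hA
  have h1 := tendsto_abs_jac l h (fun _ => norm_le_one_of_mem hAc) (tendsto_const_nhds (x := A))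
    (hAΛ F hF h.F_ne_zero)
  obtain ⟨g, hg1, hg2⟩ := ((h1.eventually_gt_atTop 1).and hmem).exists
  exact absurd hg2 (not_le.2 hg1)

/-- Only finitely many elements have distortion at most `1`, and the identity is one of them, so a
minimising `g` exists. By the cocycle rule no element decreases area on `g P`. -/
lemma exists_smul_mem_dirichletSlopes (hn : 2 ≤ n) (hΓ : IsHyperbolicGroup S)
    (hρ : IsP1Anosov S ρ ξ) {A : SlopeSpace n} (hA : A ∈ avoidingSlopes hρ) :
    ∃ g : ρ.range, ∃ A' ∈ dirichletSlopes ρ, g.1 • graphPlane A = graphPlane A' := by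
  have hfin := finite_abs_jac_le_one hn hΓ hρ hA
  have h1 : (1 : ρ.range) ∈ {g : ρ.range | |jac g.1 A| ≤ 1} := by
    change |jac (1 : O0 n) A| ≤ 1
    rw [jac_one, abs_one]
  obtain ⟨g, hg, hmin⟩ := Set.exists_min_image _ (fun g : ρ.range => |jac g.1 A|) hfin ⟨1, h1⟩
  have hmin' : ∀ k : ρ.range, |jac g.1 A| ≤ |jac k.1 A| := by
    intro k
    by_cases hk : |jac k.1 A| ≤ 1
    · exact hmin k hk
    · exact le_trans hg (not_le.1 hk).le
  have hA1 : ‖A‖ ≤ 1 := norm_le_one_of_mem ((mem_avoidingGeodesics_iff hρ).1 hA).1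
  obtain ⟨A', hA', h⟩ := exists_smul_graphPlane g.1 hA1
  refine ⟨g, A', ⟨hA', fun k hk => ?_⟩, h⟩
  have h2 := hmin' (⟨k, hk⟩ * g)
  change |jac g.1 A| ≤ |jac (k * g.1) A| at h2
  have h3 := jac_mul h g.1⁻¹
  rw [inv_mul_cancel, jac_one] at h3
  have h4 : 0 < |jac g.1 A| := by
    refine abs_pos.2 fun h0 => ?_
    rw [h0, mul_zero] at h3
    exact one_ne_zero h3
  rw [jac_mul h, abs_mul] at h2
  exact le_of_mul_le_mul_right (by rwa [one_mul]) h4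

theorem compactSpace_quotient_avoidingGeodesics (hn : 2 ≤ n) (hΓ : IsHyperbolicGroup S)
    (hρ : IsP1Anosov S ρ ξ) :
    CompactSpace (Quotient (MulAction.orbitRel ρ.range (avoidingGeodesics hρ))) := by
  have := isCompact_iff_compactSpace.1 (isCompact_dirichletSlopes ρ)
  have hsub := dirichletSlopes_subset hn hΓ hρ
  let f : dirichletSlopes ρ → Quotient (MulAction.orbitRel ρ.range (avoidingGeodesics hρ)) :=
    fun A => Quotient.mk _ (slopeHomeo hρ ⟨A.1, hsub A.2⟩)
  have hf : Continuous f := continuous_quotient_mk'.comp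
    ((slopeHomeo hρ).continuous.comp (continuous_subtype_val.subtype_mk _))
  have hsurj : Function.Surjective f := by
    intro q
    induction q using Quotient.inductionOn with
    | h P =>
      obtain ⟨⟨A, hA⟩, rfl⟩ := (slopeHomeo hρ).surjective P
      obtain ⟨g, A', hA', h⟩ := exists_smul_mem_dirichletSlopes hn hΓ hρ hA
      refine ⟨⟨A', hA'⟩, Quotient.sound ⟨g, Subtype.ext ?_⟩⟩
      exact h
  exact hsurj.compactSpace hf

theorem t2Space_quotient_avoidingGeodesics (hn : 2 ≤ n) (hΓ : IsHyperbolicGroup S)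
    (hρ : IsP1Anosov S ρ ξ) :
    T2Space (Quotient (MulAction.orbitRel ρ.range (avoidingGeodesics hρ))) := by
  have := properlyDiscontinuous_avoidingGeodesics hn hΓ hρ
  have := t2Space_avoidingGeodesics hρ
  have := locallyCompactSpace_avoidingGeodesics hΓ hρ
  exact t2Space_of_properlyDiscontinuousSMul_of_t2Space

/-! ### The timelike quotient as a dense open subset -/

lemma timelike_mem_avoidingGeodesics (hρ : IsP1Anosov S ρ ξ) {P : Gr2 n}
    (hP : P ∈ timelikeGeodesics n) : P ∈ avoidingGeodesics hρ :=
  (mem_avoidingGeodesics_iff hρ).2 ⟨Or.inl hP, fun y hy hy0 hyP =>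
    (hP y hyP hy0).ne (quad_of_mem_limitCone hy)⟩

/-- The inclusion of the timelike geodesics in the causal geodesics that avoid the limit set. -/
def timelikeInclusion (hρ : IsP1Anosov S ρ ξ) (P : timelikeGeodesics n) : avoidingGeodesics hρ :=
  ⟨P.1, timelike_mem_avoidingGeodesics hρ P.2⟩

lemma isOpen_timelikeGeodesics : IsOpen (timelikeGeodesics n : Set (Gr2 n)) := by
  have h : (timelikeGeodesics n : Set (Gr2 n)) = graphPlane '' Metric.ball 0 1 := by
    ext P
    constructor
    · intro hP
      obtain ⟨A, -, rfl⟩ := exists_graphPlane (P := P) (Or.inl hP)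
      exact ⟨A, mem_ball_zero_iff.2 (isTimelike_graphPlane_iff.1 hP), rfl⟩
    · rintro ⟨A, hA, rfl⟩
      exact isTimelike_graphPlane_iff.2 (mem_ball_zero_iff.1 hA)
  rw [h]
  exact isOpenMap_graphPlane _ Metric.isOpen_ball

lemma continuous_timelikeInclusion (hρ : IsP1Anosov S ρ ξ) : Continuous (timelikeInclusion hρ) :=
  continuous_subtype_val.subtype_mk _

lemma isOpenMap_timelikeInclusion (hρ : IsP1Anosov S ρ ξ) : IsOpenMap (timelikeInclusion hρ) := by
  intro W hW
  have h1 := isOpen_timelikeGeodesics.isOpenMap_subtype_val W hW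
  have h2 : timelikeInclusion hρ '' W =
      (Subtype.val : avoidingGeodesics hρ → Gr2 n) ⁻¹' (Subtype.val '' W) := by
    ext Q
    constructor
    · rintro ⟨P, hP, rfl⟩
      exact ⟨P, hP, rfl⟩
    · rintro ⟨P, hP, h⟩
      exact ⟨P, hP, Subtype.ext h⟩
  rw [h2]
  exact h1.preimage continuous_subtype_val

/-- A slope `A` in the closed unit ball is the limit of `t • A` as `t` increases to `1`, and these
have norm less than `1`. -/
lemma denseRange_timelikeInclusion (hρ : IsP1Anosov S ρ ξ) :
    DenseRange (timelikeInclusion hρ) := by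
  intro Q
  obtain ⟨A, hA, hAQ⟩ := exists_graphPlane ((mem_avoidingGeodesics_iff hρ).1 Q.2).1
  have hlim : Tendsto (fun t : ℝ => t • A) (𝓝[<] 1) (𝓝 A) := by
    have h1 : Tendsto (fun t : ℝ => t • A) (𝓝 1) (𝓝 ((1 : ℝ) • A)) :=
      (continuous_id.smul continuous_const).tendsto 1
    rw [one_smul] at h1
    exact h1.mono_left nhdsWithin_le_nhds
  have h2 := (continuous_graphPlane.tendsto A).comp hlim
  rw [hAQ] at h2
  rw [(IsEmbedding.subtypeVal (p := (· ∈ avoidingGeodesics hρ))).closure_eq_preimage_closure_image]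
  refine mem_closure_of_tendsto h2 ?_
  have h3 : ∀ᶠ t : ℝ in 𝓝[<] 1, 0 < t := eventually_nhdsWithin_of_eventually_nhds
    (lt_mem_nhds one_pos)
  filter_upwards [h3, self_mem_nhdsWithin] with t ht ht1
  have h4 : ‖t • A‖ < 1 := by
    rw [norm_smul, Real.norm_of_nonneg ht.le]
    have := mul_le_mul_of_nonneg_left hA ht.le
    rw [mul_one] at this
    exact this.trans_lt ht1
  exact ⟨_, ⟨⟨graphPlane (t • A), isTimelike_graphPlane_iff.2 h4⟩, rfl⟩, rfl⟩

/-- The map induced by the inclusion between the quotients by `ρ(Γ)`. -/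
def quotientInclusion (hρ : IsP1Anosov S ρ ξ) :
    Quotient (MulAction.orbitRel ρ.range (timelikeGeodesics n)) →
      Quotient (MulAction.orbitRel ρ.range (avoidingGeodesics hρ)) :=
  Quotient.map (timelikeInclusion hρ) (by
    rintro _ P ⟨g, rfl⟩
    exact ⟨g, rfl⟩)

lemma quotientInclusion_injective (hρ : IsP1Anosov S ρ ξ) :
    Function.Injective (quotientInclusion hρ) := by
  intro p q
  induction p using Quotient.inductionOn with
  | h P =>
    induction q using Quotient.inductionOn with
    | h Q =>
      intro h
      obtain ⟨g, hg⟩ := Quotient.exact h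
      have hval : ((g • timelikeInclusion hρ Q : avoidingGeodesics hρ) : Gr2 n) = P.1 :=
        congrArg Subtype.val hg
      exact Quotient.sound ⟨g, Subtype.ext hval⟩

/-- The projection to a quotient by a group of homeomorphisms is open, so openness descends from the
inclusion of `𝒯` in `U`. -/
lemma isOpenEmbedding_quotientInclusion (hρ : IsP1Anosov S ρ ξ) :
    IsOpenEmbedding (quotientInclusion hρ) := by
  refine .of_continuous_injective_isOpenMap ?_ (quotientInclusion_injective hρ) ?_
  · exact (continuous_quotient_mk'.comp (continuous_timelikeInclusion hρ)).quotient_lift _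
  · intro W hW
    have h1 : quotientInclusion hρ '' W = Quotient.mk _ '' (timelikeInclusion hρ ''
        (Quotient.mk _ ⁻¹' W)) := by
      ext q
      constructor
      · rintro ⟨p, hp, rfl⟩
        induction p using Quotient.inductionOn with
        | h P => exact ⟨_, ⟨P, hp, rfl⟩, rfl⟩
      · rintro ⟨_, ⟨P, hP, rfl⟩, rfl⟩
        exact ⟨_, hP, rfl⟩
    rw [h1]
    exact isOpenMap_quotient_mk'_mul _
      (isOpenMap_timelikeInclusion hρ _ (hW.preimage continuous_quotient_mk'))

lemma denseRange_quotientInclusion (hρ : IsP1Anosov S ρ ξ) :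
    DenseRange (quotientInclusion hρ) := by
  have h1 : DenseRange (Quotient.mk (MulAction.orbitRel ρ.range (avoidingGeodesics hρ)) ∘
      timelikeInclusion hρ) :=
    Quotient.mk_surjective.denseRange.comp (denseRange_timelikeInclusion hρ) continuous_quotient_mk'
  refine h1.mono ?_
  rintro _ ⟨P, rfl⟩
  exact ⟨Quotient.mk _ P, rfl⟩

end Avoiding

end CausalGeod

end

open CausalGeod
theorem theorem4p1 (n : ℕ) (hn : 2 ≤ n) {Γ : Type*} [Group Γ] (S : Finset Γ)
    (hΓ : IsHyperbolicGroup S) (ρ : Γ →* O0 n) (ξ : GromovBoundary S → Ein n)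
    (hρ : IsP1Anosov S ρ ξ) :
    -- `ρ(Γ)` acts properly discontinuously and cocompactly on `U`
    ProperlyDiscontinuousSMul ρ.range (avoidingGeodesics hρ) ∧
    CompactSpace (Quotient (MulAction.orbitRel ρ.range (avoidingGeodesics hρ))) ∧
    -- `U` contains the space of timelike geodesics, and `ρ(Γ)\U` compactifies its quotient
    T2Space (Quotient (MulAction.orbitRel ρ.range (avoidingGeodesics hρ))) ∧
    ∃ hT : ∀ P ∈ timelikeGeodesics n, P ∈ avoidingGeodesics hρ,
      ∃ j : Quotient (MulAction.orbitRel ρ.range (timelikeGeodesics n)) →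
          Quotient (MulAction.orbitRel ρ.range (avoidingGeodesics hρ)),
        (∀ P : timelikeGeodesics n,
          j (Quotient.mk _ P) = Quotient.mk _ ⟨P.1, hT P.1 P.2⟩) ∧
        Topology.IsOpenEmbedding j ∧ DenseRange j :=
  ⟨properlyDiscontinuous_avoidingGeodesics hn hΓ hρ,
    compactSpace_quotient_avoidingGeodesics hn hΓ hρ, t2Space_quotient_avoidingGeodesics hn hΓ hρ,
    fun _ hP => timelike_mem_avoidingGeodesics hρ hP, quotientInclusion hρ, fun _ => rfl,
    isOpenEmbedding_quotientInclusion hρ, denseRange_quotientInclusion hρ⟩
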